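/- All graphs are finite, undirected and simple. Let $k,a,b$ be positive integers with $k\ge 2$ and $a\le b$. **Rays and forks.** A *ray* of length $n$ in a tree $T$ is a path $x_0,\dots,x_n$ with $\deg(x_0)>2$, $\deg(x_1)=\dots=\deg(x_{n-1})=2$ and $\deg(x_n)=1$; its *source* is $x_0$. Write $\deg_{\mathrm{leaf}}(s)$ for the number of rays with source $s$. A vertex $s$ of degree greater than $2$ is an *$a$-$b$-fork* if $\deg(s)-\deg_{\mathrm{leaf}}(s)=1$ and, if $a\ne b$, $s$ is the source of a ray of length $a$ and of a ray of length $b$, and, if $a=b$, $s$ is the source of at least two rays of length $a$. **The data.** Let $T$ be a tree with an independent set of $2k$ $a$-$b$-forks $s_i^j$ ($1\le i\le k$, $j\in\{1,2\}$), indexed so that $\deg_{\mathrm{leaf}}(s_1^1)\ge\deg_{\mathrm{leaf}}(s_1^2)\ge\dots\ge\deg_{\mathrm{leaf}}(s_k^1)\ge\deg_{\mathrm{leaf}}(s_k^2)$. For each $(i,j)$ fix two distinct rays $F_a(i,j)$ and $F_b(i,j)$ with source $s_i^j$, of length $a$ and $b$ respectively. Let $F\subseteq V(T)$ be the set of all vertices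 of these $4k$ rays (including the $s_i^j$). Let $\Delta$ be a bipartite cubic graph with vertices $v_1,\dots,v_k$ and let $C:E(\Delta)\to\{s,m,\ell\}$ be a proper $3$-edge-colouring. **The graph $Q$.** For each $i$ take a gadget consisting of two vertices $v_i^1,v_i^2$, three vertices named $s,m,\ell$, and four internally disjoint paths: from $v_i^1$ to $s$ of length $a$, from $v_i^1$ to $m$ of length $b$, from $v_i^2$ to $v_i^1$ of length $a$, and from $v_i^2$ to $\ell$ of length $b$. For every edge $e=\{v_i,v_{i'}\}$ of $\Delta$, identify the vertex named $C(e)$ in the gadget of $v_i$ with the vertex named $C(e)$ in the gadget of $v_{i'}$. The result is $Q$. **The fractured graph.** A *fracture* $\rho$ of $Q$ assigns to each $v\in V(Q)$ a partition $\rho_v$ of the set of edges incident to $v$. The fractured graph $Q_\rho$ has a vertex $v^B$ for each $v\in V(Q)$ and each block $B\in\rho_v$, and for each edge $e=\{u,v\}$ of $Q$ an edge between $u^B$ and $v^{B'}$, where $e\in B\in\rho_u$ and $e\in B'\in\rho_v$. Its canonical colouring $c_\rho$ maps $v^B$ to $v$. Let $\tau$ be the following fracture of $Q$: at each identified vertex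 (named $s$, $m$ or $\ell$) it consists of two singleton blocks; at $v_i^1$ it is $\{\{e_s,e_m\},\{e_\ell\}\}$, where $e_s,e_m,e_\ell$ are the first edges of the paths of the gadget from $v_i^1$ to $s$, to $m$, and (via $v_i^2$) to $\ell$; at all other vertices it has one block. **The edge-coloured graph $(\hat G,\hat\gamma)$.** Let $\gamma:F\to V(Q)$ map, vertex by vertex and starting with $\gamma(s_i^j)=v_i^j$, the rays $F_a(i,1)$, $F_b(i,1)$, $F_a(i,2)$, $F_b(i,2)$ to the paths of the gadget of $v_i$ from $v_i^1$ to $s$, from $v_i^1$ to $m$, from $v_i^2$ to $v_i^1$, and from $v_i^2$ to $\ell$, respectively. The map $\{x,y\}\mapsto\{\gamma(x),\gamma(y)\}$ is a bijection $\gamma_E:E(T[F])\to E(Q)$. Let $(G,c)$ be a $Q$-coloured graph, that is, a graph $G$ with a homomorphism $c:G\to Q$. The graph $\hat G$ has vertex set $V(G)\,\dot\cup\,(V(T)\setminus F)$, and its edges and their colours $\hat\gamma(\cdot)\in E(T)$ are: * each edge $\{g,g'\}$ of $G$, with colour $\gamma_E^{-1}(\{c(g),c(g')\})$; * each edge $e$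 of $T$ between two vertices of $V(T)\setminus F$, with colour $e$; * for each edge $\{z,y\}$ of $T$ with $z\notin F$ and $y\in F$, all edges $\{z,g\}$ with $g\in V(G)$ and $c(g)=\gamma(y)$, with colour $\{z,y\}$. **Claim.** Suppose that $|c^{-1}(v)|$ is odd for every $v\in V(Q)$. Then the number of subgraphs of $\hat G$ that are isomorphic to $T$ and contain exactly one edge of each colour in $E(T)$ is congruent modulo $2$ to the number of colour-preserving embeddings of $(Q_\tau,c_\tau)$ in $(G,c)$, that is, of injective homomorphisms $\varphi:Q_\tau\to G$ with $c(\varphi(x))=c_\tau(x)$ for all $x\in V(Q_\tau)$. -/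

import Mathlib

namespace ForkNumber

noncomputable section

/-! ### Colour-preserving embeddings and edge-colourful copies -/

section Colours

variable {U V W : Type*}

/-- The `Q`-coloured graphs `(H, cH)` and `(G, cG)` are given by homomorphisms `cH : H →g Q` and
`cG : G →g Q`. This is the set of colour-preserving embeddings of `(H, cH)` in `(G, cG)`, that is,
of injective homomorphisms `φ` from `H` to `G` with `cG (φ v) = cH v` for all `v`. -/
def colEmb {H : SimpleGraph U} {G : SimpleGraph V} {Q : SimpleGraph W}
    (cH : H →g Q) (cG : G →g Q) : Set (H →g G) :=
  {φ | Function.Injective φ ∧ ∀ v, cG (φ v) = cH v}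

/-- The set of subgraphs of the edge-coloured graph `(G, γ)` that are isomorphic to `H` and contain
each edge colour precisely once. -/
def colSub {κ : Type*} (H : SimpleGraph U) (G : SimpleGraph V) (γ : G.edgeSet → κ) :
    Set G.Subgraph :=
  {S | Nonempty (S.coe ≃g H) ∧ ∀ x : κ, ∃! e : G.edgeSet, (e : Sym2 V) ∈ S.edgeSet ∧ γ e = x}

end Colours

/-! ### Fractures and fractured graphs -/

section Fractures

variable {V : Type*} {Q : SimpleGraph V}

/-- A fracture of `Q`: for each vertex `v` a partition (given by its equivalence relation) of the
set of edges of `Q` that are incident to `v`. -/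
def Fracture (Q : SimpleGraph V) : Type _ := ∀ v : V, Setoid (Q.incidenceSet v)

/-- The vertices `v^B` of the fractured graph: pairs of a vertex `v` of `Q` and a block `B` of the
partition at `v`. -/
def Fracture.Vertex (ρ : Fracture Q) : Type _ := Σ v : V, Quotient (ρ v)

/-- The fractured graph: each edge `e = {u, v}` of `Q` yields an edge between `u^B` and `v^B'`,
where `B` and `B'` are the blocks that contain `e`. -/
def Fracture.graph (ρ : Fracture Q) : SimpleGraph ρ.Vertex where
  Adj x y := ∃ (e : Sym2 V) (hx : e ∈ Q.incidenceSet x.1) (hy : e ∈ Q.incidenceSet y.1),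
    e = s(x.1, y.1) ∧ x.2 = Quotient.mk (ρ x.1) ⟨e, hx⟩ ∧ y.2 = Quotient.mk (ρ y.1) ⟨e, hy⟩
  symm := by
    constructor
    rintro x y ⟨e, hx, hy, he, h1, h2⟩
    exact ⟨e, hy, hx, by rw [he, Sym2.eq_swap], h2, h1⟩
  loopless := by
    constructor
    rintro x ⟨e, hx, hy, he, h1, h2⟩
    have := hx.1
    rw [he] at this
    exact Q.loopless.irrefl _ this

/-- The canonical `Q`-colouring of the fractured graph: `v^B` is mapped to `v`. -/
def Fracture.canonicalColouring (ρ : Fracture Q) : ρ.graph →g Q where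
  toFun x := x.1
  map_rel' := by
    rintro x y ⟨e, hx, hy, he, h1, h2⟩
    have := hx.1
    rw [he] at this
    exact this

end Fractures

/-! ### Rays and forks of a tree -/

section Rays

variable {V : Type*} (T : SimpleGraph V) [T.LocallyFinite]

/-- `x 0, …, x n` is a `2`-path of length `n`: a path whose endpoints do not have degree `2` and
whose inner vertices all have degree `2`. -/
def IsTwoPath (n : ℕ) (x : Fin (n + 1) → V) : Prop :=
  Function.Injective x ∧ (∀ t : Fin n, T.Adj (x t.castSucc) (x t.succ)) ∧
    T.degree (x 0) ≠ 2 ∧ (∀ t, t ≠ 0 → t ≠ Fin.last n → T.degree (x t) = 2) ∧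
    T.degree (x (Fin.last n)) ≠ 2

/-- A ray is a `2`-path from a source `x 0`, that is, a vertex of degree greater than `2`, to a
vertex `x n` of degree `1`. -/
def IsRay (n : ℕ) (x : Fin (n + 1) → V) : Prop :=
  IsTwoPath T n x ∧ 2 < T.degree (x 0) ∧ T.degree (x (Fin.last n)) = 1

/-- The number of rays of length `n` with source `s`. -/
def degRay (n : ℕ) (s : V) : ℕ := Nat.card {x : Fin (n + 1) → V // IsRay T n x ∧ x 0 = s}

/-- The number of rays (of any length) with source `s`; in a finite graph a ray of length `n` has
`n + 1` distinct vertices, so that `n` is less than the number of vertices. -/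
def degLeaves (s : V) : ℕ := ∑ n ∈ Finset.range (Nat.card V), degRay T n s

/-- The degree minus the number of rays. -/
def degNonleaves (s : V) : ℤ := (T.degree s : ℤ) - degLeaves T s

/-- The vertex `s` is an `a`-`b`-fork. -/
def IsFork (a b : ℕ) (s : V) : Prop :=
  2 < T.degree s ∧ degNonleaves T s = 1 ∧
    ((a ≠ b ∧ 0 < degRay T a s ∧ 0 < degRay T b s) ∨ (a = b ∧ 1 < degRay T a s))

variable {T} in
/-- A neighbour of a vertex of a ray other than its source is on the ray, next to it. -/
theorem IsRay.neighbour {n : ℕ} {x : Fin (n + 1) → V} (hx : IsRay T n x) (t : Fin (n + 1))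
    (ht : t ≠ 0) (w : V) (hw : T.Adj (x t) w) :
    ∃ t' : Fin (n + 1), x t' = w ∧ (t'.val = t.val + 1 ∨ t'.val + 1 = t.val) := by
  classical
  obtain ⟨⟨hinj, hadj, -, hmid, -⟩, -, hlast⟩ := hx
  have ht0 : 0 < t.val := Nat.pos_of_ne_zero fun h => ht (Fin.ext h)
  have hprev : T.Adj (x t) (x ⟨t.val - 1, by omega⟩) := by
    have := hadj ⟨t.val - 1, by omega⟩
    have e : (⟨t.val - 1, by omega⟩ : Fin n).succ = t := Fin.ext (by simp; omega)
    rw [e] at this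
    exact this.symm
  by_cases hl : t = Fin.last n
  · rw [← hl] at hlast
    obtain ⟨z, -, hz⟩ := SimpleGraph.degree_eq_one_iff_existsUnique_adj.1 hlast
    exact ⟨_, (hz _ hprev).trans (hz _ hw).symm, Or.inr (by simp; omega)⟩
  · have hlt : t.val < n := by
      rcases Nat.lt_or_ge t.val n with h | h
      · exact h
      · exact absurd (Fin.ext (by simp; omega)) hl
    have hnext : T.Adj (x t) (x ⟨t.val + 1, by omega⟩) := hadj ⟨t.val, hlt⟩
    have h2 := hmid t ht hl
    rw [← SimpleGraph.card_neighborFinset_eq_degree, Finset.card_eq_two] at h2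
    obtain ⟨p, q, -, hpq⟩ := h2
    have key : ∀ z, T.Adj (x t) z → z = p ∨ z = q := by
      intro z hz
      rw [← SimpleGraph.mem_neighborFinset, hpq] at hz
      simpa using hz
    have hne : x ⟨t.val - 1, by omega⟩ ≠ x ⟨t.val + 1, by omega⟩ := by
      intro h
      have : t.val - 1 = t.val + 1 := congrArg Fin.val (hinj h)
      omega
    have h3 : w = x ⟨t.val - 1, by omega⟩ ∨ w = x ⟨t.val + 1, by omega⟩ := by
      rcases key _ hprev with h | h <;> rcases key _ hnext with h' | h' <;>
        rcases key _ hw with h'' | h'' <;> simp_all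
    rcases h3 with h | h
    · exact ⟨_, h.symm, Or.inr (by simp; omega)⟩
    · exact ⟨_, h.symm, Or.inl rfl⟩

variable {T} in
theorem IsRay.degree_le {n : ℕ} {x : Fin (n + 1) → V} (hx : IsRay T n x) (t : Fin (n + 1))
    (ht : t ≠ 0) : T.degree (x t) ≤ 2 := by
  by_cases hl : t = Fin.last n
  · rw [hl, hx.2.2]
    omega
  · rw [hx.1.2.2.2.1 t ht hl]

variable {T} in
/-- If two rays share a vertex other than their sources, then the first contains the second and
they have the same source. -/
theorem IsRay.share {n m : ℕ} {x : Fin (n + 1) → V} {y : Fin (m + 1) → V} (hx : IsRay T n x)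
    (hy : IsRay T m y) (t : Fin (n + 1)) (u : Fin (m + 1)) (ht : t ≠ 0) (hu : u ≠ 0)
    (h : x t = y u) : Set.range y ⊆ Set.range x ∧ y 0 = x 0 := by
  have step : ∀ v w : Fin (m + 1), w ≠ 0 → T.Adj (y v) (y w) → (∃ t, t ≠ 0 ∧ x t = y v) →
      ∃ t, t ≠ 0 ∧ x t = y w := by
    rintro v w hw hvw ⟨t, ht, htv⟩
    rw [← htv] at hvw
    obtain ⟨t', ht', -⟩ := hx.neighbour t ht _ hvw
    refine ⟨t', ?_, ht'⟩
    rintro rfl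
    have h1 := hx.2.1
    rw [ht'] at h1
    have h2 := hy.degree_le w hw
    omega
  have hadj := hy.1.2.1
  have up : ∀ d : ℕ, ∀ v : Fin (m + 1), v.val = u.val + d → ∃ t, t ≠ 0 ∧ x t = y v := by
    intro d
    induction d with
    | zero =>
      intro v hv
      obtain rfl : v = u := Fin.ext hv
      exact ⟨t, ht, h⟩
    | succ d ih =>
      intro v hv
      have := hadj ⟨u.val + d, by omega⟩
      have e : (⟨u.val + d, by omega⟩ : Fin m).succ = v := Fin.ext (by simp; omega)
      rw [e] at this
      exact step _ v (by rintro rfl; simp at hv) this (ih _ rfl)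
  have down : ∀ d : ℕ, ∀ v : Fin (m + 1), v ≠ 0 → v.val + d = u.val →
      ∃ t, t ≠ 0 ∧ x t = y v := by
    intro d
    induction d with
    | zero =>
      intro v hv0 hv
      obtain rfl : v = u := Fin.ext hv
      exact ⟨t, ht, h⟩
    | succ d ih =>
      intro v hv0 hv
      have := hadj ⟨v.val, by omega⟩
      exact step _ v hv0 this.symm (ih _ (Fin.succ_ne_zero _) (by
        rw [Fin.val_succ]
        change v.val + 1 + d = u.val
        omega))
  have all : ∀ v : Fin (m + 1), v ≠ 0 → ∃ t, t ≠ 0 ∧ x t = y v := by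
    intro v hv
    rcases le_total u.val v.val with hle | hle
    · exact up (v.val - u.val) v (by omega)
    · exact down (u.val - v.val) v hv (by omega)
  have hm : 0 < m := by
    have : 0 < u.val := Nat.pos_of_ne_zero fun h => hu (Fin.ext h)
    omega
  have hsrc : y 0 = x 0 := by
    obtain ⟨t1, ht1, ht1y⟩ := all ⟨1, by omega⟩ (by simp [Fin.ext_iff])
    have h01 : T.Adj (y 0) (y ⟨1, by omega⟩) := hadj ⟨0, hm⟩
    rw [← ht1y] at h01
    obtain ⟨t', ht', -⟩ := hx.neighbour t1 ht1 _ h01.symm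
    by_cases h0 : t' = 0
    · rw [← ht', h0]
    · have h1 := hx.degree_le t' h0
      have h2 := hy.2.1
      rw [ht'] at h1
      omega
  refine ⟨?_, hsrc⟩
  rintro _ ⟨v, rfl⟩
  by_cases hv : v = 0
  · exact ⟨0, by rw [hv, hsrc]⟩
  · obtain ⟨t', -, ht'⟩ := all v hv
    exact ⟨t', ht'⟩

end Rays

/-- The two kinds of designated rays: `A` for length `a`, and `B` for length `b`. -/
inductive Arm
  | A
  | B
  deriving DecidableEq

/-- The length of a designated ray. -/
def Arm.len (a b : ℕ) : Arm → ℕ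
  | .A => a
  | .B => b

/-- A choice of `2k` designated sources `s_i^j` of `T` that are `a`-`b`-forks and form an
independent set of size `2k`, ordered by the number of their rays, together with two distinct
designated rays `F_a(i,j)` and `F_b(i,j)` of lengths `a` and `b` at each of them. The index `j` is
`0` or `1` instead of `1` or `2`. -/
structure DesignatedForks {V : Type*} (T : SimpleGraph V) [T.LocallyFinite] (k a b : ℕ) where
  /-- The designated sources `s_i^j`. -/
  src : Fin k × Fin 2 → V
  src_injective : Function.Injective src
  src_fork : ∀ p, IsFork T a b (src p)
  src_indep : T.IsIndepSet (Set.range src)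
  src_order : ∀ p q, toLex p ≤ toLex q → degLeaves T (src q) ≤ degLeaves T (src p)
  /-- The designated rays `F_a(i,j)` and `F_b(i,j)`. -/
  ray : (p : Fin k × Fin 2) → (r : Arm) → Fin (r.len a b + 1) → V
  ray_isRay : ∀ p r, IsRay T (r.len a b) (ray p r)
  ray_src : ∀ p r, ray p r 0 = src p
  ray_distinct : ∀ p, Set.range (ray p .A) ≠ Set.range (ray p .B)

/-- The set `F` of all vertices of the designated rays, including the designated sources. -/
def DesignatedForks.F {V : Type*} {T : SimpleGraph V} [T.LocallyFinite] {k a b : ℕ}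
    (D : DesignatedForks T k a b) : Set V :=
  {y | ∃ p r t, D.ray p r t = y}

/-- The designated rays are disjoint, up to their sources. -/
theorem DesignatedForks.ray_eq {V : Type*} {T : SimpleGraph V} [T.LocallyFinite] {k a b : ℕ}
    (D : DesignatedForks T k a b) {p p' : Fin k × Fin 2} {r r' : Arm}
    {t : Fin (r.len a b + 1)} {t' : Fin (r'.len a b + 1)} (h : D.ray p r t = D.ray p' r' t') :
    p = p' ∧ t.val = t'.val ∧ (t ≠ 0 → r = r') := by
  by_cases ht : t = 0
  · by_cases ht' : t' = 0
    · subst ht ht'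
      rw [D.ray_src, D.ray_src] at h
      exact ⟨D.src_injective h, rfl, fun h => absurd rfl h⟩
    · have h1 := (D.ray_isRay p' r').degree_le t' ht'
      have h2 := (D.ray_isRay p r).2.1
      rw [← ht, h] at h2
      omega
  · by_cases ht' : t' = 0
    · have h1 := (D.ray_isRay p r).degree_le t ht
      have h2 := (D.ray_isRay p' r').2.1
      rw [← ht', ← h] at h2
      omega
    · have h1 := (D.ray_isRay p r).share (D.ray_isRay p' r') t t' ht ht' h
      have h2 := (D.ray_isRay p' r').share (D.ray_isRay p r) t' t ht' ht h.symm
      have hp : p = p' := by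
        have := h1.2
        rw [D.ray_src, D.ray_src] at this
        exact (D.src_injective this).symm
      subst hp
      have hr : r = r' := by
        have hd := D.ray_distinct p
        have he := h1.1.antisymm h2.1
        cases r <;> cases r' <;> simp_all
      subst hr
      exact ⟨rfl, congrArg Fin.val ((D.ray_isRay p r).1.1 h), fun _ => rfl⟩

/-- An edge of `T` with an endpoint in `F` is an edge of a designated ray, or it leaves `F` at a
designated source. -/
theorem DesignatedForks.adj_cases {V : Type*} {T : SimpleGraph V} [T.LocallyFinite] {k a b : ℕ}
    (D : DesignatedForks T k a b) {y w : V} (hy : y ∈ D.F) (h : T.Adj y w) :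
    (∃ p, y = D.src p ∧ w ∉ D.F) ∨
      ∃ p r, ∃ t : Fin (r.len a b), s(y, w) = s(D.ray p r t.castSucc, D.ray p r t.succ) := by
  have main : ∀ (p : Fin k × Fin 2) (r : Arm) (t : Fin (r.len a b + 1)) (w : V), t ≠ 0 →
      T.Adj (D.ray p r t) w → ∃ u : Fin (r.len a b),
        s(D.ray p r t, w) = s(D.ray p r u.castSucc, D.ray p r u.succ) := by
    intro p r t w ht hw
    obtain ⟨t', rfl, h1 | h1⟩ := (D.ray_isRay p r).neighbour t ht w hw
    · refine ⟨⟨t.val, by omega⟩, ?_⟩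
      have e : (⟨t.val, by omega⟩ : Fin (r.len a b)).succ = t' := Fin.ext (by simp; omega)
      rw [e]
      rfl
    · refine ⟨⟨t'.val, by omega⟩, ?_⟩
      have e : (⟨t'.val, by omega⟩ : Fin (r.len a b)).succ = t := Fin.ext (by simp; omega)
      rw [e, Sym2.eq_swap]
      rfl
  obtain ⟨p, r, t, rfl⟩ := hy
  by_cases ht : t = 0
  · subst ht
    by_cases hw : w ∈ D.F
    · obtain ⟨p', r', t', rfl⟩ := hw
      by_cases ht' : t' = 0
      · subst ht'
        rw [D.ray_src, D.ray_src] at h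
        exact absurd h (D.src_indep ⟨p, rfl⟩ ⟨p', rfl⟩ h.ne)
      · obtain ⟨u, hu⟩ := main p' r' t' _ ht' h.symm
        exact Or.inr ⟨p', r', u, by rw [Sym2.eq_swap, hu]⟩
    · exact Or.inl ⟨p, D.ray_src p r, hw⟩
  · obtain ⟨u, hu⟩ := main p r t w ht h
    exact Or.inr ⟨p, r, u, hu⟩

/-! ### The cubic graph and the graph `Q` -/

/-- The three edge colours of the cubic graph. -/
inductive Port
  | s
  | m
  | l
  deriving DecidableEq

instance : Fintype Port := ⟨{.s, .m, .l}, by intro x; cases x <;> simp⟩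

/-- A bipartite cubic graph `Δ` with vertices `v_1, …, v_k` and a proper `3`-edge-colouring. -/
structure CubicGraph (k : ℕ) where
  graph : SimpleGraph (Fin k)
  locFin : graph.LocallyFinite
  bipartite : graph.IsBipartite
  cubic : graph.IsRegularOfDegree 3
  /-- The edge-colouring; edges that share a vertex get distinct colours. -/
  colour : graph.lineGraph.Coloring Port

/-- Every vertex of `Δ` is incident to exactly one edge of each colour. -/
theorem CubicGraph.existsUnique_edge {k : ℕ} (Δ : CubicGraph k) (i : Fin k) (x : Port) :
    ∃! e : Δ.graph.edgeSet, i ∈ (e : Sym2 (Fin k)) ∧ Δ.colour e = x := by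
  classical
  have hinj : ∀ e f : Δ.graph.edgeSet, i ∈ (e : Sym2 (Fin k)) → i ∈ (f : Sym2 (Fin k)) →
      Δ.colour e = Δ.colour f → e = f := by
    intro e f he hf hc
    by_contra hne
    exact Δ.colour.valid (v := e) (w := f) ⟨hne, ⟨i, he, hf⟩⟩ hc
  let _ := Δ.locFin
  let g : Δ.graph.neighborSet i → Port := fun w => Δ.colour ⟨s(i, (w : Fin k)), w.2⟩
  have hg : Function.Injective g := by
    intro w w' h
    have := hinj _ _ (by simp) (by simp) h
    have h2 : s(i, (w : Fin k)) = s(i, (w' : Fin k)) := congrArg Subtype.val this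
    exact Subtype.ext (Sym2.congr_right.1 h2)
  have hcard : Fintype.card (Δ.graph.neighborSet i) = Fintype.card Port := by
    rw [SimpleGraph.card_neighborSet_eq_degree, Δ.cubic i]
    rfl
  obtain ⟨w, hw⟩ := ((Fintype.bijective_iff_injective_and_card g).2 ⟨hg, hcard⟩).2 x
  refine ⟨⟨s(i, (w : Fin k)), w.2⟩, ⟨by simp, hw⟩, ?_⟩
  rintro f ⟨hf, hfx⟩
  exact hinj _ _ hf (by simp) (hfx.trans hw.symm)

section Construction

variable {k a b : ℕ}

/-- The edge of colour `x` of `Δ` at the vertex `v_i`. -/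
def CubicGraph.edgeAt (Δ : CubicGraph k) (i : Fin k) (x : Port) : Δ.graph.edgeSet :=
  (Δ.existsUnique_edge i x).choose

/-- The vertices of `Q`. The gadget of `v_i` consists of four paths, indexed by `j` and `r`:
* `(0, A)`: a path of length `a` from `v_i^1` to the vertex `s`,
* `(0, B)`: a path of length `b` from `v_i^1` to the vertex `m`,
* `(1, A)`: a path of length `a` from `v_i^2` to `v_i^1`,
* `(1, B)`: a path of length `b` from `v_i^2` to the vertex `ℓ`.
The vertex with colour `C(e)` in the gadget of an endpoint of an edge `e` of `Δ` is identified with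
the vertex with this colour in the gadget of the other endpoint; the resulting vertex is `port e`.
-/
inductive QVertex (Δ : CubicGraph k) (a b : ℕ)
  /-- The vertex `v_i^1` (for `j = 0`) or `v_i^2` (for `j = 1`). -/
  | branch (i : Fin k) (j : Fin 2)
  /-- The vertex in position `t + 1` of the path `(j, r)` in the gadget of `v_i`. -/
  | inner (i : Fin k) (j : Fin 2) (r : Arm) (t : Fin (r.len a b - 1))
  /-- The vertex that is shared by the gadgets of the two endpoints of `e`. -/
  | port (e : Δ.graph.edgeSet)

/-- The last vertex of the path `(j, r)` in the gadget of `v_i`. -/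
def gadgetEnd (Δ : CubicGraph k) (a b : ℕ) (i : Fin k) : Fin 2 → Arm → QVertex Δ a b
  | 0, .A => .port (Δ.edgeAt i .s)
  | 0, .B => .port (Δ.edgeAt i .m)
  | 1, .A => .branch i 0
  | 1, .B => .port (Δ.edgeAt i .l)

/-- The vertex in position `t` of the path `(j, r)` in the gadget of `v_i`, for `t` between `0` and
the length of the path. -/
def gadgetPath (Δ : CubicGraph k) (a b : ℕ) (i : Fin k) (j : Fin 2) (r : Arm) (t : ℕ) :
    QVertex Δ a b :=
  if t = 0 then .branch i j
  else if h : t - 1 < r.len a b - 1 then .inner i j r ⟨t - 1, h⟩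
  else gadgetEnd Δ a b i j r

/-- The graph `Q`: its edges are those of the paths of the gadgets. -/
def qGraph (Δ : CubicGraph k) (a b : ℕ) : SimpleGraph (QVertex Δ a b) :=
  SimpleGraph.fromEdgeSet {e | ∃ i j r, ∃ t < Arm.len a b r,
    e = s(gadgetPath Δ a b i j r t, gadgetPath Δ a b i j r (t + 1))}

/-- The fracture `τ` of `Q`. At the vertices `port e`, it has two singleton blocks. At `v_i^1`, one
block contains the first edges of the paths to `s` and to `m`, and the other block consists of the
first edge of the path to `ℓ`, which is the last edge of the path from `v_i^2` to `v_i^1`. At all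
other vertices it has one block only. -/
def tau (Δ : CubicGraph k) (a b : ℕ) : Fracture (qGraph Δ a b)
  | .port _ => ⊥
  | .branch i 0 => Setoid.ker fun e : (qGraph Δ a b).incidenceSet (.branch i 0) =>
      (e : Sym2 (QVertex Δ a b)) = s(.branch i 0, gadgetPath Δ a b i 1 .A (a - 1))
  | .branch _ 1 => ⊤
  | .inner _ _ _ _ => ⊤

variable {VT : Type*} {T : SimpleGraph VT} [T.LocallyFinite]

theorem gamma_existsUnique (D : DesignatedForks T k a b) (Δ : CubicGraph k) (y : D.F) :
    ∃! q : QVertex Δ a b, ∃ p r t, D.ray p r t = y ∧ gadgetPath Δ a b p.1 p.2 r t = q := by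
  obtain ⟨y, p, r, t, rfl⟩ := y
  refine ⟨_, ⟨p, r, t, rfl, rfl⟩, ?_⟩
  rintro _ ⟨p', r', t', h, rfl⟩
  obtain ⟨rfl, h2, h3⟩ := D.ray_eq h
  by_cases ht : t' = 0
  · subst ht
    have : t.val = 0 := h2.symm
    rw [this]
    simp [gadgetPath]
  · obtain rfl := h3 ht
    rw [h2]

/-- The map `γ : F → V(Q)`: the vertex in position `t` of the ray `F_a(i,j)` or `F_b(i,j)` is mapped
to the vertex in position `t` of the path `(j, A)` or `(j, B)` in the gadget of `v_i`. Thus the path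
formed by `F_a(i,1)` and `F_b(i,1)` is mapped to the path from `s` to `m`, the path formed by
`F_a(i,2)` and `F_b(i,2)` to the path from `v_i^1` to `ℓ`, and `s_i^j` to `v_i^j`. -/
def gamma (D : DesignatedForks T k a b) (Δ : CubicGraph k) (y : D.F) : QVertex Δ a b :=
  (gamma_existsUnique D Δ y).choose

variable {VG : Type*} {G : SimpleGraph VG}

/-- The graph `Ĝ` on `V(G) ∪ (V(T) \ F)`. -/
def hatGraph (D : DesignatedForks T k a b) (Δ : CubicGraph k) (c : G →g qGraph Δ a b) :
    SimpleGraph (VG ⊕ {z : VT // z ∉ D.F}) where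
  Adj
    | .inl g, .inl g' => G.Adj g g'
    | .inr z, .inr z' => T.Adj z z'
    | .inl g, .inr z => ∃ y : D.F, T.Adj z y ∧ c g = gamma D Δ y
    | .inr z, .inl g => ∃ y : D.F, T.Adj z y ∧ c g = gamma D Δ y
  symm := by
    constructor
    rintro (g | z) (g' | z') h
    · exact G.symm.symm _ _ h
    · exact h
    · exact h
    · exact T.symm.symm _ _ h
  loopless := by
    constructor
    rintro (g | z) h
    · exact G.loopless.irrefl _ h
    · exact T.loopless.irrefl _ h

/-- The graph of the edge-colouring `γ̂` of `Ĝ` with colours in `E(T)`: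
* an edge `e` of `G` gets the colour `f ∈ E(T[F])` with `γ_E(f) = c_E(e)`,
* an edge of `T` between vertices outside of `F` gets itself as its colour,
* an edge between `z ∉ F` and `g ∈ V(G)` gets the colour `{z, y} ∈ E(T)`, where `y ∈ F` and
  `c(g) = γ(y)`. -/
inductive HatColour (D : DesignatedForks T k a b) (Δ : CubicGraph k) (c : G →g qGraph Δ a b) :
    Sym2 (VG ⊕ {z : VT // z ∉ D.F}) → Sym2 VT → Prop
  | inside (e : Sym2 VG) (he : e ∈ G.edgeSet) (f : Sym2 D.F) (hf : f ∈ (T.induce D.F).edgeSet)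
      (h : f.map (gamma D Δ) = e.map c) : HatColour D Δ c (e.map .inl) (f.map Subtype.val)
  | outside (z z' : {z : VT // z ∉ D.F}) (h : T.Adj z z') :
      HatColour D Δ c s(.inr z, .inr z') s((z : VT), (z' : VT))
  | between (z : {z : VT // z ∉ D.F}) (g : VG) (y : D.F) (h : T.Adj z y)
      (hg : c g = gamma D Δ y) : HatColour D Δ c s(.inr z, .inl g) s((z : VT), (y : VT))

theorem gamma_ray (D : DesignatedForks T k a b) (Δ : CubicGraph k) (p : Fin k × Fin 2) (r : Arm)
    (t : Fin (r.len a b + 1)) (h : D.ray p r t ∈ D.F) :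
    gamma D Δ ⟨D.ray p r t, h⟩ = gadgetPath Δ a b p.1 p.2 r t :=
  ((gamma_existsUnique D Δ ⟨D.ray p r t, h⟩).choose_spec.2 _ ⟨p, r, t, rfl, rfl⟩).symm

theorem gadgetPath_left (Δ : CubicGraph k) (i : Fin k) (j : Fin 2) {r : Arm} {t : ℕ}
    (ht : t < r.len a b) : (t = 0 ∧ gadgetPath Δ a b i j r t = .branch i j) ∨
      ∃ u : Fin (r.len a b - 1), u.val + 1 = t ∧ gadgetPath Δ a b i j r t = .inner i j r u := by
  by_cases h : t = 0
  · exact Or.inl ⟨h, by simp [gadgetPath, h]⟩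
  · exact Or.inr ⟨⟨t - 1, by omega⟩, by simp; omega,
      by rw [gadgetPath, if_neg h, dif_pos (by omega)]⟩

theorem gadgetPath_right (Δ : CubicGraph k) (i : Fin k) (j : Fin 2) {r : Arm} {t : ℕ}
    (ht : t < r.len a b) : (t + 1 = r.len a b ∧
        gadgetPath Δ a b i j r (t + 1) = gadgetEnd Δ a b i j r) ∨
      ∃ u : Fin (r.len a b - 1), u.val = t ∧ gadgetPath Δ a b i j r (t + 1) = .inner i j r u := by
  by_cases h : t + 1 = r.len a b
  · exact Or.inl ⟨h, by rw [gadgetPath, if_neg (by omega), dif_neg (by omega)]⟩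
  · exact Or.inr ⟨⟨t, by omega⟩, rfl, by
      rw [gadgetPath, if_neg (by omega), dif_pos (by omega)]; rfl⟩

theorem CubicGraph.edgeAt_inj (Δ : CubicGraph k) {i : Fin k} {x y : Port}
    (h : Δ.edgeAt i x = Δ.edgeAt i y) : x = y := by
  rw [← (Δ.existsUnique_edge i x).choose_spec.1.2, ← (Δ.existsUnique_edge i y).choose_spec.1.2]
  exact congrArg Δ.colour h

theorem gadgetEnd_ne_inner (Δ : CubicGraph k) {i i' : Fin k} {j j' : Fin 2} {r r' : Arm}
    (u : Fin (r'.len a b - 1)) : gadgetEnd Δ a b i j r ≠ .inner i' j' r' u := by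
  fin_cases j <;> cases r <;> simp [gadgetEnd]

theorem gadgetEnd_inj (Δ : CubicGraph k) {i : Fin k} {j : Fin 2} {r r' : Arm}
    (h : gadgetEnd Δ a b i j r = gadgetEnd Δ a b i j r') : r = r' := by
  fin_cases j <;> cases r <;> cases r' <;> simp [gadgetEnd] at h ⊢
  all_goals exact absurd (Δ.edgeAt_inj h) (by simp)

theorem gadgetEnd_branch (Δ : CubicGraph k) {i i' : Fin k} {j j' : Fin 2} {r : Arm}
    (h : gadgetEnd Δ a b i j r = .branch i' j') : j = 1 ∧ j' = 0 := by
  fin_cases j <;> cases r <;> simp [gadgetEnd] at h ⊢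
  exact h.2.symm

/-- Different edges of the gadgets are different edges of `Q`. -/
theorem gadgetPath_edge_inj (Δ : CubicGraph k) {i i' : Fin k} {j j' : Fin 2} {r r' : Arm}
    {t t' : ℕ} (ht : t < r.len a b) (ht' : t' < r'.len a b)
    (h : s(gadgetPath Δ a b i j r t, gadgetPath Δ a b i j r (t + 1)) =
      s(gadgetPath Δ a b i' j' r' t', gadgetPath Δ a b i' j' r' (t' + 1))) :
    i = i' ∧ j = j' ∧ r = r' ∧ t = t' := by
  have hE := @gadgetEnd_ne_inner k a b Δ
  have hB := @gadgetEnd_branch k a b Δ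
  have hI := @gadgetEnd_inj k a b Δ
  rw [Sym2.eq_iff] at h
  rcases gadgetPath_left Δ i j ht with ⟨h1, e1⟩ | ⟨u1, h1, e1⟩ <;>
  rcases gadgetPath_right Δ i j ht with ⟨h2, e2⟩ | ⟨u2, h2, e2⟩ <;>
  rcases gadgetPath_left Δ i' j' ht' with ⟨h3, e3⟩ | ⟨u3, h3, e3⟩ <;>
  rcases gadgetPath_right Δ i' j' ht' with ⟨h4, e4⟩ | ⟨u4, h4, e4⟩ <;>
  rw [e1, e2, e3, e4] at h <;> clear e1 e2 e3 e4 <;>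
  rcases h with ⟨ha, hb⟩ | ⟨ha, hb⟩ <;>
  first
  | (cases ha; done)
  | (cases hb; done)
  | exact absurd hb (hE _)
  | exact absurd hb.symm (hE _)
  | exact absurd ha (hE _)
  | exact absurd ha.symm (hE _)
  | skip
  · cases ha
    exact ⟨rfl, rfl, hI hb, by omega⟩
  · have p1 := hB ha.symm
    have p2 := hB hb
    omega
  · cases hb
    exact ⟨rfl, rfl, rfl, by omega⟩
  · cases hb
    have p1 := hB ha.symm
    omega
  · cases ha
    have p1 := hB hb
    omega
  · cases ha
    exact ⟨rfl, rfl, rfl, by omega⟩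
  · cases ha
    exact ⟨rfl, rfl, rfl, by omega⟩
  · cases ha
    have p1 := congrArg Fin.val (eq_of_heq (QVertex.inner.inj hb).2.2.2)
    omega

/-- Every edge of `T[F]` is an edge of a designated ray. -/
theorem DesignatedForks.induce_edge (D : DesignatedForks T k a b) (f : Sym2 D.F)
    (hf : f ∈ (T.induce D.F).edgeSet) : ∃ p r, ∃ t : Fin (r.len a b),
      f = s(⟨D.ray p r t.castSucc, ⟨p, r, _, rfl⟩⟩, ⟨D.ray p r t.succ, ⟨p, r, _, rfl⟩⟩) := by
  revert hf
  refine Sym2.ind ?_ f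
  rintro ⟨y, hy⟩ ⟨w, hw⟩ h
  rcases D.adj_cases hy (w := w) h with ⟨p, -, h2⟩ | ⟨p, r, t, h2⟩
  · exact absurd hw h2
  · refine ⟨p, r, t, Sym2.map.injective Subtype.val_injective ?_⟩
    simpa using h2

theorem gammaE_ray (D : DesignatedForks T k a b) (Δ : CubicGraph k) (p : Fin k × Fin 2) (r : Arm)
    (t : Fin (r.len a b)) :
    Sym2.map (gamma D Δ)
        s(⟨D.ray p r t.castSucc, ⟨p, r, _, rfl⟩⟩, ⟨D.ray p r t.succ, ⟨p, r, _, rfl⟩⟩) =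
      s(gadgetPath Δ a b p.1 p.2 r t, gadgetPath Δ a b p.1 p.2 r (t + 1)) :=
  congrArg₂ (fun x y => s(x, y)) (gamma_ray D Δ p r t.castSucc _) (gamma_ray D Δ p r t.succ _)

/-- The map `γ_E : E(T[F]) → E(Q)` is injective. -/
theorem gammaE_injective (D : DesignatedForks T k a b) (Δ : CubicGraph k) (f f' : Sym2 D.F)
    (hf : f ∈ (T.induce D.F).edgeSet) (hf' : f' ∈ (T.induce D.F).edgeSet)
    (h : f.map (gamma D Δ) = f'.map (gamma D Δ)) : f = f' := by
  obtain ⟨⟨i, j⟩, r, t, rfl⟩ := D.induce_edge f hf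
  obtain ⟨⟨i', j'⟩, r', t', rfl⟩ := D.induce_edge f' hf'
  obtain ⟨rfl, rfl, rfl, h4⟩ := gadgetPath_edge_inj Δ t.2 t'.2
    ((gammaE_ray D Δ (i, j) r t).symm.trans (h.trans (gammaE_ray D Δ (i', j') r' t')))
  rw [Fin.ext h4]

/-- The map `γ_E : E(T[F]) → E(Q)` is surjective. -/
theorem gammaE_surjective (D : DesignatedForks T k a b) (Δ : CubicGraph k)
    (e : Sym2 (QVertex Δ a b)) (he : e ∈ (qGraph Δ a b).edgeSet) :
    ∃ f ∈ (T.induce D.F).edgeSet, f.map (gamma D Δ) = e := by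
  rw [qGraph, SimpleGraph.edgeSet_fromEdgeSet] at he
  obtain ⟨⟨i, j, r, t, ht, rfl⟩, -⟩ := he
  refine ⟨s(⟨D.ray (i, j) r (⟨t, ht⟩ : Fin _).castSucc, ⟨_, r, _, rfl⟩⟩,
    ⟨D.ray (i, j) r (⟨t, ht⟩ : Fin _).succ, ⟨_, r, _, rfl⟩⟩), ?_, ?_⟩
  · exact (D.ray_isRay (i, j) r).1.2.1 ⟨t, ht⟩
  · exact gammaE_ray D Δ (i, j) r ⟨t, ht⟩

/-- Every edge of `Ĝ` has exactly one colour. -/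
theorem hatColour_existsUnique (D : DesignatedForks T k a b) (Δ : CubicGraph k)
    (c : G →g qGraph Δ a b) (e : (hatGraph D Δ c).edgeSet) :
    ∃! f : T.edgeSet, HatColour D Δ c e f := by
  obtain ⟨e, he⟩ := e
  change ∃! f : T.edgeSet, HatColour D Δ c e f
  revert he
  refine Sym2.ind ?_ e
  have hsrc : ∀ (z : {z : VT // z ∉ D.F}) (y : D.F), T.Adj z y → ∃ p, y.1 = D.src p ∧
      gamma D Δ y = .branch p.1 p.2 := by
    rintro z ⟨y, hy⟩ h
    rcases D.adj_cases hy h.symm with ⟨p, h1, -⟩ | ⟨p, r, t, h1⟩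
    · rw [← D.ray_src p .A] at h1
      subst h1
      exact ⟨p, D.ray_src p .A, by rw [gamma_ray]; rfl⟩
    · have : z.1 ∈ s(D.ray p r t.castSucc, D.ray p r t.succ) := by rw [← h1]; simp
      rcases Sym2.mem_iff.1 this with h2 | h2
      · exact absurd ⟨p, r, _, h2.symm⟩ z.2
      · exact absurd ⟨p, r, _, h2.symm⟩ z.2
  have hbet : ∀ (g : VG) (z : {z : VT // z ∉ D.F}),
      (∃ y : D.F, T.Adj z y ∧ c g = gamma D Δ y) →
      ∃! f : T.edgeSet, HatColour D Δ c s(.inr z, .inl g) f := by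
    rintro g z ⟨y, hzy, hg⟩
    refine ⟨⟨s((z : VT), (y : VT)), hzy⟩, .between z g y hzy hg, ?_⟩
    rintro ⟨f, hf⟩ h
    refine Subtype.ext ?_
    change HatColour D Δ c s(.inr z, .inl g) f at h
    change f = s((z : VT), (y : VT))
    generalize hE : (s(.inr z, .inl g) : Sym2 (VG ⊕ {z : VT // z ∉ D.F})) = E at h
    cases h with
    | inside e he f' hf' h =>
      revert hE
      refine Sym2.ind ?_ e
      intro u v h
      simp at h
    | outside z1 z2 h => simp at hE
    | between z' g' y' h hg' =>
      simp at hE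
      obtain ⟨rfl, rfl⟩ := hE
      obtain ⟨p, h1, h2⟩ := hsrc _ _ hzy
      obtain ⟨p', h1', h2'⟩ := hsrc _ _ h
      rw [← hg, hg', h2'] at h2
      obtain ⟨h3, h4⟩ := QVertex.branch.inj h2
      rw [h1, h1', Prod.ext h3 h4]
  rintro (g | z) (g' | z') he
  · have he' : G.Adj g g' := he
    obtain ⟨f, hf, hfe⟩ := gammaE_surjective D Δ s(c g, c g') (c.map_adj he')
    have hfT : f.map Subtype.val ∈ T.edgeSet := by
      revert hf
      exact Sym2.ind (fun u v h => h) f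
    refine ⟨⟨f.map Subtype.val, hfT⟩, .inside s(g, g') he' f hf hfe, ?_⟩
    rintro ⟨f', hf'⟩ h
    refine Subtype.ext ?_
    change HatColour D Δ c s(.inl g, .inl g') f' at h
    change f' = f.map Subtype.val
    generalize hE : (s(.inl g, .inl g') : Sym2 (VG ⊕ {z : VT // z ∉ D.F})) = E at h
    cases h with
    | inside e he f' hf1 h =>
      have : e = s(g, g') := by
        refine Sym2.map.injective Sum.inl_injective (hE.symm.trans ?_)
        rfl
      subst this
      rw [gammaE_injective D Δ f f' hf hf1 (hfe.trans h.symm)]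
    | outside z1 z2 h => simp at hE
    | between z' g' y' h hg' => simp at hE
  · rw [Sym2.eq_swap (a := Sum.inl g)]
    exact hbet g z' he
  · exact hbet g' z he
  · refine ⟨⟨s((z : VT), (z' : VT)), he⟩, .outside z z' he, ?_⟩
    rintro ⟨f, hf⟩ h
    refine Subtype.ext ?_
    change HatColour D Δ c s(.inr z, .inr z') f at h
    change f = s((z : VT), (z' : VT))
    generalize hE : (s(.inr z, .inr z') : Sym2 (VG ⊕ {z : VT // z ∉ D.F})) = E at h
    cases h with
    | inside e he f' hf' h =>
      revert hE
      refine Sym2.ind ?_ e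
      intro u v h
      simp at h
    | outside z1 z2 h =>
      simp at hE
      rcases hE with ⟨rfl, rfl⟩ | ⟨rfl, rfl⟩
      · rfl
      · exact Sym2.eq_swap
    | between z' g' y' h hg' => simp at hE

/-- The edge-colouring `γ̂` of `Ĝ` with colours in `E(T)`. -/
def hatGamma (D : DesignatedForks T k a b) (Δ : CubicGraph k) (c : G →g qGraph Δ a b)
    (e : (hatGraph D Δ c).edgeSet) : T.edgeSet :=
  (hatColour_existsUnique D Δ c e).choose

end Construction

end

end ForkNumber

/-!
A copy `S` of `T` in `Ĝ` with exactly one edge of each colour is a *lift* of `T` (`IsLift`): the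
edge `{y, w}` of `T` corresponds to the edge of `S` of this colour, whose ends `E y w` and `E w y`
lie over the images of `y` and `w` in `V(Q) ∪ (V(T) \ F)`. Thus `S` arises from `T` by splitting
vertices, and by identifying vertices with the same image. Outside of `F` nothing happens. Over an
inner vertex of a path of a gadget the lift may split one vertex into two leaves, over a port it may
join two leaves to one vertex of degree `2`, and over `v_i^1` and `v_i^2` the edges may be
distributed arbitrarily. That the result is isomorphic to `T` is used as follows.

* For each `φ` with `φ 0 = 0`, the sums of `φ (deg u)` over `S` and over `T` agree
  (`IsCopy.sum_vdeg`). Hence splits and joined ports are balanced by the changes at the vertices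
  `v_i^j` (`IsLift.sum_branch_excess`).
* `S` has no more leaves than `T` at distance less than `θ` from a vertex of degree at least `3`.
  A split at distance less than `θ` from a source creates such a leaf, unless it ends in a vertex of
  degree `2` over some `v_i^j`. As no component of `S` is a path, each path to a port has at most
  one split, and each joined port serves only one split (`IsLift.exists_splitY_injection`). For
  `θ = a`, this shows that the path from `v_i^2` to `v_i^1` is not split, that no vertex over a
  `v_i^j` has degree `2`, and that there are as many joined ports as splits
  (`IsLift.splitX_eq_empty`); moreover, a split has distance at least `a` from the source
  (`IsLift.le_of_split`).
* The neighbours of `s_i^1` and `s_i^2` that are not on rays, called roots, are connected outside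
  of `F`. As `S` is acyclic, they are not connected by the path from `v_i^2` to `v_i^1` as well
  (`IsLift.root_separated`), so that there are at least three vertices over `v_i^1` and `v_i^2`. The
  functions `φ d = [d ≥ 1]`, `φ d = [d ≥ 3]` and `φ d = d ^ 2`, the last together with
  `deg s_i^2 ≤ deg s_i^1`, show that there are a leaf and another vertex over `v_i^1`, and one
  vertex over `v_i^2` (`IsLift.fibre_branch`).

The edge at the leaf over `v_i^1` either leads to the root at `s_i^1`, or it is the last edge of the
path from `v_i^2` to `v_i^1`. If the former holds for some `i`, then the leaf can be replaced by any
vertex `g` of `G` with `c(g) = v_i^1` other than the non-leaf over `v_i^1`. The number of choices is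
even since `|c⁻¹(v_i^1)|` is odd, and so the copies of this kind cancel modulo `2`
(`card_copies_modEq`). If the latter holds for all `i`, then the number of leaves at distance less
than `b` shows that there are no splits at all (`IsLift.eq_of_root_not_leaf`). Hence `S` is
the image of `T` under the extension of an embedding of `(T[F], γ)` in `(G, c)`
(`card_good_copies`), and `(T[F], γ)` is isomorphic to `(Q_τ, c_τ)` (`exists_iso_fractured`).
-/

namespace ForkNumber

noncomputable section

/-! ### Degrees, pendant paths and copies of a graph -/

section Pendant

variable {V : Type*} {H : SimpleGraph V}

/-- The degree of a vertex, as the `ncard` of its neighbour set, so that no finiteness instance on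
the graph is involved. -/
def vdeg (H : SimpleGraph V) (v : V) : ℕ := (H.neighborSet v).ncard

theorem vdeg_eq_degree (H : SimpleGraph V) [H.LocallyFinite] (v : V) : vdeg H v = H.degree v := by
  rw [vdeg, Set.ncard_eq_toFinset_card', ← SimpleGraph.card_neighborFinset_eq_degree]
  rfl

theorem vdeg_pos [Finite V] {u v : V} (h : H.Adj u v) : 0 < vdeg H u :=
  (Set.ncard_pos (Set.toFinite _)).2 ⟨v, h⟩

theorem exists_adj_of_vdeg_pos {u : V} (h : 0 < vdeg H u) : ∃ v, H.Adj u v :=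
  Set.nonempty_of_ncard_ne_zero h.ne'

theorem eq_of_vdeg_one {u v w : V} (hu : vdeg H u = 1) (hv : H.Adj u v) (hw : H.Adj u w) :
    v = w := by
  obtain ⟨x, hx⟩ := Set.ncard_eq_one.1 hu
  have h1 : v ∈ H.neighborSet u := hv
  have h2 : w ∈ H.neighborSet u := hw
  rw [hx] at h1 h2
  exact h1.trans h2.symm

theorem eq_or_eq_of_vdeg_two {u v w x : V} (hu : vdeg H u = 2) (hv : H.Adj u v) (hw : H.Adj u w)
    (hx : H.Adj u x) (h : v ≠ w) : x = v ∨ x = w := by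
  obtain ⟨p, q, -, hpq⟩ := Set.ncard_eq_two.1 hu
  have h1 : v ∈ H.neighborSet u := hv
  have h2 : w ∈ H.neighborSet u := hw
  have h3 : x ∈ H.neighborSet u := hx
  rw [hpq] at h1 h2 h3
  simp only [Set.mem_insert_iff, Set.mem_singleton_iff] at h1 h2 h3
  grind

/-- `Pendant H n ℓ u v`: there is a path of length `n + 1` from the leaf `ℓ` to `v` whose inner
vertices have degree `2`, and `u` is the last vertex on it before `v`. -/
inductive Pendant (H : SimpleGraph V) : ℕ → V → V → V → Prop
  | leaf {u v : V} : H.Adj u v → vdeg H u = 1 → Pendant H 0 u u v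
  | step {n : ℕ} {l w u v : V} : Pendant H n l w u → vdeg H u = 2 → H.Adj u v → w ≠ v →
      Pendant H (n + 1) l u v

namespace Pendant

variable {n n' : ℕ} {l l' u u' v v' : V}

theorem adj (h : Pendant H n l u v) : H.Adj u v := by
  cases h <;> assumption

theorem vdeg_leaf (h : Pendant H n l u v) : vdeg H l = 1 := by
  induction h with
  | leaf _ h => exact h
  | step _ _ _ _ ih => exact ih

/-- The vertices of a pendant path before its end `v` form a set that can be left only
through `v`. -/
theorem barrier (h : Pendant H n l u v) : ∃ B : Set V, u ∈ B ∧ (∀ x ∈ B, vdeg H x ≤ 2) ∧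
    ∀ x ∈ B, ∀ y, H.Adj x y → y ∈ B ∨ y = v := by
  induction h with
  | @leaf u v huv hu =>
    refine ⟨{u}, rfl, ?_, ?_⟩
    · rintro x rfl
      omega
    · rintro x rfl y hy
      exact Or.inr (eq_of_vdeg_one hu hy huv)
  | @step n l w u v hw hu huv hwv ih =>
    obtain ⟨B, hwB, hdeg, hcl⟩ := ih
    refine ⟨insert u B, Set.mem_insert _ _, ?_, ?_⟩
    · rintro x (rfl | hx)
      · omega
      · exact hdeg x hx
    · rintro x (rfl | hx) y hy
      · rcases eq_or_eq_of_vdeg_two hu hw.adj.symm huv hy hwv with rfl | rfl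
        · exact Or.inl (Or.inr hwB)
        · exact Or.inr rfl
      · rcases hcl x hx y hy with h | rfl
        · exact Or.inl (Or.inr h)
        · exact Or.inl (Or.inl rfl)

/-- The leaf of a pendant path is determined by its last edge. -/
theorem leaf_unique (h : Pendant H n l u v) (h' : Pendant H n' l' u v) : l = l' := by
  induction h generalizing n' with
  | leaf _ hu =>
    cases h' with
    | leaf _ _ => rfl
    | step _ hu' _ _ => omega
  | step hw hu huv hne ih =>
    cases h' with
    | leaf _ hu' => omega
    | step hw' _ _ hne' =>
      rcases eq_or_eq_of_vdeg_two hu hw.adj.symm huv hw'.adj.symm hne with rfl | h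
      · exact ih hw'
      · exact absurd h hne'

theorem eq_of_length_eq (h : Pendant H n l u v) (h' : Pendant H n l u' v') :
    u = u' ∧ v = v' := by
  induction h generalizing u' v' with
  | leaf huv hu =>
    cases h' with
    | leaf huv' _ => exact ⟨rfl, eq_of_vdeg_one hu huv huv'⟩
  | step hw hu huv hne ih =>
    cases h' with
    | step hw' hu' huv' hne' =>
      obtain ⟨rfl, rfl⟩ := ih hw'
      refine ⟨rfl, ?_⟩
      rcases eq_or_eq_of_vdeg_two hu hw.adj.symm huv huv' hne with h | h
      · exact absurd h.symm hne'
      · exact h.symm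

theorem exists_shorter (h : Pendant H n l u v) (hn : n' < n) :
    ∃ u' v', Pendant H n' l u' v' ∧ vdeg H v' = 2 := by
  induction h with
  | leaf _ _ => omega
  | @step n l w u v hw hu _ _ ih =>
    rcases Nat.lt_or_ge n' n with h | h
    · exact ih h
    · obtain rfl : n' = n := by omega
      exact ⟨w, u, hw, hu⟩

/-- The distance from a leaf to the first vertex of degree at least `3` is well defined. -/
theorem length_unique (h : Pendant H n l u v) (h' : Pendant H n' l u' v')
    (hv : 3 ≤ vdeg H v) (hv' : 3 ≤ vdeg H v') : n = n' := by
  rcases lt_trichotomy n n' with hn | hn | hn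
  · obtain ⟨x, y, hxy, hy⟩ := h'.exists_shorter hn
    obtain ⟨-, rfl⟩ := h.eq_of_length_eq hxy
    omega
  · exact hn
  · obtain ⟨x, y, hxy, hy⟩ := h.exists_shorter hn
    obtain ⟨-, rfl⟩ := h'.eq_of_length_eq hxy
    omega

end Pendant

/-- Each component with an edge has a vertex of degree at least `3`, that is, no component is a
path or a cycle. -/
def Branching (H : SimpleGraph V) : Prop :=
  ∀ A : Set V, (∀ x ∈ A, ∀ y, H.Adj x y → y ∈ A) → (∃ x ∈ A, 0 < vdeg H x) →
    ∃ x ∈ A, 3 ≤ vdeg H x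

namespace Pendant

variable [Finite V] {n n' : ℕ} {l l' u u' v v' : V}

/-- A pendant path does not lead to a leaf, since it would be a component then. -/
theorem vdeg_ne_one (hH : Branching H) (h : Pendant H n l u v) : vdeg H v ≠ 1 := by
  intro hv
  obtain ⟨B, huB, hdeg, hcl⟩ := h.barrier
  obtain ⟨x, hx, hx3⟩ := hH (insert v B) (by
    rintro x (rfl | hx) y hy
    · rw [eq_of_vdeg_one hv hy h.adj.symm]
      exact Or.inr huB
    · exact (hcl x hx y hy).symm) ⟨u, Or.inr huB, vdeg_pos h.adj⟩
  rcases hx with rfl | hx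
  · omega
  · have := hdeg x hx
    omega

/-- Two pendant paths do not lead to the same vertex of degree `2` from different sides, since
they would form a component then. -/
theorem eq_of_vdeg_two (hH : Branching H) (h : Pendant H n l u v) (h' : Pendant H n' l' u' v)
    (hv : vdeg H v = 2) : u = u' := by
  by_contra hne
  obtain ⟨B, huB, hdeg, hcl⟩ := h.barrier
  obtain ⟨B', huB', hdeg', hcl'⟩ := h'.barrier
  obtain ⟨x, hx, hx3⟩ := hH (insert v (B ∪ B')) (by
    rintro x (rfl | hx | hx) y hy
    · rcases eq_or_eq_of_vdeg_two hv h.adj.symm h'.adj.symm hy hne with rfl | rfl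
      · exact Or.inr (Or.inl huB)
      · exact Or.inr (Or.inr huB')
    · exact (hcl x hx y hy).symm.imp id Or.inl
    · exact (hcl' x hx y hy).symm.imp id Or.inr) ⟨u, Or.inr (Or.inl huB), vdeg_pos h.adj⟩
  rcases hx with rfl | hx | hx
  · omega
  · have := hdeg x hx
    omega
  · have := hdeg' x hx
    omega

end Pendant

/-- The leaves at distance less than `θ` from the first vertex of degree at least `3`. -/
def shortLeaves (H : SimpleGraph V) (θ : ℕ) : Set V :=
  {l | ∃ n u v, n + 1 < θ ∧ Pendant H n l u v ∧ 3 ≤ vdeg H v}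

/-- Leaves from which a pendant path of length less than `θ` leads to a vertex of degree at least
`3` or to a vertex in `X` are short, up to at most one leaf for each vertex in `X`: a vertex of
degree `2` cannot be the end of two pendant paths. -/
theorem ncard_le_shortLeaves [Finite V] (hH : Branching H) (θ : ℕ) (L X : Set V)
    (hL : ∀ l ∈ L, ∃ n u v, n + 1 < θ ∧ Pendant H n l u v ∧ (3 ≤ vdeg H v ∨ v ∈ X)) :
    L.ncard ≤ (shortLeaves H θ).ncard + X.ncard := by
  have key : ∀ l, ∃ v, l ∈ L → l ∉ shortLeaves H θ →
      v ∈ X ∧ vdeg H v = 2 ∧ ∃ n u, Pendant H n l u v := by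
    intro l
    by_cases h : l ∈ L ∧ l ∉ shortLeaves H θ
    · obtain ⟨hl, hs⟩ := h
      obtain ⟨n, u, v, hn, hp, hv⟩ := hL l hl
      have h3 : ¬ 3 ≤ vdeg H v := fun h3 => hs ⟨n, u, v, hn, hp, h3⟩
      have h1 := hp.vdeg_ne_one hH
      have h0 := vdeg_pos hp.adj.symm
      exact ⟨v, fun _ _ => ⟨hv.resolve_left h3, by omega, n, u, hp⟩⟩
    · exact ⟨l, fun h1 h2 => absurd ⟨h1, h2⟩ h⟩
  choose f hf using key
  have h1 : (L \ shortLeaves H θ).ncard ≤ X.ncard := by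
    refine Set.ncard_le_ncard_of_injOn f (fun l hl => (hf l hl.1 hl.2).1) ?_ (Set.toFinite _)
    intro l hl l' hl' he
    obtain ⟨-, h2, n, u, hp⟩ := hf l hl.1 hl.2
    obtain ⟨-, -, n', u', hp'⟩ := hf l' hl'.1 hl'.2
    rw [← he] at hp'
    obtain rfl := hp.eq_of_vdeg_two hH hp' h2
    exact hp.leaf_unique hp'
  have h2 := Set.ncard_le_ncard_sdiff_add_ncard L (shortLeaves H θ) (Set.toFinite _)
  omega

theorem card_le_shortLeaves [Finite V] (hH : Branching H) (θ : ℕ) (X : Set V) {ι : Type*}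
    [Finite ι] {g : ι → V} (hg : Function.Injective g)
    (hL : ∀ x, ∃ n u v, n + 1 < θ ∧ Pendant H n (g x) u v ∧ (3 ≤ vdeg H v ∨ v ∈ X)) :
    Nat.card ι ≤ (shortLeaves H θ).ncard + X.ncard := by
  rw [← Set.ncard_univ, ← Set.ncard_image_of_injective _ hg]
  refine ncard_le_shortLeaves hH θ _ X ?_
  rintro _ ⟨x, -, rfl⟩
  exact hL x

end Pendant

section Copy

variable {U V : Type*} {T : SimpleGraph U} {H : SimpleGraph V}

/-- Up to isolated vertices, `f` is an isomorphism from `T` to `H`. -/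
def IsCopy (f : T ↪g H) : Prop := ∀ u v, H.Adj u v → u ∈ Set.range f

namespace IsCopy

variable {f : T ↪g H} (hf : IsCopy f)
include hf

theorem neighborSet_apply (x : U) : H.neighborSet (f x) = f '' T.neighborSet x := by
  ext v
  constructor
  · intro h
    obtain ⟨y, rfl⟩ := hf v _ (SimpleGraph.Adj.symm h)
    exact ⟨y, f.map_adj_iff.1 h, rfl⟩
  · rintro ⟨y, hy, rfl⟩
    exact f.map_adj_iff.2 hy

theorem vdeg_apply (x : U) : vdeg H (f x) = vdeg T x := by
  rw [vdeg, hf.neighborSet_apply, Set.ncard_image_of_injective _ f.injective, vdeg]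

theorem vdeg_eq_zero {u : V} (hu : u ∉ Set.range f) : vdeg H u = 0 := by
  by_contra h
  obtain ⟨v, hv⟩ := exists_adj_of_vdeg_pos (Nat.pos_of_ne_zero h)
  exact hu (hf u v hv)

theorem sum_vdeg [Fintype U] [Fintype V] (φ : ℕ → ℤ) (hφ : φ 0 = 0) :
    ∑ u, φ (vdeg H u) = ∑ x, φ (vdeg T x) :=
  (Fintype.sum_of_injective f f.injective _ _
    (fun u hu => by rw [hf.vdeg_eq_zero hu, hφ]) (fun x => by rw [hf.vdeg_apply])).symm

theorem pendant {n : ℕ} {l u v : V} (h : Pendant H n l u v) :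
    ∃ l' u' v', f l' = l ∧ f u' = u ∧ f v' = v ∧ Pendant T n l' u' v' := by
  induction h with
  | leaf huv hu =>
    obtain ⟨x, rfl⟩ := hf _ _ huv
    obtain ⟨y, rfl⟩ := hf _ _ huv.symm
    rw [hf.vdeg_apply] at hu
    exact ⟨x, x, y, rfl, rfl, rfl, .leaf (f.map_adj_iff.1 huv) hu⟩
  | step hw hu huv hne ih =>
    obtain ⟨l', w', u', rfl, rfl, rfl, hp⟩ := ih
    obtain ⟨y, rfl⟩ := hf _ _ huv.symm
    rw [hf.vdeg_apply] at hu
    exact ⟨l', u', y, rfl, rfl, rfl, .step hp hu (f.map_adj_iff.1 huv) (fun h => hne (by rw [h]))⟩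

theorem ncard_shortLeaves_le [Finite U] (θ : ℕ) :
    (shortLeaves H θ).ncard ≤ (shortLeaves T θ).ncard := by
  have : shortLeaves H θ ⊆ f '' shortLeaves T θ := by
    rintro l ⟨n, u, v, hn, hp, hv⟩
    obtain ⟨l', u', v', rfl, rfl, rfl, hp'⟩ := hf.pendant hp
    rw [hf.vdeg_apply] at hv
    exact ⟨l', ⟨n, u', v', hn, hp', hv⟩, rfl⟩
  exact (Set.ncard_le_ncard this (Set.toFinite _)).trans (Set.ncard_image_le (Set.toFinite _))

theorem branching (hT : T.Connected) {s : U} (hs : 3 ≤ vdeg T s) : Branching H := by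
  rintro A hA ⟨x, hx, hx0⟩
  obtain ⟨y, hxy⟩ := exists_adj_of_vdeg_pos hx0
  obtain ⟨x, rfl⟩ := hf _ _ hxy
  refine ⟨f s, ?_, by rwa [hf.vdeg_apply]⟩
  obtain ⟨w⟩ := hT.preconnected x s
  clear hxy hx0 hs
  induction w with
  | nil => exact hx
  | cons h _ ih => exact ih (hA _ hx _ (f.map_adj_iff.2 h))

/-- If `T` is acyclic, then the ends of an edge of `H` are not connected without this edge. -/
theorem not_reachable (hT : T.IsAcyclic) {u v : V} (huv : H.Adj u v) :
    ¬ (H.deleteEdges {s(u, v)}).Reachable u v := by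
  obtain ⟨x, rfl⟩ := hf _ _ huv
  obtain ⟨y, rfl⟩ := hf _ _ huv.symm
  have hxy := f.map_adj_iff.1 huv
  have hb := SimpleGraph.isAcyclic_iff_forall_adj_isBridge.1 hT hxy
  rw [SimpleGraph.isBridge_iff] at hb
  rintro ⟨w⟩
  suffices h : ∀ {p q : V} (w : (H.deleteEdges {s(f x, f y)}).Walk p q) (x' y' : U), f x' = p →
      f y' = q → (T \ SimpleGraph.fromEdgeSet {s(x, y)}).Reachable x' y' from
    hb (h w x y rfl rfl)
  intro p q w
  induction w with
  | nil =>
    rintro x' y' rfl h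
    rw [f.injective h]
  | cons h _ ih =>
    rintro x' y' rfl hy'
    rw [SimpleGraph.deleteEdges_adj] at h
    obtain ⟨t, rfl⟩ := hf _ _ h.1.symm
    refine SimpleGraph.Reachable.trans (SimpleGraph.Adj.reachable ?_) (ih t y' rfl hy')
    rw [SimpleGraph.sdiff_adj, SimpleGraph.fromEdgeSet_adj]
    refine ⟨f.map_adj_iff.1 h.1, fun h' => h.2 ?_⟩
    have := congrArg (Sym2.map f) h'.1
    simpa using this

end IsCopy

end Copy

/-! ### The designated rays and the rest of the tree -/

section Rays

variable {V : Type*} {T : SimpleGraph V} [T.LocallyFinite]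

theorem IsRay.pos {n : ℕ} {x : Fin (n + 1) → V} (hx : IsRay T n x) : 0 < n := by
  rcases Nat.eq_zero_or_pos n with rfl | h
  · have h1 := hx.2.1
    have h2 := hx.2.2
    have : Fin.last 0 = 0 := rfl
    rw [this] at h2
    omega
  · exact h

/-- A ray is determined by its source and the neighbour of the source on it. -/
theorem IsRay.eq_of_second {n m : ℕ} {x : Fin (n + 1) → V} {y : Fin (m + 1) → V}
    (hx : IsRay T n x) (hy : IsRay T m y) (t : Fin (n + 1)) (u : Fin (m + 1)) (ht : t.val = 1)
    (hu : u.val = 1) (h : x t = y u) : n = m ∧ ∀ s s', s.val = s'.val → x s = y s' := by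
  have ht0 : t ≠ 0 := by
    rintro rfl
    simp at ht
  have hu0 : u ≠ 0 := by
    rintro rfl
    simp at hu
  obtain ⟨h1, h0⟩ := hx.share hy t u ht0 hu0 h
  obtain ⟨h2, -⟩ := hy.share hx u t hu0 ht0 h.symm
  have hr := h1.antisymm h2
  have hnm : n = m := by
    have h3 := congrArg Set.ncard hr
    rw [← Set.image_univ, ← Set.image_univ, Set.ncard_image_of_injective _ hx.1.1,
      Set.ncard_image_of_injective _ hy.1.1, Set.ncard_univ, Set.ncard_univ] at h3
    simpa using h3.symm
  subst hnm
  refine ⟨rfl, ?_⟩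
  have key : ∀ s : ℕ, ∀ hs : s + 1 < n + 1,
      x ⟨s, by omega⟩ = y ⟨s, by omega⟩ ∧ x ⟨s + 1, hs⟩ = y ⟨s + 1, hs⟩ := by
    intro s
    induction s with
    | zero =>
      intro hs
      have e1 : t = ⟨0 + 1, hs⟩ := Fin.ext (by simpa using ht)
      have e2 : u = ⟨0 + 1, hs⟩ := Fin.ext (by simpa using hu)
      rw [e1, e2] at h
      exact ⟨h0.symm, h⟩
    | succ s ih =>
      intro hs
      obtain ⟨i1, i2⟩ := ih (by omega)
      refine ⟨i2, ?_⟩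
      have hadj : T.Adj (y ⟨s + 1, by omega⟩) (y ⟨s + 1 + 1, hs⟩) := hy.1.2.1 ⟨s + 1, by omega⟩
      rw [← i2] at hadj
      obtain ⟨t', ht', h4⟩ := hx.neighbour _ (by simp [Fin.ext_iff]) _ hadj
      rcases h4 with h4 | h4
      · have : t' = ⟨s + 1 + 1, hs⟩ := Fin.ext h4
        rw [← ht', this]
      · have : t' = ⟨s, by omega⟩ := Fin.ext (by simpa using h4)
        rw [this, i1] at ht'
        have := congrArg Fin.val (hy.1.1 ht')
        simp at this
        omega
  rintro ⟨s, hs⟩ ⟨s', hs'⟩ rfl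
  rcases s with _ | s
  · exact (key 0 (by have := hx.pos; omega)).1
  · exact (key s hs).2

theorem IsRay.val_eq_one {n : ℕ} {x : Fin (n + 1) → V} (hx : IsRay T n x) {t : Fin (n + 1)}
    (ht : t ≠ 0) (h : T.Adj (x 0) (x t)) : t.val = 1 := by
  obtain ⟨t', ht', h1⟩ := hx.neighbour t ht _ h.symm
  obtain rfl := hx.1.1 ht'
  have : t.val ≠ 0 := fun h => ht (Fin.ext h)
  rcases h1 with h1 | h1
  · simp at h1
  · simpa using h1.symm

/-- The vertex `w` lies on a ray with source `s`, and is different from `s`. -/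
def OnRay (T : SimpleGraph V) [T.LocallyFinite] (s w : V) : Prop :=
  ∃ (n : ℕ) (x : Fin (n + 1) → V) (t : Fin (n + 1)), IsRay T n x ∧ x 0 = s ∧ t ≠ 0 ∧ x t = w

theorem OnRay.degree_le {s w : V} (h : OnRay T s w) : T.degree w ≤ 2 := by
  obtain ⟨n, x, t, hx, -, ht, rfl⟩ := h
  exact hx.degree_le t ht

theorem OnRay.adj {s w v : V} (h : OnRay T s w) (hv : T.Adj w v) : v = s ∨ OnRay T s v := by
  obtain ⟨n, x, t, hx, rfl, ht, rfl⟩ := h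
  obtain ⟨t', rfl, -⟩ := hx.neighbour t ht v hv
  by_cases h0 : t' = 0
  · exact Or.inl (by rw [h0])
  · exact Or.inr ⟨n, x, t', hx, rfl, h0, rfl⟩

/-- The rays from `s` correspond to their second vertices. -/
theorem ncard_onRay [Finite V] (s : V) : {w | T.Adj s w ∧ OnRay T s w}.ncard = degLeaves T s := by
  have h1 : ∀ z : (Σ n : Fin (Nat.card V), {x : Fin (n.val + 1) → V // IsRay T n x ∧ x 0 = s}),
      1 < z.1.val + 1 := fun z => by have := z.2.2.1.pos; omega
  let f : (Σ n : Fin (Nat.card V), {x : Fin (n.val + 1) → V // IsRay T n x ∧ x 0 = s}) →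
      {w | T.Adj s w ∧ OnRay T s w} := fun z => ⟨z.2.1 ⟨1, h1 z⟩, by
    have h0 := z.2.2.1.1.2.1 ⟨0, z.2.2.1.pos⟩
    have e : z.2.1 (⟨0, z.2.2.1.pos⟩ : Fin z.1.val).castSucc = s := z.2.2.2
    rw [e] at h0
    exact h0, _, z.2.1, ⟨1, h1 z⟩, z.2.2.1, z.2.2.2, by simp [Fin.ext_iff], rfl⟩
  have hf : Function.Bijective f := by
    constructor
    · rintro ⟨n, x, hx⟩ ⟨m, y, hy⟩ h
      have h' := congrArg Subtype.val h
      obtain ⟨hnm, hxy⟩ := hx.1.eq_of_second hy.1 _ _ rfl rfl h'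
      obtain rfl : n = m := Fin.ext hnm
      obtain rfl : x = y := funext fun s => hxy s s rfl
      rfl
    · rintro ⟨w, hw, n, x, t, hx, rfl, ht, rfl⟩
      have hn : n < Nat.card V := by
        have := Nat.card_le_card_of_injective x hx.1.1
        rw [Nat.card_fin] at this
        omega
      refine ⟨⟨⟨n, hn⟩, x, hx, rfl⟩, Subtype.ext ?_⟩
      exact congrArg x (Fin.ext (hx.val_eq_one ht hw).symm)
  rw [degLeaves, Finset.sum_range]
  simp only [degRay]
  rw [← Nat.card_sigma]
  exact (Nat.card_eq_of_bijective f hf).symm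

/-- A fork has exactly one neighbour that is not on a ray from it. -/
theorem IsFork.exists_root [Finite V] {a b : ℕ} {s : V} (hs : IsFork T a b s) :
    ∃ z, T.Adj s z ∧ ¬ OnRay T s z ∧ ∀ w, T.Adj s w → w ≠ z → OnRay T s w := by
  have h1 := hs.2.1
  rw [degNonleaves, ← ncard_onRay, ← vdeg_eq_degree, vdeg] at h1
  have hsub : {w | T.Adj s w ∧ OnRay T s w} ⊆ T.neighborSet s := fun w hw => hw.1
  have h2 := Set.ncard_sdiff_add_ncard_of_subset hsub (Set.toFinite _)
  have h3 : (T.neighborSet s \ {w | T.Adj s w ∧ OnRay T s w}).ncard = 1 := by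
    zify at h2 ⊢
    linarith
  obtain ⟨z, hz⟩ := Set.ncard_eq_one.1 h3
  have hz' : z ∈ T.neighborSet s \ {w | T.Adj s w ∧ OnRay T s w} := by rw [hz]; rfl
  refine ⟨z, hz'.1, fun h => hz'.2 ⟨hz'.1, h⟩, fun w hw hne => ?_⟩
  by_contra h
  have hw' : w ∈ T.neighborSet s \ {w | T.Adj s w ∧ OnRay T s w} := ⟨hw, fun h' => h h'.2⟩
  rw [hz] at hw'
  exact hne hw'

end Rays

namespace DesignatedForks

variable {VT : Type*} {T : SimpleGraph VT} [T.LocallyFinite] {k a b : ℕ}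
  (D : DesignatedForks T k a b)

/-- The vertex in position `t` of a designated ray, for `t` at most the length of the ray. -/
def pt (p : Fin k × Fin 2) (r : Arm) (t : ℕ) : VT :=
  if h : t < r.len a b + 1 then D.ray p r ⟨t, h⟩ else D.src p

theorem pt_eq {p : Fin k × Fin 2} {r : Arm} {t : ℕ} (h : t < r.len a b + 1) :
    D.pt p r t = D.ray p r ⟨t, h⟩ := by
  rw [pt, dif_pos h]

@[simp]
theorem pt_zero (p : Fin k × Fin 2) (r : Arm) : D.pt p r 0 = D.src p := by
  rw [D.pt_eq (by omega), ← D.ray_src p r]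
  rfl

theorem len_pos (D : DesignatedForks T k a b) (p : Fin k × Fin 2) (r : Arm) :
    0 < r.len a b :=
  (D.ray_isRay p r).pos

theorem src_mem (p : Fin k × Fin 2) : D.src p ∈ D.F := ⟨p, .A, 0, D.ray_src p .A⟩

theorem pt_mem (p : Fin k × Fin 2) (r : Arm) (t : ℕ) : D.pt p r t ∈ D.F := by
  rw [pt]
  split_ifs with h
  · exact ⟨p, r, _, rfl⟩
  · exact D.src_mem p

theorem pt_adj (p : Fin k × Fin 2) {r : Arm} {t : ℕ} (h : t < r.len a b) :
    T.Adj (D.pt p r t) (D.pt p r (t + 1)) := by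
  rw [D.pt_eq (by omega), D.pt_eq (by omega)]
  exact (D.ray_isRay p r).1.2.1 ⟨t, h⟩

theorem pt_inj {p p' : Fin k × Fin 2} {r r' : Arm} {t t' : ℕ} (ht : t ≤ r.len a b)
    (ht' : t' ≤ r'.len a b) (h : D.pt p r t = D.pt p' r' t') :
    p = p' ∧ t = t' ∧ (t ≠ 0 → r = r') := by
  rw [D.pt_eq (by omega), D.pt_eq (by omega)] at h
  obtain ⟨h1, h2, h3⟩ := D.ray_eq h
  exact ⟨h1, h2, fun h => h3 fun h' => h (congrArg Fin.val h')⟩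

theorem mem_F_cases {y : VT} (hy : y ∈ D.F) :
    (∃ p, y = D.src p) ∨ ∃ p r t, 0 < t ∧ t ≤ r.len a b ∧ y = D.pt p r t := by
  obtain ⟨p, r, t, rfl⟩ := hy
  by_cases h : t = 0
  · exact Or.inl ⟨p, by rw [h, D.ray_src]⟩
  · exact Or.inr ⟨p, r, t, Nat.pos_of_ne_zero fun h' => h (Fin.ext h'), by omega,
      by rw [D.pt_eq t.2]⟩

theorem pt_neighbour {p : Fin k × Fin 2} {r : Arm} {t : ℕ} (h0 : 0 < t) (ht : t ≤ r.len a b)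
    {w : VT} (hw : T.Adj (D.pt p r t) w) :
    w = D.pt p r (t - 1) ∨ t < r.len a b ∧ w = D.pt p r (t + 1) := by
  rw [D.pt_eq (by omega)] at hw
  obtain ⟨t', rfl, h | h⟩ := (D.ray_isRay p r).neighbour _ (by simp [Fin.ext_iff]; omega) w hw
  · refine Or.inr ⟨?_, ?_⟩
    · simp at h
      omega
    · rw [D.pt_eq (by simp at h; omega)]
      exact congrArg _ (Fin.ext h)
  · refine Or.inl ?_
    rw [D.pt_eq (by omega)]
    exact congrArg _ (Fin.ext (by simp at h ⊢; omega))

theorem vdeg_pt_last (p : Fin k × Fin 2) (r : Arm) : vdeg T (D.pt p r (r.len a b)) = 1 := by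
  rw [vdeg_eq_degree, D.pt_eq (by omega)]
  exact (D.ray_isRay p r).2.2

theorem vdeg_pt_inner {p : Fin k × Fin 2} {r : Arm} {t : ℕ} (h0 : 0 < t) (ht : t < r.len a b) :
    vdeg T (D.pt p r t) = 2 := by
  rw [vdeg_eq_degree, D.pt_eq (by omega)]
  refine (D.ray_isRay p r).1.2.2.2.1 _ ?_ ?_ <;> simp [Fin.ext_iff] <;> omega

theorem vdeg_src (p : Fin k × Fin 2) : 3 ≤ vdeg T (D.src p) := by
  rw [vdeg_eq_degree]
  exact (D.src_fork p).1

theorem vdeg_src_le {p q : Fin k × Fin 2} (h : toLex p ≤ toLex q) :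
    vdeg T (D.src q) ≤ vdeg T (D.src p) := by
  have h1 := D.src_order p q h
  have h2 := (D.src_fork p).2.1
  have h3 := (D.src_fork q).2.1
  rw [degNonleaves, ← vdeg_eq_degree] at h2 h3
  omega

/-- A vertex of `F` with a neighbour outside of `F` is a designated source. -/
theorem eq_src_of_adj {y z : VT} (hy : y ∈ D.F) (hz : z ∉ D.F) (h : T.Adj y z) :
    ∃ p, y = D.src p := by
  rcases D.adj_cases hy h with ⟨p, h1, -⟩ | ⟨p, r, t, h1⟩
  · exact ⟨p, h1⟩
  · have : z ∈ s(D.ray p r t.castSucc, D.ray p r t.succ) := by rw [← h1]; simp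
    rcases Sym2.mem_iff.1 this with h2 | h2
    · exact absurd ⟨p, r, _, h2.symm⟩ hz
    · exact absurd ⟨p, r, _, h2.symm⟩ hz

/-- A neighbour in `F` of a designated source is the second vertex of a designated ray. -/
theorem eq_pt_of_src_adj {p : Fin k × Fin 2} {w : VT} (hw : w ∈ D.F) (h : T.Adj (D.src p) w) :
    ∃ r, w = D.pt p r 1 := by
  rcases D.mem_F_cases hw with ⟨q, rfl⟩ | ⟨q, r, t, h0, ht, rfl⟩
  · exact absurd h (D.src_indep ⟨p, rfl⟩ ⟨q, rfl⟩ h.ne)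
  · rcases D.pt_neighbour h0 ht h.symm with h1 | ⟨ht', h1⟩
    · rw [← D.pt_zero p r] at h1
      obtain ⟨rfl, h2, -⟩ := D.pt_inj (by omega) (by omega) h1
      exact ⟨r, by rw [show t = 1 by omega]⟩
    · rw [← D.pt_zero p r] at h1
      obtain ⟨-, h2, -⟩ := D.pt_inj (by omega) (by omega) h1
      omega

theorem onRay_pt {p : Fin k × Fin 2} {r : Arm} {t : ℕ} (h0 : 0 < t) (ht : t ≤ r.len a b) :
    OnRay T (D.src p) (D.pt p r t) :=
  ⟨_, D.ray p r, ⟨t, by omega⟩, D.ray_isRay p r, D.ray_src p r,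
    by simp [Fin.ext_iff]; omega, by rw [D.pt_eq]⟩

section Root

variable [Finite VT]

/-- The root at a designated source: its only neighbour that is not on a ray from it. -/
def root (p : Fin k × Fin 2) : VT := (D.src_fork p).exists_root.choose

theorem root_adj (p : Fin k × Fin 2) : T.Adj (D.src p) (D.root p) :=
  (D.src_fork p).exists_root.choose_spec.1

theorem not_onRay_root (p : Fin k × Fin 2) : ¬ OnRay T (D.src p) (D.root p) :=
  (D.src_fork p).exists_root.choose_spec.2.1

theorem onRay_of_ne_root {p : Fin k × Fin 2} {w : VT} (h : T.Adj (D.src p) w)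
    (hw : w ≠ D.root p) : OnRay T (D.src p) w :=
  (D.src_fork p).exists_root.choose_spec.2.2 w h hw

theorem root_notMem (p : Fin k × Fin 2) : D.root p ∉ D.F := by
  intro h
  obtain ⟨r, hr⟩ := D.eq_pt_of_src_adj h (D.root_adj p)
  refine D.not_onRay_root p ?_
  rw [hr]
  exact D.onRay_pt (by omega) (D.len_pos p r)

theorem not_onRay_root' (p q : Fin k × Fin 2) : ¬ OnRay T (D.src q) (D.root p) := by
  intro h
  rcases h.adj (D.root_adj p).symm with h1 | h1
  · rw [← h1] at h
    exact D.not_onRay_root p h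
  · have h2 := h1.degree_le
    have h3 := D.vdeg_src p
    rw [vdeg_eq_degree] at h3
    omega

/-- The roots are connected outside of `F`: the rays at the sources are dead ends. -/
theorem root_reachable (hT : T.Connected) (p q : Fin k × Fin 2) :
    (T.induce D.Fᶜ).Reachable ⟨D.root p, D.root_notMem p⟩ ⟨D.root q, D.root_notMem q⟩ := by
  let C : Set VT := {v | ∃ h : v ∈ D.Fᶜ,
    (T.induce D.Fᶜ).Reachable ⟨D.root p, D.root_notMem p⟩ ⟨v, h⟩}
  have hC : ∀ v ∈ C, ∀ w, T.Adj v w → w ∉ D.F → w ∈ C := by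
    rintro v ⟨hv, hr⟩ w hvw hw
    exact ⟨hw, hr.trans (SimpleGraph.Adj.reachable (by simpa using hvw))⟩
  have hCray : ∀ q', ∀ v ∈ C, ¬ OnRay T (D.src q') v := by
    rintro q' v ⟨hv, ⟨w⟩⟩
    suffices h : ∀ {x y : (D.Fᶜ : Set VT)} (w : (T.induce D.Fᶜ).Walk x y),
        ¬ OnRay T (D.src q') x → ¬ OnRay T (D.src q') y from h w (D.not_onRay_root' p q')
    intro x y w
    induction w with
    | nil => exact id
    | @cons x y' y h _ ih =>
      intro hx
      refine ih fun hy' => hx ?_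
      have hxy : T.Adj x y' := h
      rcases hy'.adj hxy.symm with h1 | h1
      · exact absurd (h1 ▸ D.src_mem q') x.2
      · exact h1
  let A : Set VT := {v | v ∈ C ∨ ∃ q', D.root q' ∈ C ∧ (v = D.src q' ∨ OnRay T (D.src q') v)}
  have hA : ∀ v ∈ A, ∀ w, T.Adj v w → w ∈ A := by
    rintro v (hv | ⟨q', hq', rfl | hv⟩) w hvw
    · by_cases hw : w ∈ D.F
      · obtain ⟨q', rfl⟩ := D.eq_src_of_adj hw hv.1 hvw.symm
        refine Or.inr ⟨q', ?_, Or.inl rfl⟩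
        by_cases h : v = D.root q'
        · exact h ▸ hv
        · exact absurd (D.onRay_of_ne_root hvw.symm h) (hCray q' v hv)
      · exact Or.inl (hC v hv w hvw hw)
    · by_cases h : w = D.root q'
      · exact Or.inl (h ▸ hq')
      · exact Or.inr ⟨q', hq', Or.inr (D.onRay_of_ne_root hvw h)⟩
    · exact Or.inr ⟨q', hq', hv.adj hvw⟩
  have hall : ∀ v, v ∈ A := by
    intro v
    have h0 : D.root p ∈ A := Or.inl ⟨D.root_notMem p, SimpleGraph.Reachable.refl _⟩
    obtain ⟨w⟩ := hT.preconnected (D.root p) v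
    generalize D.root p = u at h0 w
    induction w with
    | nil => exact h0
    | cons h _ ih => exact ih (hA _ h0 _ h)
  rcases hall (D.src q) with h | ⟨q', hq', h | h⟩
  · exact absurd (D.src_mem q) h.1
  · rw [D.src_injective h]
    exact hq'.2
  · have h2 := h.degree_le
    have h3 := D.vdeg_src q
    rw [vdeg_eq_degree] at h3
    omega

end Root

/-- A pendant path in `T` that starts outside of `F` can meet `F` only in its end. -/
theorem notMem_of_pendant {n : ℕ} {l u v : VT} (h : Pendant T n l u v) (hl : l ∉ D.F) :
    u ∉ D.F := by
  induction h with
  | leaf _ _ => exact hl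
  | @step n l w u v hw hu _ _ ih =>
    intro hF
    obtain ⟨p, rfl⟩ := D.eq_src_of_adj hF (ih hl) hw.adj.symm
    have := D.vdeg_src p
    omega

theorem pendant_ray (p : Fin k × Fin 2) (r : Arm) :
    Pendant T (r.len a b - 1) (D.pt p r (r.len a b)) (D.pt p r 1) (D.src p) := by
  have key : ∀ s, s + 1 ≤ r.len a b → Pendant T s (D.pt p r (r.len a b))
      (D.pt p r (r.len a b - s)) (D.pt p r (r.len a b - s - 1)) := by
    intro s
    induction s with
    | zero =>
      intro h
      have := D.pt_adj p (r := r) (t := r.len a b - 1) (by omega)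
      rw [show r.len a b - 1 + 1 = r.len a b by omega] at this
      exact .leaf this.symm (D.vdeg_pt_last p r)
    | succ s ih =>
      intro h
      have := D.pt_adj p (r := r) (t := r.len a b - s - 1 - 1) (by omega)
      rw [show r.len a b - s - 1 - 1 + 1 = r.len a b - s - 1 by omega] at this
      refine .step (ih (by omega)) (D.vdeg_pt_inner (by omega) (by omega)) this.symm ?_
      intro h'
      obtain ⟨-, h2, -⟩ := D.pt_inj (by omega) (by omega) h'
      omega
  have h := D.len_pos p r
  have := key (r.len a b - 1) (by omega)
  rwa [show r.len a b - (r.len a b - 1) = 1 by omega, Nat.sub_self, pt_zero] at this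

/-- The short leaves of `T` in `F` are the ends of the designated rays of small length. -/
theorem shortLeaves_cases {θ : ℕ} {l : VT} (hl : l ∈ shortLeaves T θ) (hF : l ∈ D.F) :
    ∃ p r, r.len a b < θ ∧ l = D.pt p r (r.len a b) := by
  obtain ⟨n, u, v, hn, hp, hv⟩ := hl
  have h1 := hp.vdeg_leaf
  rcases D.mem_F_cases hF with ⟨p, rfl⟩ | ⟨p, r, t, h0, ht, rfl⟩
  · have := D.vdeg_src p
    omega
  · obtain rfl : t = r.len a b := by
      by_contra h
      rw [D.vdeg_pt_inner h0 (by omega)] at h1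
      omega
    have := hp.length_unique (D.pendant_ray p r) hv (D.vdeg_src p)
    exact ⟨p, r, by omega, rfl⟩

end DesignatedForks

/-! ### The projection of the tree to the graph `Q` -/

section Projection

variable {k a b : ℕ} {VT : Type*} {T : SimpleGraph VT} [T.LocallyFinite]
  (D : DesignatedForks T k a b) (Δ : CubicGraph k)

open Classical in
/-- The extension of `γ` to a map from `V(T)` to the vertices of `Q` and those of `T` outside
of `F`. -/
def gammaHat (y : VT) : QVertex Δ a b ⊕ {z : VT // z ∉ D.F} :=
  if h : y ∈ D.F then .inl (gamma D Δ ⟨y, h⟩) else .inr ⟨y, h⟩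

theorem gammaHat_mem (y : D.F) : gammaHat D Δ y = .inl (gamma D Δ y) := dif_pos y.2

theorem gammaHat_notMem (z : {z : VT // z ∉ D.F}) : gammaHat D Δ z = .inr z := dif_neg z.2

theorem gammaHat_pt (p : Fin k × Fin 2) {r : Arm} {t : ℕ} (ht : t ≤ r.len a b) :
    gammaHat D Δ (D.pt p r t) = .inl (gadgetPath Δ a b p.1 p.2 r t) := by
  rw [gammaHat, dif_pos (D.pt_mem p r t)]
  have h : t < r.len a b + 1 := by omega
  simp only [D.pt_eq h]
  rw [gamma_ray]

theorem gammaHat_src (p : Fin k × Fin 2) :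
    gammaHat D Δ (D.src p) = .inl (.branch p.1 p.2) := by
  rw [← D.pt_zero p .A, gammaHat_pt D Δ p (by omega)]
  rfl

theorem gammaHat_inner (p : Fin k × Fin 2) {r : Arm} {t : ℕ} (h0 : 0 < t) (ht : t < r.len a b) :
    gammaHat D Δ (D.pt p r t) = .inl (.inner p.1 p.2 r ⟨t - 1, by omega⟩) := by
  rw [gammaHat_pt D Δ p (by omega), gadgetPath, if_neg (by omega), dif_pos]

theorem gammaHat_last (p : Fin k × Fin 2) (r : Arm) :
    gammaHat D Δ (D.pt p r (r.len a b)) = .inl (gadgetEnd Δ a b p.1 p.2 r) := by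
  have := D.len_pos p r
  rw [gammaHat_pt D Δ p le_rfl, gadgetPath, if_neg (by omega), dif_neg (by omega)]

theorem gammaHat_cases {y : VT} {q : QVertex Δ a b} (h : gammaHat D Δ y = .inl q) :
    (∃ p, y = D.src p ∧ q = .branch p.1 p.2) ∨
    (∃ p r t, ∃ (_ : 0 < t) (_ : t < r.len a b), y = D.pt p r t ∧
      q = .inner p.1 p.2 r ⟨t - 1, by omega⟩) ∨
    (∃ p r, y = D.pt p r (r.len a b) ∧ q = gadgetEnd Δ a b p.1 p.2 r) := by
  have hF : y ∈ D.F := by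
    by_contra hF
    rw [gammaHat, dif_neg hF] at h
    exact absurd h (by simp)
  rcases D.mem_F_cases hF with ⟨p, rfl⟩ | ⟨p, r, t, h0, ht, rfl⟩
  · rw [gammaHat_src] at h
    exact Or.inl ⟨p, rfl, (Sum.inl_injective h).symm⟩
  · rcases ht.lt_or_eq with ht | rfl
    · rw [gammaHat_inner D Δ p h0 ht] at h
      exact Or.inr (Or.inl ⟨p, r, t, h0, ht, rfl, (Sum.inl_injective h).symm⟩)
    · rw [gammaHat_last] at h
      exact Or.inr (Or.inr ⟨p, r, rfl, (Sum.inl_injective h).symm⟩)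

theorem gadgetEnd_eq_branch {Δ : CubicGraph k} {i i' : Fin k} {j j' : Fin 2} {r : Arm}
    (h : gadgetEnd Δ a b i j r = .branch i' j') : i = i' ∧ j = 1 ∧ j' = 0 ∧ r = .A := by
  fin_cases j <;> cases r <;> simp [gadgetEnd] at h ⊢
  exact ⟨h.1, h.2.symm⟩

theorem gammaHat_eq_inner {y : VT} {i : Fin k} {j : Fin 2} {r : Arm} {t : ℕ} (h0 : 0 < t)
    (ht : t < r.len a b) (h : gammaHat D Δ y = .inl (.inner i j r ⟨t - 1, by omega⟩)) :
    y = D.pt (i, j) r t := by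
  rcases gammaHat_cases D Δ h with ⟨p, rfl, h1⟩ | ⟨p, r', t', h0', ht', rfl, h1⟩ | ⟨p, r', rfl, h1⟩
  · cases h1
  · obtain ⟨rfl, rfl, rfl, h2⟩ := QVertex.inner.inj h1
    have h3 := congrArg Fin.val (eq_of_heq h2)
    simp at h3
    rw [show t = t' by omega]
  · exact absurd h1.symm (gadgetEnd_ne_inner Δ _)

theorem gammaHat_eq_branch_one {y : VT} {i : Fin k}
    (h : gammaHat D Δ y = .inl (.branch i 1)) : y = D.src (i, 1) := by
  rcases gammaHat_cases D Δ h with ⟨p, rfl, h1⟩ | ⟨p, r', t', h0', ht', rfl, h1⟩ | ⟨p, r', rfl, h1⟩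
  · obtain ⟨rfl, h2⟩ := QVertex.branch.inj h1
    exact congrArg D.src (Prod.ext rfl h2.symm)
  · cases h1
  · have := gadgetEnd_eq_branch h1.symm
    simp at this

theorem gammaHat_eq_branch_zero {y : VT} {i : Fin k}
    (h : gammaHat D Δ y = .inl (.branch i 0)) : y = D.src (i, 0) ∨ y = D.pt (i, 1) .A a := by
  rcases gammaHat_cases D Δ h with ⟨p, rfl, h1⟩ | ⟨p, r', t', h0', ht', rfl, h1⟩ | ⟨p, r', rfl, h1⟩
  · obtain ⟨rfl, h2⟩ := QVertex.branch.inj h1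
    exact Or.inl (congrArg D.src (Prod.ext rfl h2.symm))
  · cases h1
  · obtain ⟨rfl, h2, -, rfl⟩ := gadgetEnd_eq_branch h1.symm
    exact Or.inr (by rw [← h2]; rfl)

theorem gammaHat_x_end (i : Fin k) :
    gammaHat D Δ (D.pt (i, 1) .A a) = .inl (.branch i 0) :=
  gammaHat_last D Δ (i, 1) .A

/-- The designated ray `(j, r)` is mapped to a path that ends in a port. -/
def IsPortArm (j : Fin 2) (r : Arm) : Prop := ¬ (j = 1 ∧ r = .A)

/-- Exactly one designated ray at `s_i^1` and `s_i^2` is mapped to a path that ends in the port of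
a given colour. -/
theorem exists_portArm (x : Port) : ∃ j r, IsPortArm j r ∧
    (∀ i, gadgetEnd Δ a b i j r = .port (Δ.edgeAt i x)) ∧
    ∀ i' j' r' e, gadgetEnd Δ a b i' j' r' = .port e → Δ.colour e = x → j' = j ∧ r' = r := by
  have hc : ∀ i x, Δ.colour (Δ.edgeAt i x) = x := fun i x =>
    (Δ.existsUnique_edge i x).choose_spec.1.2
  cases x
  · refine ⟨0, .A, by simp [IsPortArm], fun _ => rfl, ?_⟩
    intro i' j' r' e h he
    fin_cases j' <;> cases r' <;> simp [gadgetEnd] at h ⊢ <;> rw [← h, hc] at he <;> cases he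
  · refine ⟨0, .B, by simp [IsPortArm], fun _ => rfl, ?_⟩
    intro i' j' r' e h he
    fin_cases j' <;> cases r' <;> simp [gadgetEnd] at h ⊢ <;> rw [← h, hc] at he <;> cases he
  · refine ⟨1, .B, by simp [IsPortArm], fun _ => rfl, ?_⟩
    intro i' j' r' e h he
    fin_cases j' <;> cases r' <;> simp [gadgetEnd] at h ⊢ <;> rw [← h, hc] at he <;> cases he

theorem CubicGraph.mem_edgeAt (Δ : CubicGraph k) (i : Fin k) (x : Port) :
    i ∈ (Δ.edgeAt i x : Sym2 (Fin k)) := (Δ.existsUnique_edge i x).choose_spec.1.1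

theorem CubicGraph.edgeAt_eq (Δ : CubicGraph k) {i : Fin k} {e : Δ.graph.edgeSet}
    (h : i ∈ (e : Sym2 (Fin k))) : Δ.edgeAt i (Δ.colour e) = e :=
  ((Δ.existsUnique_edge i (Δ.colour e)).choose_spec.2 e ⟨h, rfl⟩).symm

/-- Exactly two designated rays end in a given port. -/
theorem exists_port_ends (e : Δ.graph.edgeSet) : ∃ i i' j r, i ≠ i' ∧ IsPortArm j r ∧
    gadgetEnd Δ a b i j r = .port e ∧ gadgetEnd Δ a b i' j r = .port e ∧
    ∀ y, gammaHat D Δ y = .inl (.port e) →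
      y = D.pt (i, j) r (r.len a b) ∨ y = D.pt (i', j) r (r.len a b) := by
  obtain ⟨j, r, hjr, hend, huniq⟩ := exists_portArm (a := a) (b := b) Δ (Δ.colour e)
  obtain ⟨e, he⟩ := e
  induction e using Sym2.ind with
  | _ i i' =>
  have hne : i ≠ i' := SimpleGraph.Adj.ne he
  refine ⟨i, i', j, r, hne, hjr, ?_, ?_, ?_⟩
  · rw [hend, Δ.edgeAt_eq (by simp)]
  · rw [hend, Δ.edgeAt_eq (by simp)]
  · intro y hy
    rcases gammaHat_cases D Δ hy with ⟨p, rfl, h1⟩ | ⟨p, r', t', h0', ht', rfl, h1⟩ |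
      ⟨⟨i'', j'⟩, r', rfl, h1⟩
    · cases h1
    · cases h1
    · obtain ⟨rfl, rfl⟩ := huniq _ _ _ _ h1.symm rfl
      rw [hend] at h1
      have h2 := Δ.mem_edgeAt i'' (Δ.colour ⟨s(i, i'), he⟩)
      rw [← QVertex.port.inj h1] at h2
      rcases Sym2.mem_iff.1 h2 with rfl | rfl
      · exact Or.inl rfl
      · exact Or.inr rfl

theorem qGraph_gadgetPath_ne {i : Fin k} {j : Fin 2} {r : Arm} {t : ℕ} (ht : t < r.len a b) :
    gadgetPath Δ a b i j r t ≠ gadgetPath Δ a b i j r (t + 1) := by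
  intro h
  rcases gadgetPath_left Δ i j ht with ⟨h1, e1⟩ | ⟨u1, h1, e1⟩ <;>
  rcases gadgetPath_right Δ i j ht with ⟨h2, e2⟩ | ⟨u2, h2, e2⟩ <;>
  rw [e1, e2] at h
  · have := gadgetEnd_eq_branch h.symm
    omega
  · cases h
  · exact gadgetEnd_ne_inner Δ _ h.symm
  · cases h
    omega

theorem gammaHat_ne {y w : VT} (h : T.Adj y w) : gammaHat D Δ y ≠ gammaHat D Δ w := by
  by_cases hy : y ∈ D.F <;> by_cases hw : w ∈ D.F
  · intro he
    obtain ⟨p, r, t, h1⟩ := D.induce_edge s(⟨y, hy⟩, ⟨w, hw⟩) (by simpa using h)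
    have h2 := congrArg (Sym2.map (gamma D Δ)) h1
    rw [gammaE_ray, Sym2.map_mk] at h2
    have h3 : gamma D Δ ⟨y, hy⟩ = gamma D Δ ⟨w, hw⟩ := by
      rw [gammaHat, gammaHat, dif_pos hy, dif_pos hw] at he
      exact Sum.inl_injective he
    have h4 := qGraph_gadgetPath_ne Δ (i := p.1) (j := p.2) t.2
    rw [Sym2.eq_iff] at h2
    rcases h2 with h2 | h2
    · exact h4 (h2.1.symm.trans (h3.trans h2.2))
    · exact h4 (h2.2.symm.trans (h3.symm.trans h2.1))
  · simp [gammaHat, hy, hw]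
  · simp [gammaHat, hy, hw]
  · simp only [gammaHat, hy, hw]
    intro he
    have := congrArg Subtype.val (Sum.inr_injective he)
    exact h.ne this

/-- An edge of `T`, with its direction, is determined by its image. -/
theorem gammaHat_dart_inj {y w y' w' : VT} (h : T.Adj y w) (h' : T.Adj y' w')
    (hy : gammaHat D Δ y = gammaHat D Δ y') (hw : gammaHat D Δ w = gammaHat D Δ w') :
    y = y' ∧ w = w' := by
  have hF : ∀ {y y' : VT}, gammaHat D Δ y = gammaHat D Δ y' → y ∉ D.F → y = y' := by
    intro y y' he hy
    by_cases hy' : y' ∈ D.F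
    · simp [gammaHat, hy, hy'] at he
    · simp only [gammaHat, hy, hy'] at he
      exact congrArg Subtype.val (Sum.inr_injective he)
  have hS : ∀ {y y' w w' : VT}, gammaHat D Δ y = gammaHat D Δ y' → y ∈ D.F → w ∉ D.F →
      w = w' → T.Adj y w → T.Adj y' w' → y = y' := by
    rintro y y' w _ he hy hw rfl hyw hyw'
    have hy' : y' ∈ D.F := by
      by_contra hy'
      exact hy' (hF he.symm hy' ▸ hy)
    obtain ⟨p, rfl⟩ := D.eq_src_of_adj hy hw hyw
    obtain ⟨p', rfl⟩ := D.eq_src_of_adj hy' hw hyw'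
    rw [gammaHat_src, gammaHat_src] at he
    obtain ⟨h1, h2⟩ := QVertex.branch.inj (Sum.inl_injective he)
    rw [Prod.ext h1 h2]
  by_cases hyF : y ∈ D.F <;> by_cases hwF : w ∈ D.F
  · have hyF' : y' ∈ D.F := by
      by_contra hy'
      exact hy' (hF hy.symm hy' ▸ hyF)
    have hwF' : w' ∈ D.F := by
      by_contra hw'
      exact hw' (hF hw.symm hw' ▸ hwF)
    simp only [gammaHat, hyF, hyF', hwF, hwF', dif_pos] at hy hw
    have h1 := gammaE_injective D Δ s(⟨y, hyF⟩, ⟨w, hwF⟩) s(⟨y', hyF'⟩, ⟨w', hwF'⟩) h h'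
      (by rw [Sym2.map_mk, Sym2.map_mk, Sum.inl_injective hy, Sum.inl_injective hw])
    rw [Sym2.eq_iff] at h1
    rcases h1 with ⟨h1, h2⟩ | ⟨h1, h2⟩
    · exact ⟨congrArg Subtype.val h1, congrArg Subtype.val h2⟩
    · exfalso
      have h3 : y = w' := congrArg Subtype.val h1
      apply gammaHat_ne D Δ h'
      rw [← h3]
      simp only [gammaHat, hyF, hyF', dif_pos]
      rw [hy]
  · have h1 := hF hw hwF
    exact ⟨hS hy hyF hwF h1 h h', h1⟩
  · have h1 := hF hy hyF
    exact ⟨h1, hS hw hwF hyF h1 h.symm h'.symm⟩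
  · exact ⟨hF hy hyF, hF hw hwF⟩

/-- The edges of `T` with an end `x` such that `x` has the same image as `y` are exactly the two
different edges from `y` to `w` and from `y'` to `w'`. -/
structure IsPair (y w y' w' : VT) : Prop where
  adj : T.Adj y w
  adj' : T.Adj y' w'
  eq : gammaHat D Δ y' = gammaHat D Δ y
  ne : y = y' → w ≠ w'
  cases : ∀ {x z}, T.Adj x z → gammaHat D Δ x = gammaHat D Δ y →
    x = y ∧ z = w ∨ x = y' ∧ z = w'

variable {D Δ} in
theorem IsPair.symm {y w y' w' : VT} (h : IsPair D Δ y w y' w') : IsPair D Δ y' w' y w :=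
  ⟨h.adj', h.adj, h.eq.symm, fun he hw => h.ne he.symm hw.symm,
    fun hx hxy => (h.cases hx (hxy.trans h.eq)).symm⟩

theorem isPair_inner (p : Fin k × Fin 2) {r : Arm} {t : ℕ} (h0 : 0 < t) (ht : t < r.len a b) :
    IsPair D Δ (D.pt p r t) (D.pt p r (t - 1)) (D.pt p r t) (D.pt p r (t + 1)) := by
  have h1 := D.pt_adj p (r := r) (t := t - 1) (by omega)
  rw [show t - 1 + 1 = t by omega] at h1
  refine ⟨h1.symm, D.pt_adj p ht, rfl, fun _ h => ?_, ?_⟩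
  · have := (D.pt_inj (by omega) (by omega) h).2.1
    omega
  · intro x z hxz hx
    rw [gammaHat_inner D Δ p h0 ht] at hx
    obtain rfl := gammaHat_eq_inner D Δ h0 ht hx
    rcases D.pt_neighbour h0 ht.le hxz with rfl | ⟨-, rfl⟩
    · exact Or.inl ⟨rfl, rfl⟩
    · exact Or.inr ⟨rfl, rfl⟩

theorem isPair_port (e : Δ.graph.edgeSet) : ∃ i i' j r, i ≠ i' ∧ IsPortArm j r ∧
    gammaHat D Δ (D.pt (i, j) r (r.len a b)) = .inl (.port e) ∧
    IsPair D Δ (D.pt (i, j) r (r.len a b)) (D.pt (i, j) r (r.len a b - 1))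
      (D.pt (i', j) r (r.len a b)) (D.pt (i', j) r (r.len a b - 1)) := by
  obtain ⟨i, i', j, r, hne, hjr, h1, h2, h3⟩ := exists_port_ends D Δ e
  have hpos := D.len_pos (i, j) r
  have hadj : ∀ p : Fin k × Fin 2, T.Adj (D.pt p r (r.len a b)) (D.pt p r (r.len a b - 1)) := by
    intro p
    have h1 := D.pt_adj p (r := r) (t := r.len a b - 1) (by omega)
    rw [show r.len a b - 1 + 1 = r.len a b by omega] at h1
    exact h1.symm
  have hg : gammaHat D Δ (D.pt (i, j) r (r.len a b)) = .inl (.port e) := by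
    rw [gammaHat_last, h1]
  refine ⟨i, i', j, r, hne, hjr, hg, hadj _, hadj _, ?_, ?_, ?_⟩
  · rw [hg, gammaHat_last, h2]
  · intro h
    have := (D.pt_inj le_rfl le_rfl h).1
    exact absurd (congrArg Prod.fst this) hne
  · intro x z hxz hx
    rw [hg] at hx
    rcases h3 x hx with rfl | rfl <;> rcases D.pt_neighbour hpos le_rfl hxz with rfl | ⟨h, -⟩
    · exact Or.inl ⟨rfl, rfl⟩
    · omega
    · exact Or.inr ⟨rfl, rfl⟩
    · omega

end Projection

/-! ### Lifts of the tree -/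

section Lift

variable {k a b : ℕ} {VT : Type*} {T : SimpleGraph VT} [T.LocallyFinite]
  {D : DesignatedForks T k a b} {Δ : CubicGraph k} {VG : Type*} {c : VG → QVertex Δ a b}

/-- The colouring `c` of `G`, extended by the identity on the vertices of `T` outside of `F`. -/
def hatProj (D : DesignatedForks T k a b) (c : VG → QVertex Δ a b) :
    VG ⊕ {z : VT // z ∉ D.F} → QVertex Δ a b ⊕ {z : VT // z ∉ D.F} := Sum.map c id

/-- The graph `H` arises from `T` by splitting and identifying vertices over the same vertex of
`Q`: the edge `{y, w}` of `T` becomes the edge of `H` with ends `E y w` and `E w y`, which lie over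
the images of `y` and `w`, respectively. -/
structure IsLift (D : DesignatedForks T k a b) (c : VG → QVertex Δ a b)
    (H : SimpleGraph (VG ⊕ {z : VT // z ∉ D.F})) (E : VT → VT → VG ⊕ {z : VT // z ∉ D.F}) :
    Prop where
  proj : ∀ {y w}, T.Adj y w → hatProj D c (E y w) = gammaHat D Δ y
  adj : ∀ {y w}, T.Adj y w → H.Adj (E y w) (E w y)
  exists_of_adj : ∀ {u v}, H.Adj u v → ∃ y w, T.Adj y w ∧ E y w = u ∧ E w y = v

namespace IsLift

variable {H : SimpleGraph (VG ⊕ {z : VT // z ∉ D.F})} {E : VT → VT → VG ⊕ {z : VT // z ∉ D.F}}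
  (h : IsLift D c H E)
include h

theorem eq_inr {y w : VT} (hyw : T.Adj y w) (hy : y ∉ D.F) : E y w = .inr ⟨y, hy⟩ := by
  have h1 := h.proj hyw
  rw [gammaHat_notMem D Δ ⟨y, hy⟩] at h1
  generalize E y w = u at h1
  rcases u with g | z
  · simp [hatProj] at h1
  · simpa [hatProj] using h1

theorem dart_inj {y w y' w' : VT} (hyw : T.Adj y w) (hyw' : T.Adj y' w') (h1 : E y w = E y' w')
    (h2 : E w y = E w' y') : y = y' ∧ w = w' :=
  gammaHat_dart_inj D Δ hyw hyw' (by rw [← h.proj hyw, h1, h.proj hyw'])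
    (by rw [← h.proj hyw.symm, h2, h.proj hyw'.symm])

theorem vdeg_eq (u : VG ⊕ {z : VT // z ∉ D.F}) :
    vdeg H u = {d : VT × VT | T.Adj d.1 d.2 ∧ E d.1 d.2 = u}.ncard := by
  have hi : H.neighborSet u =
      (fun d : VT × VT => E d.2 d.1) '' {d : VT × VT | T.Adj d.1 d.2 ∧ E d.1 d.2 = u} := by
    ext v
    constructor
    · intro hv
      obtain ⟨y, w, hyw, h1, h2⟩ := h.exists_of_adj hv
      exact ⟨(y, w), ⟨hyw, h1⟩, h2⟩
    · rintro ⟨⟨y, w⟩, ⟨hyw, rfl⟩, rfl⟩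
      exact h.adj hyw
  rw [vdeg, hi, Set.InjOn.ncard_image]
  rintro ⟨y, w⟩ ⟨hyw, h1⟩ ⟨y', w'⟩ ⟨hyw', h1'⟩ he
  obtain ⟨rfl, rfl⟩ := h.dart_inj hyw hyw' (h1.trans h1'.symm) he
  rfl

theorem exists_of_vdeg_pos {u : VG ⊕ {z : VT // z ∉ D.F}} (hu : 0 < vdeg H u) :
    ∃ y w, T.Adj y w ∧ E y w = u := by
  obtain ⟨v, hv⟩ := exists_adj_of_vdeg_pos hu
  obtain ⟨y, w, hyw, h1, -⟩ := h.exists_of_adj hv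
  exact ⟨y, w, hyw, h1⟩

theorem dart_unique {u : VG ⊕ {z : VT // z ∉ D.F}} (hu : vdeg H u = 1) {y w y' w' : VT}
    (hyw : T.Adj y w) (hyw' : T.Adj y' w') (h1 : E y w = u) (h2 : E y' w' = u) :
    y = y' ∧ w = w' := by
  subst h1
  refine h.dart_inj hyw hyw' h2.symm (eq_of_vdeg_one hu (h.adj hyw) ?_)
  rw [← h2]
  exact h.adj hyw'

theorem vdeg_inr (z : {z : VT // z ∉ D.F}) : vdeg H (.inr z) = vdeg T z := by
  rw [h.vdeg_eq, vdeg]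
  have : {d : VT × VT | T.Adj d.1 d.2 ∧ E d.1 d.2 = .inr z} =
      (fun w => (z.1, w)) '' T.neighborSet z := by
    ext ⟨y, w⟩
    constructor
    · rintro ⟨hyw, h1⟩
      have h2 := h.proj hyw
      simp only at h1 hyw
      rw [h1] at h2
      have hy : y ∉ D.F := by
        intro hy
        rw [gammaHat_mem D Δ ⟨y, hy⟩] at h2
        simp [hatProj] at h2
      rw [h.eq_inr hyw hy] at h1
      obtain rfl := Sum.inr_injective h1
      exact ⟨w, hyw, rfl⟩
    · rintro ⟨w', hw, he⟩
      obtain ⟨rfl, rfl⟩ := Prod.mk.inj he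
      exact ⟨hw, h.eq_inr hw z.2⟩
  rw [this, Set.ncard_image_of_injective _ (Prod.mk_right_injective _)]

theorem vdeg_of_pair_eq {y w y' w' : VT} (hp : IsPair D Δ y w y' w') (he : E y w = E y' w') :
    vdeg H (E y w) = 2 := by
  have : {d : VT × VT | T.Adj d.1 d.2 ∧ E d.1 d.2 = E y w} = {(y, w), (y', w')} := by
    ext ⟨x, z⟩
    simp only [Set.mem_ofPred_eq, Set.mem_insert_iff, Set.mem_singleton_iff, Prod.mk.injEq]
    constructor
    · rintro ⟨hxz, h1⟩
      exact hp.cases hxz (by rw [← h.proj hxz, h1, h.proj hp.adj])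
    · rintro (⟨rfl, rfl⟩ | ⟨rfl, rfl⟩)
      · exact ⟨hp.adj, rfl⟩
      · exact ⟨hp.adj', he.symm⟩
  rw [h.vdeg_eq, this, Set.ncard_pair]
  intro h1
  exact hp.ne (congrArg Prod.fst h1) (congrArg Prod.snd h1)

theorem vdeg_of_pair_ne {y w y' w' : VT} (hp : IsPair D Δ y w y' w') (hne : E y w ≠ E y' w') :
    vdeg H (E y w) = 1 := by
  have : {d : VT × VT | T.Adj d.1 d.2 ∧ E d.1 d.2 = E y w} = {(y, w)} := by
    ext ⟨x, z⟩
    simp only [Set.mem_ofPred_eq, Set.mem_singleton_iff, Prod.mk.injEq]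
    constructor
    · rintro ⟨hxz, h1⟩
      rcases hp.cases hxz (by rw [← h.proj hxz, h1, h.proj hp.adj]) with h2 | ⟨rfl, rfl⟩
      · exact h2
      · exact absurd h1.symm hne
    · rintro ⟨rfl, rfl⟩
      exact ⟨hp.adj, rfl⟩
  rw [h.vdeg_eq, this, Set.ncard_singleton]

variable [Finite VT] [Finite VG]

theorem vdeg_pos {y w : VT} (hyw : T.Adj y w) : 0 < vdeg H (E y w) :=
  ForkNumber.vdeg_pos (h.adj hyw)

/-- A pendant path of `H` that lifts a path of `T` with inner vertices that are inner vertices of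
designated rays. It cannot split because no component of `H` is a path. -/
theorem pendant_of_path (hH : Branching H) (Y : ℕ → VT) (m : ℕ)
    (hadj : ∀ s ≤ m, T.Adj (Y s) (Y (s + 1)))
    (hpair : ∀ s < m, IsPair D Δ (Y (s + 1)) (Y s) (Y (s + 1)) (Y (s + 2)))
    (h0 : vdeg H (E (Y 0) (Y 1)) = 1) :
    Pendant H m (E (Y 0) (Y 1)) (E (Y m) (Y (m + 1))) (E (Y (m + 1)) (Y m)) := by
  induction m with
  | zero => exact .leaf (h.adj (hadj 0 le_rfl)) h0
  | succ m ih =>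
    have hp := ih (fun s hs => hadj s (by omega)) (fun s hs => hpair s (by omega))
    have hq := hpair m (by omega)
    have he : E (Y (m + 1)) (Y m) = E (Y (m + 1)) (Y (m + 2)) := by
      by_contra hne
      exact hp.vdeg_ne_one hH (h.vdeg_of_pair_ne hq hne)
    have h2 := h.vdeg_of_pair_eq hq he
    rw [he] at hp h2
    refine .step hp h2 (h.adj (hadj (m + 1) le_rfl)) ?_
    intro h3
    have h4 := (h.dart_inj (hadj m (by omega)) (hadj (m + 1) le_rfl).symm h3 he).1
    exact hq.ne rfl h4

end IsLift

end Lift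

/-! ### Degree sums over the vertices of `Q` -/

section Sums

variable {k a b : ℕ} {VT : Type*} {T : SimpleGraph VT} [T.LocallyFinite]
  {D : DesignatedForks T k a b} {Δ : CubicGraph k} {VG : Type*} {c : VG → QVertex Δ a b}
  {H : SimpleGraph (VG ⊕ {z : VT // z ∉ D.F})} {E : VT → VT → VG ⊕ {z : VT // z ∉ D.F}}
  [Fintype VT] [Fintype VG]

open Classical in
/-- The sum of `φ (deg u)` over the vertices `u` of `H` over the vertex `q` of `Q`. -/
def upSum (D : DesignatedForks T k a b) (c : VG → QVertex Δ a b)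
    (H : SimpleGraph (VG ⊕ {z : VT // z ∉ D.F})) (φ : ℕ → ℤ)
    (q : QVertex Δ a b ⊕ {z : VT // z ∉ D.F}) : ℤ :=
  ∑ u with hatProj D c u = q, φ (vdeg H u)

open Classical in
/-- The sum of `φ (deg y)` over the vertices `y` of `T` over the vertex `q` of `Q`. -/
def downSum (D : DesignatedForks T k a b) (Δ : CubicGraph k) (φ : ℕ → ℤ)
    (q : QVertex Δ a b ⊕ {z : VT // z ∉ D.F}) : ℤ :=
  ∑ y with gammaHat D Δ y = q, φ (vdeg T y)

variable (h : IsLift D c H E)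
include h

/-- The sum of the degrees over a vertex of `Q` is the number of edges there, which is the same in
`H` and in `T`. -/
theorem IsLift.upSum_id (q : QVertex Δ a b ⊕ {z : VT // z ∉ D.F}) :
    upSum D c H (fun d => d) q = downSum D Δ (fun d => d) q := by
  classical
  have h1 : downSum D Δ (fun d => d) q =
      (({d : VT × VT | T.Adj d.1 d.2 ∧ gammaHat D Δ d.1 = q} : Finset (VT × VT)).card : ℤ) := by
    rw [downSum, Finset.card_eq_sum_card_fiberwise (f := Prod.fst)
      (t := ({y | gammaHat D Δ y = q} : Finset VT))]
    · push_cast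
      refine Finset.sum_congr rfl fun y hy => ?_
      congr 1
      rw [vdeg, ← Set.ncard_coe_finset, ← Set.ncard_image_of_injective (T.neighborSet y)
        (Prod.mk_right_injective y)]
      congr 1
      ext ⟨x, z⟩
      simp only [Finset.mem_filter, Finset.mem_univ, true_and] at hy
      simp only [Set.mem_image, SimpleGraph.mem_neighborSet, Prod.mk.injEq, Finset.coe_filter,
        Finset.mem_filter, Finset.mem_univ, true_and, Set.mem_ofPred_eq]
      constructor
      · rintro ⟨z, hz, rfl, rfl⟩
        exact ⟨⟨hz, hy⟩, rfl⟩
      · rintro ⟨⟨hz, -⟩, rfl⟩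
        exact ⟨z, hz, rfl, rfl⟩
    · intro d hd
      simp at hd ⊢
      exact hd.2
  rw [h1, upSum, Finset.card_eq_sum_card_fiberwise (f := fun d => E d.1 d.2)
    (t := ({u | hatProj D c u = q} : Finset _))]
  · push_cast
    refine Finset.sum_congr rfl fun u hu => ?_
    congr 1
    rw [h.vdeg_eq, ← Set.ncard_coe_finset]
    congr 1
    ext ⟨x, z⟩
    simp only [Finset.mem_filter, Finset.mem_univ, true_and] at hu
    simp only [Set.mem_ofPred_eq, Finset.coe_filter, Finset.mem_filter, Finset.mem_univ, true_and]
    constructor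
    · rintro ⟨hz, rfl⟩
      exact ⟨⟨hz, by rw [← h.proj hz, hu]⟩, rfl⟩
    · rintro ⟨⟨hz, -⟩, h2⟩
      exact ⟨hz, h2⟩
  · rintro ⟨x, z⟩ hd
    simp at hd ⊢
    rw [h.proj hd.1, hd.2]

theorem IsLift.upSum_inr (φ : ℕ → ℤ) (z : {z : VT // z ∉ D.F}) :
    upSum D c H φ (.inr z) = downSum D Δ φ (.inr z) := by
  classical
  rw [upSum, downSum, Finset.sum_eq_single (.inr z), Finset.sum_eq_single z.1, h.vdeg_inr]
  · intro y hy hne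
    simp only [Finset.mem_filter, Finset.mem_univ, true_and] at hy
    by_cases hyF : y ∈ D.F
    · rw [gammaHat_mem D Δ ⟨y, hyF⟩] at hy
      cases hy
    · rw [gammaHat_notMem D Δ ⟨y, hyF⟩] at hy
      exact absurd (congrArg Subtype.val (Sum.inr_injective hy)) hne
  · simp [gammaHat_notMem]
  · intro u hu hne
    replace hu := (Finset.mem_filter.1 hu).2
    rcases u with g | z'
    · simp [hatProj] at hu
    · exact absurd (congrArg Sum.inr (Sum.inr_injective hu)) hne
  · intro hn
    rw [Finset.mem_filter] at hn
    exact absurd ⟨Finset.mem_univ _, rfl⟩ hn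

/-- If `H` is isomorphic to `T`, then the excess of `H` over `T` of the sums of `φ (deg u)` is `0`
in total. -/
theorem IsLift.sum_excess [Fintype (QVertex Δ a b)] {f : T ↪g H} (hf : IsCopy f) (φ : ℕ → ℤ)
    (hφ : φ 0 = 0) :
    ∑ q : QVertex Δ a b, (upSum D c H φ (.inl q) - downSum D Δ φ (.inl q)) = 0 := by
  classical
  have h1 : ∑ q, upSum D c H φ q = ∑ u, φ (vdeg H u) :=
    Finset.sum_fiberwise _ _ _
  have h2 : ∑ q, downSum D Δ φ q = ∑ y, φ (vdeg T y) :=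
    Finset.sum_fiberwise _ _ _
  have h3 := hf.sum_vdeg φ hφ
  rw [← h1, ← h2, Fintype.sum_sum_type, Fintype.sum_sum_type,
    Finset.sum_congr rfl fun z _ => h.upSum_inr φ z] at h3
  rw [Finset.sum_sub_distrib]
  linarith

theorem IsLift.upSum_pair {y w y' w' : VT} (hp : IsPair D Δ y w y' w') (φ : ℕ → ℤ)
    (hφ : φ 0 = 0) [Decidable (E y w = E y' w')] :
    upSum D c H φ (gammaHat D Δ y) = if E y w = E y' w' then φ 2 else 2 * φ 1 := by
  classical
  have hsupp : ∀ u, hatProj D c u = gammaHat D Δ y → u ≠ E y w → u ≠ E y' w' →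
      φ (vdeg H u) = 0 := by
    intro u hu h1 h2
    rcases Nat.eq_zero_or_pos (vdeg H u) with h0 | h0
    · rw [h0, hφ]
    · obtain ⟨x, z, hxz, rfl⟩ := h.exists_of_vdeg_pos h0
      rw [h.proj hxz] at hu
      rcases hp.cases hxz hu with ⟨rfl, rfl⟩ | ⟨rfl, rfl⟩
      · exact absurd rfl h1
      · exact absurd rfl h2
  have hm : hatProj D c (E y w) = gammaHat D Δ y := h.proj hp.adj
  have hm' : hatProj D c (E y' w') = gammaHat D Δ y := by rw [h.proj hp.adj', hp.eq]
  have hsub : ({E y w, E y' w'} : Finset _) ⊆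
      ({u | hatProj D c u = gammaHat D Δ y} : Finset _) := by
    intro u hu
    simp only [Finset.mem_insert, Finset.mem_singleton] at hu
    rcases hu with rfl | rfl <;> simp [hm, hm']
  rw [upSum, ← Finset.sum_subset hsub]
  · split_ifs with he
    · rw [← he, Finset.pair_eq_singleton, Finset.sum_singleton, h.vdeg_of_pair_eq hp he]
    · rw [Finset.sum_pair he, h.vdeg_of_pair_ne hp he, h.vdeg_of_pair_ne hp.symm (Ne.symm he)]
      ring
  · intro u hu hn
    simp only [Finset.mem_insert, Finset.mem_singleton, not_or, Finset.mem_filter,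
      Finset.mem_univ, true_and] at hu hn
    exact hsupp u hu hn.1 hn.2

omit h

theorem downSum_inner (φ : ℕ → ℤ) (p : Fin k × Fin 2) {r : Arm} {t : ℕ} (h0 : 0 < t)
    (ht : t < r.len a b) : downSum D Δ φ (gammaHat D Δ (D.pt p r t)) = φ 2 := by
  classical
  rw [downSum, Finset.sum_eq_single (D.pt p r t), D.vdeg_pt_inner h0 ht]
  · intro y hy hne
    simp only [Finset.mem_filter, Finset.mem_univ, true_and] at hy
    rw [gammaHat_inner D Δ p h0 ht] at hy
    exact absurd (gammaHat_eq_inner D Δ h0 ht hy) hne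
  · simp

theorem downSum_port (φ : ℕ → ℤ) (e : Δ.graph.edgeSet) :
    downSum D Δ φ (.inl (.port e)) = 2 * φ 1 := by
  classical
  obtain ⟨i, i', j, r, hne, -, h1, h2, h3⟩ := exists_port_ends D Δ e
  have : ({y | gammaHat D Δ y = .inl (.port e)} : Finset VT) =
      {D.pt (i, j) r (r.len a b), D.pt (i', j) r (r.len a b)} := by
    ext y
    simp only [Finset.mem_filter, Finset.mem_univ, true_and, Finset.mem_insert,
      Finset.mem_singleton]
    refine ⟨h3 y, ?_⟩
    rintro (rfl | rfl)
    · rw [gammaHat_last, h1]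
    · rw [gammaHat_last, h2]
  rw [downSum, this, Finset.sum_pair, D.vdeg_pt_last, D.vdeg_pt_last]
  · ring
  · intro h
    exact hne (congrArg Prod.fst (D.pt_inj le_rfl le_rfl h).1)

theorem downSum_branch_one (φ : ℕ → ℤ) (i : Fin k) :
    downSum D Δ φ (.inl (.branch i 1)) = φ (vdeg T (D.src (i, 1))) := by
  classical
  rw [downSum, Finset.sum_eq_single (D.src (i, 1))]
  · intro y hy hne
    simp only [Finset.mem_filter, Finset.mem_univ, true_and] at hy
    exact absurd (gammaHat_eq_branch_one D Δ hy) hne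
  · simp [gammaHat_src]

theorem downSum_branch_zero (φ : ℕ → ℤ) (i : Fin k) :
    downSum D Δ φ (.inl (.branch i 0)) = φ (vdeg T (D.src (i, 0))) + φ 1 := by
  classical
  have : ({y | gammaHat D Δ y = .inl (.branch i 0)} : Finset VT) =
      {D.src (i, 0), D.pt (i, 1) .A a} := by
    ext y
    simp only [Finset.mem_filter, Finset.mem_univ, true_and, Finset.mem_insert,
      Finset.mem_singleton]
    refine ⟨gammaHat_eq_branch_zero D Δ, ?_⟩
    rintro (rfl | rfl)
    · rw [gammaHat_src]
    · rw [gammaHat_x_end]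
  have h1 := D.vdeg_pt_last (i, 1) .A
  rw [downSum, this, Finset.sum_pair]
  · simp only [Arm.len] at h1
    rw [h1]
  · intro h
    have := D.vdeg_src (i, 0)
    simp only [Arm.len] at h1
    rw [h] at this
    omega

end Sums

/-! ### Splits of the designated rays -/

section Splits

variable {k a b : ℕ} {VT : Type*} {T : SimpleGraph VT} [T.LocallyFinite]
  {D : DesignatedForks T k a b} {Δ : CubicGraph k} {VG : Type*} {c : VG → QVertex Δ a b}
  {H : SimpleGraph (VG ⊕ {z : VT // z ∉ D.F})} {E : VT → VT → VG ⊕ {z : VT // z ∉ D.F}}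

/-- The lift splits the inner vertex in position `t` of a designated ray. -/
def IsSplit (D : DesignatedForks T k a b) (E : VT → VT → VG ⊕ {z : VT // z ∉ D.F})
    (p : Fin k × Fin 2) (r : Arm) (t : ℕ) : Prop :=
  0 < t ∧ t < r.len a b ∧ E (D.pt p r t) (D.pt p r (t - 1)) ≠ E (D.pt p r t) (D.pt p r (t + 1))

/-- The vertices of `Q` in the interior of the path from `v_i^2` to `v_i^1` that are split. -/
def splitX (D : DesignatedForks T k a b) (Δ : CubicGraph k)
    (E : VT → VT → VG ⊕ {z : VT // z ∉ D.F}) : Set (QVertex Δ a b) :=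
  {q | ∃ i t, IsSplit D E (i, 1) .A t ∧ gammaHat D Δ (D.pt (i, 1) .A t) = .inl q}

/-- The vertices of `Q` in the interior of the paths to the ports that are split. -/
def splitY (D : DesignatedForks T k a b) (Δ : CubicGraph k)
    (E : VT → VT → VG ⊕ {z : VT // z ∉ D.F}) : Set (QVertex Δ a b) :=
  {q | ∃ p r t, IsPortArm p.2 r ∧ IsSplit D E p r t ∧ gammaHat D Δ (D.pt p r t) = .inl q}

/-- The ports that are not split. -/
def joined (D : DesignatedForks T k a b) (c : VG → QVertex Δ a b)
    (H : SimpleGraph (VG ⊕ {z : VT // z ∉ D.F})) : Set (QVertex Δ a b) :=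
  {q | (∃ e, q = .port e) ∧ ∃ u, hatProj D c u = .inl q ∧ vdeg H u = 2}

/-- The vertices of degree `2` of `H` over the vertices `v_i^j` of `Q`. -/
def thinBranch (D : DesignatedForks T k a b) (c : VG → QVertex Δ a b)
    (H : SimpleGraph (VG ⊕ {z : VT // z ∉ D.F})) : Set (VG ⊕ {z : VT // z ∉ D.F}) :=
  {u | (∃ i j, hatProj D c u = .inl (.branch i j)) ∧ vdeg H u = 2}

namespace IsLift

variable (h : IsLift D c H E)
include h

theorem vdeg_split {p : Fin k × Fin 2} {r : Arm} {t : ℕ} (hs : IsSplit D E p r t) :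
    vdeg H (E (D.pt p r t) (D.pt p r (t - 1))) = 1 ∧
      vdeg H (E (D.pt p r t) (D.pt p r (t + 1))) = 1 := by
  have hp := isPair_inner D Δ p hs.1 hs.2.1
  exact ⟨h.vdeg_of_pair_ne hp hs.2.2, h.vdeg_of_pair_ne hp.symm hs.2.2.symm⟩

variable [Finite VT] [Finite VG] (hB : Branching H)
include hB

theorem pendant_up {p : Fin k × Fin 2} {r : Arm} {t m : ℕ} (hm : t + m + 1 ≤ r.len a b)
    (h1 : vdeg H (E (D.pt p r t) (D.pt p r (t + 1))) = 1) :
    Pendant H m (E (D.pt p r t) (D.pt p r (t + 1)))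
      (E (D.pt p r (t + m)) (D.pt p r (t + m + 1)))
      (E (D.pt p r (t + m + 1)) (D.pt p r (t + m))) := by
  refine h.pendant_of_path hB (fun s => D.pt p r (t + s)) m ?_ ?_ h1
  · intro s hs
    exact D.pt_adj p (by omega)
  · intro s hs
    exact isPair_inner D Δ p (t := t + s + 1) (by omega) (by omega)

theorem pendant_down {p : Fin k × Fin 2} {r : Arm} {t : ℕ} (h0 : 0 < t) (ht : t ≤ r.len a b)
    (h1 : vdeg H (E (D.pt p r t) (D.pt p r (t - 1))) = 1) :
    Pendant H (t - 1) (E (D.pt p r t) (D.pt p r (t - 1)))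
      (E (D.pt p r 1) (D.src p)) (E (D.src p) (D.pt p r 1)) := by
  have := h.pendant_of_path hB (fun s => D.pt p r (t - s)) (t - 1) ?_ ?_ h1
  · simp only [show t - (t - 1) = 1 by omega, show t - (t - 1 + 1) = 0 by omega, D.pt_zero,
      Nat.sub_zero] at this
    exact this
  · intro s hs
    have h2 := D.pt_adj p (r := r) (t := t - (s + 1)) (by omega)
    rw [show t - (s + 1) + 1 = t - s by omega] at h2
    exact h2.symm
  · intro s hs
    have h2 := isPair_inner D Δ p (r := r) (t := t - (s + 1)) (by omega) (by omega)
    rw [show t - (s + 1) + 1 = t - s by omega,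
      show t - (s + 1) - 1 = t - (s + 2) by omega] at h2
    exact h2.symm

/-- A ray has at most one split: the part between two splits would be a component of `H`. -/
theorem split_unique {p : Fin k × Fin 2} {r : Arm} {t t' : ℕ} (hs : IsSplit D E p r t)
    (hs' : IsSplit D E p r t') : t = t' := by
  have key : ∀ {t t' : ℕ}, IsSplit D E p r t → IsSplit D E p r t' → ¬ t < t' := by
    intro t t' hs hs' hlt
    have h1 := h.pendant_up hB (m := t' - t - 1) (by have := hs'.2.1; omega) (h.vdeg_split hs).2
    rw [show t + (t' - t - 1) + 1 = t' by omega, show t + (t' - t - 1) = t' - 1 by omega] at h1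
    exact h1.vdeg_ne_one hB (h.vdeg_split hs').1
  rcases lt_trichotomy t t' with h1 | h1 | h1
  · exact absurd h1 (key hs hs')
  · exact h1
  · exact absurd h1 (key hs' hs)

/-- If the path to a port has a split vertex, then the port is not split. -/
theorem joined_of_split {p : Fin k × Fin 2} {r : Arm} {t : ℕ} (hs : IsSplit D E p r t)
    {e : Δ.graph.edgeSet} (he : gammaHat D Δ (D.pt p r (r.len a b)) = .inl (.port e)) :
    Pendant H (r.len a b - t - 1) (E (D.pt p r t) (D.pt p r (t + 1)))
      (E (D.pt p r (r.len a b - 1)) (D.pt p r (r.len a b)))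
      (E (D.pt p r (r.len a b)) (D.pt p r (r.len a b - 1))) ∧
    vdeg H (E (D.pt p r (r.len a b)) (D.pt p r (r.len a b - 1))) = 2 ∧
    ∀ y w, T.Adj y w → gammaHat D Δ y = .inl (.port e) →
      E y w = E (D.pt p r (r.len a b)) (D.pt p r (r.len a b - 1)) := by
  have ht := hs.2.1
  have h1 := h.pendant_up hB (m := r.len a b - t - 1) (by omega) (h.vdeg_split hs).2
  rw [show t + (r.len a b - t - 1) + 1 = r.len a b by omega,
    show t + (r.len a b - t - 1) = r.len a b - 1 by omega] at h1
  have h2 := h1.vdeg_ne_one hB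
  have hadj := D.pt_adj p (r := r) (t := r.len a b - 1) (by omega)
  rw [show r.len a b - 1 + 1 = r.len a b by omega] at hadj
  refine ⟨h1, ?_⟩
  obtain ⟨i, i', j, r', -, -, hg, hp⟩ := isPair_port D Δ e
  have heq : E (D.pt (i, j) r' (r'.len a b)) (D.pt (i, j) r' (r'.len a b - 1)) =
      E (D.pt (i', j) r' (r'.len a b)) (D.pt (i', j) r' (r'.len a b - 1)) := by
    by_contra hne
    rcases hp.cases hadj.symm (he.trans hg.symm) with ⟨e1, e2⟩ | ⟨e1, e2⟩
    · rw [e1, e2] at h2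
      exact h2 (h.vdeg_of_pair_ne hp hne)
    · rw [e1, e2] at h2
      exact h2 (h.vdeg_of_pair_ne hp.symm (Ne.symm hne))
  have hall : ∀ y w, T.Adj y w → gammaHat D Δ y = .inl (.port e) →
      E y w = E (D.pt (i, j) r' (r'.len a b)) (D.pt (i, j) r' (r'.len a b - 1)) := by
    intro y w hyw hy
    rcases hp.cases hyw (hy.trans hg.symm) with ⟨rfl, rfl⟩ | ⟨rfl, rfl⟩
    · rfl
    · exact heq.symm
  have h3 := hall _ _ hadj.symm he
  rw [h3]
  exact ⟨h.vdeg_of_pair_eq hp heq, hall⟩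

/-- Two splits on the paths to a port would separate a path through the port from the rest
of `H`. Thus the split vertices on the paths to the ports are mapped injectively to the ports that
are not split. -/
theorem exists_splitY_injection : ∃ f : splitY D Δ E → joined D c H, Function.Injective f ∧
    ∀ q, ∃ p r t, IsPortArm p.2 r ∧ IsSplit D E p r t ∧
      gammaHat D Δ (D.pt p r (r.len a b)) = .inl (f q).1 := by
  choose p r t hr hs hq using fun q : splitY D Δ E => q.2
  have hport : ∀ q, ∃ e, gammaHat D Δ (D.pt (p q) (r q) ((r q).len a b)) = .inl (.port e) := by
    intro q
    rw [gammaHat_last]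
    have := hr q
    generalize (p q).2 = j at this
    revert this
    generalize r q = r'
    intro this
    fin_cases j <;> cases r'
    · exact ⟨_, rfl⟩
    · exact ⟨_, rfl⟩
    · exact absurd ⟨rfl, rfl⟩ this
    · exact ⟨_, rfl⟩
  choose e he using hport
  have hJ := fun q => h.joined_of_split hB (hs q) (he q)
  have hadj : ∀ q, T.Adj (D.pt (p q) (r q) ((r q).len a b))
      (D.pt (p q) (r q) ((r q).len a b - 1)) := by
    intro q
    have h0 := (hs q).2.1
    have h1 := D.pt_adj (p q) (r := r q) (t := (r q).len a b - 1) (by omega)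
    rw [show (r q).len a b - 1 + 1 = (r q).len a b by omega] at h1
    exact h1.symm
  refine ⟨fun q => ⟨.port (e q), ⟨e q, rfl⟩, _, ?_, (hJ q).2.1⟩, ?_, ?_⟩
  · rw [h.proj (hadj q), he]
  · intro q q' hqq
    have heq : e q = e q' := QVertex.port.inj (congrArg Subtype.val hqq)
    have h1 := (hJ q).2.2 _ _ (hadj q') (by rw [he q', heq])
    have h2 := (hJ q').1
    rw [h1] at h2
    have h3 := (hJ q).1.eq_of_vdeg_two hB h2 (hJ q).2.1
    obtain ⟨h4, h5⟩ := h.dart_inj (hadj q).symm (hadj q').symm h3 h1.symm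
    obtain ⟨h6, -, h7⟩ := D.pt_inj le_rfl le_rfl h5
    have h8 := h7 (by have := (hs q).2.1; omega)
    have h9 : t q = t q' := by
      have hsq' := hs q'
      rw [← h6, ← h8] at hsq'
      exact h.split_unique hB (hs q) hsq'
    refine Subtype.ext (Sum.inl_injective (β := {z : VT // z ∉ D.F}) ?_)
    rw [← hq q, ← hq q', h6, h8, h9]
  · intro q
    exact ⟨p q, r q, t q, hr q, hs q, he q⟩

/-- A ray with a split vertex ends, at the source, in a vertex of degree at least `3`, or in one of
degree `2`. -/
theorem source_end {p : Fin k × Fin 2} {r : Arm} {t : ℕ} (h0 : 0 < t) (ht : t ≤ r.len a b)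
    (h1 : vdeg H (E (D.pt p r t) (D.pt p r (t - 1))) = 1) :
    ∃ u v, Pendant H (t - 1) (E (D.pt p r t) (D.pt p r (t - 1))) u v ∧
      (3 ≤ vdeg H v ∨ v ∈ thinBranch D c H) := by
  have hp := h.pendant_down hB h0 ht h1
  refine ⟨_, _, hp, ?_⟩
  have h2 := hp.vdeg_ne_one hB
  have h3 := ForkNumber.vdeg_pos hp.adj.symm
  by_cases h4 : 3 ≤ vdeg H (E (D.src p) (D.pt p r 1))
  · exact Or.inl h4
  · have hadj := D.pt_adj p (r := r) (t := 0) (by omega)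
    rw [D.pt_zero] at hadj
    exact Or.inr ⟨⟨p.1, p.2, by rw [h.proj hadj, gammaHat_src]⟩, by omega⟩

omit hB [Finite VT] [Finite VG] in
/-- A pendant path outside of `F` is not changed, up to its end. -/
theorem pendant_outside {n : ℕ} {l u v : VT} (hp : Pendant T n l u v) (hl : l ∉ D.F) :
    ∃ hu : u ∉ D.F, Pendant H n (.inr ⟨l, hl⟩) (.inr ⟨u, hu⟩) (E v u) := by
  have hE : ∀ {u v : VT} (huv : T.Adj u v) (hu : u ∉ D.F), H.Adj (.inr ⟨u, hu⟩) (E v u) := by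
    intro u v huv hu
    have := h.adj huv
    rwa [h.eq_inr huv hu] at this
  induction hp with
  | leaf huv hu => exact ⟨hl, .leaf (hE huv hl) (by rw [h.vdeg_inr]; exact hu)⟩
  | @step n l w u v hw hu huv hne ih =>
    obtain ⟨hwF, hpw⟩ := ih hl
    have huF : u ∉ D.F := D.notMem_of_pendant (.step hw hu huv hne) hl
    refine ⟨huF, ?_⟩
    rw [h.eq_inr hw.adj.symm huF] at hpw
    refine .step hpw (by rw [h.vdeg_inr]; exact hu) (hE huv huF) ?_
    intro he
    have h1 := h.proj huv.symm
    rw [← he] at h1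
    have h2 := gammaHat_notMem D Δ ⟨w, hwF⟩
    have h3 : gammaHat D Δ w = gammaHat D Δ v := h2.trans h1
    exact hne (gammaHat_dart_inj D Δ hw.adj huv.symm h3 rfl).1

/-- The short leaves of `T` outside of `F` are short in `H`, unless they are attached to a vertex
of degree `2`. -/
theorem outside_end {θ : ℕ} {l : VT} (hl : l ∈ shortLeaves T θ) (hF : l ∉ D.F) :
    ∃ n u v, n + 1 < θ ∧ Pendant H n (.inr ⟨l, hF⟩) u v ∧
      (3 ≤ vdeg H v ∨ v ∈ thinBranch D c H) := by
  obtain ⟨n, u, v, hn, hp, hv⟩ := hl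
  obtain ⟨hu, hp'⟩ := h.pendant_outside hp hF
  refine ⟨n, _, _, hn, hp', ?_⟩
  have h2 := hp'.vdeg_ne_one hB
  have h3 := ForkNumber.vdeg_pos hp'.adj.symm
  by_cases h4 : 3 ≤ vdeg H (E v u)
  · exact Or.inl h4
  · by_cases hvF : v ∈ D.F
    · obtain ⟨p, rfl⟩ := D.eq_src_of_adj hvF hu hp.adj.symm
      exact Or.inr ⟨⟨p.1, p.2, by rw [h.proj hp.adj.symm, gammaHat_src]⟩, by omega⟩
    · rw [h.eq_inr hp.adj.symm hvF, h.vdeg_inr] at h4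
      exact absurd hv h4

end IsLift

end Splits

/-! ### The number of splits -/

section Count

variable {k a b : ℕ} {VT : Type*} {T : SimpleGraph VT} [T.LocallyFinite]
  {D : DesignatedForks T k a b} {Δ : CubicGraph k} {VG : Type*} {c : VG → QVertex Δ a b}
  {H : SimpleGraph (VG ⊕ {z : VT // z ∉ D.F})} {E : VT → VT → VG ⊕ {z : VT // z ∉ D.F}}

theorem mem_split_iff {i : Fin k} {j : Fin 2} {r : Arm} {t : ℕ} (h0 : 0 < t)
    (ht : t < r.len a b) :
    QVertex.inner i j r ⟨t - 1, by omega⟩ ∈ splitX D Δ E ∪ splitY D Δ E ↔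
      IsSplit D E (i, j) r t := by
  have key : ∀ {p r' t'}, IsSplit D E p r' t' → gammaHat D Δ (D.pt p r' t') =
      .inl (.inner i j r ⟨t - 1, by omega⟩) → IsSplit D E (i, j) r t := by
    intro p r' t' hs hq
    obtain ⟨rfl, rfl, h3⟩ := D.pt_inj hs.2.1.le ht.le (gammaHat_eq_inner D Δ h0 ht hq)
    rw [← h3 (by omega)]
    exact hs
  constructor
  · rintro (⟨i', t', hs, hq⟩ | ⟨p, r', t', -, hs, hq⟩)
    · exact key hs hq
    · exact key hs hq
  · intro hs
    by_cases hr : IsPortArm j r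
    · exact Or.inr ⟨(i, j), r, t, hr, hs, gammaHat_inner D Δ _ h0 ht⟩
    · obtain ⟨rfl, rfl⟩ := not_not.1 hr
      exact Or.inl ⟨i, t, hs, gammaHat_inner D Δ _ h0 ht⟩

theorem branch_notMem_split (i : Fin k) (j : Fin 2) :
    QVertex.branch i j ∉ splitX D Δ E ∪ splitY D Δ E := by
  rintro (⟨i', t', hs, hq⟩ | ⟨p, r', t', -, hs, hq⟩) <;>
  · rw [gammaHat_inner D Δ _ hs.1 hs.2.1] at hq
    cases hq

theorem port_notMem_split (e : Δ.graph.edgeSet) :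
    QVertex.port e ∉ splitX D Δ E ∪ splitY D Δ E := by
  rintro (⟨i', t', hs, hq⟩ | ⟨p, r', t', -, hs, hq⟩) <;>
  · rw [gammaHat_inner D Δ _ hs.1 hs.2.1] at hq
    cases hq

variable [Fintype VT] [Fintype VG] [Fintype (QVertex Δ a b)]

namespace IsLift

variable (h : IsLift D c H E)
include h

/-- A split of an inner vertex replaces a vertex of degree `2` by two leaves, and a port that is
not split replaces two leaves by a vertex of degree `2`. In total, this must be balanced by the
vertices of `H` over the vertices `v_i^j`. -/
theorem sum_branch_excess {f : T ↪g H} (hf : IsCopy f) (φ : ℕ → ℤ) (hφ : φ 0 = 0) :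
    ∑ i : Fin k, ((upSum D c H φ (.inl (.branch i 0)) - downSum D Δ φ (.inl (.branch i 0))) +
      (upSum D c H φ (.inl (.branch i 1)) - downSum D Δ φ (.inl (.branch i 1)))) =
    (2 * φ 1 - φ 2) * ((joined D c H).ncard - (splitX D Δ E ∪ splitY D Δ E).ncard) := by
  classical
  have hcard : ∀ (S : Set (QVertex Δ a b)) [DecidablePred (· ∈ S)],
      ∑ q, (if q ∈ S then (1 : ℤ) else 0) = S.ncard := by
    intro S _
    rw [Finset.sum_boole, Set.ncard_eq_toFinset_card']
    congr 2
    ext q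
    simp
  have hpoint : ∀ q : QVertex Δ a b, q ∉ Set.range (fun p : Fin k × Fin 2 => .branch p.1 p.2) →
      (upSum D c H φ (.inl q) - downSum D Δ φ (.inl q)) - (2 * φ 1 - φ 2) *
        ((if q ∈ splitX D Δ E ∪ splitY D Δ E then 1 else 0) -
          (if q ∈ joined D c H then 1 else 0)) = 0 := by
    rintro (⟨i, j⟩ | ⟨i, j, r, u⟩ | e) hq
    · exact absurd ⟨(i, j), rfl⟩ hq
    · have h0 : 0 < u.val + 1 := by omega
      have ht : u.val + 1 < r.len a b := by omega
      have h1 := gammaHat_inner D Δ (i, j) h0 ht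
      have h2 := downSum_inner (Δ := Δ) φ (i, j) h0 ht (D := D)
      have h3 := h.upSum_pair (isPair_inner D Δ (i, j) h0 ht) φ hφ
      have h4 := mem_split_iff (D := D) (Δ := Δ) (E := E) (i := i) (j := j) h0 ht
      rw [h1] at h2 h3
      have hJ : QVertex.inner i j r u ∉ joined D c H := by
        rintro ⟨⟨e, he⟩, -⟩
        cases he
      simp only [Nat.add_sub_cancel, Fin.eta] at h2 h3 h4
      rw [h2, h3, if_neg hJ]
      by_cases he : E (D.pt (i, j) r (u + 1)) (D.pt (i, j) r u) =
          E (D.pt (i, j) r (u + 1)) (D.pt (i, j) r (u + 1 + 1))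
      · rw [if_pos he, if_neg (fun hm => (h4.1 hm).2.2 he)]
        ring
      · rw [if_neg he, if_pos (h4.2 ⟨h0, ht, he⟩)]
        ring
    · obtain ⟨i, i', j, r, -, -, hg, hp⟩ := isPair_port D Δ e
      have h2 := downSum_port (D := D) φ e
      have h3 := h.upSum_pair hp φ hφ
      rw [hg] at h3
      rw [h2, h3, if_neg (port_notMem_split e)]
      by_cases he : E (D.pt (i, j) r (r.len a b)) (D.pt (i, j) r (r.len a b - 1)) =
          E (D.pt (i', j) r (r.len a b)) (D.pt (i', j) r (r.len a b - 1))
      · rw [if_pos he, if_pos ⟨⟨e, rfl⟩, _, by rw [h.proj hp.adj, hg],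
          h.vdeg_of_pair_eq hp he⟩]
        ring
      · rw [if_neg he, if_neg]
        · ring
        · rintro ⟨-, u, hu, hu2⟩
          obtain ⟨x, z, hxz, rfl⟩ := h.exists_of_vdeg_pos (u := u) (by omega)
          rw [h.proj hxz] at hu
          rcases hp.cases hxz (hu.trans hg.symm) with ⟨rfl, rfl⟩ | ⟨rfl, rfl⟩
          · rw [h.vdeg_of_pair_ne hp he] at hu2
            omega
          · rw [h.vdeg_of_pair_ne hp.symm (Ne.symm he)] at hu2
            omega
  have hinj : Function.Injective
      (fun p : Fin k × Fin 2 => (QVertex.branch p.1 p.2 : QVertex Δ a b)) := by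
    rintro ⟨i, j⟩ ⟨i', j'⟩ he
    obtain ⟨h1, h2⟩ := QVertex.branch.inj he
    exact Prod.ext h1 h2
  have hsum := Fintype.sum_of_injective _ hinj
    (fun p : Fin k × Fin 2 => upSum D c H φ (.inl (.branch p.1 p.2)) -
      downSum D Δ φ (.inl (.branch p.1 p.2))) _ hpoint (by
    rintro ⟨i, j⟩
    rw [if_neg (branch_notMem_split i j), if_neg]
    · ring
    · rintro ⟨⟨e, he⟩, -⟩
      cases he)
  rw [Fintype.sum_prod_type, Finset.sum_sub_distrib (s := Finset.univ (α := QVertex Δ a b)),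
    h.sum_excess hf φ hφ, ← Finset.mul_sum, Finset.sum_sub_distrib, hcard, hcard] at hsum
  simp only [Fin.sum_univ_two] at hsum
  rw [hsum]
  ring

/-- The comparison of the numbers of vertices of degree `2` in `H` and in `T`, where the vertices
`v_i^j` contribute none to the latter. -/
theorem thinBranch_add_joined {f : T ↪g H} (hf : IsCopy f) :
    (thinBranch D c H).ncard + (joined D c H).ncard ≤
      (splitX D Δ E ∪ splitY D Δ E).ncard := by
  classical
  have h1 := h.sum_branch_excess hf (fun d => if d = 2 then 1 else 0) (by simp)
  have h2 : ∀ q, upSum D c H (fun d => if d = 2 then 1 else 0) q =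
      ((({u | hatProj D c u = q ∧ vdeg H u = 2} : Finset _).card : ℕ) : ℤ) := by
    intro q
    rw [upSum, Finset.sum_boole, Finset.filter_filter]
  have h3 : thinBranch D c H ⊆ ((Finset.univ.biUnion fun p : Fin k × Fin 2 =>
      ({u | hatProj D c u = .inl (.branch p.1 p.2) ∧ vdeg H u = 2} : Finset _) :
        Finset (VG ⊕ {z : VT // z ∉ D.F})) : Set (VG ⊕ {z : VT // z ∉ D.F})) := by
    rintro u ⟨⟨i, j, hu⟩, h2⟩
    simp only [Finset.coe_biUnion, Finset.coe_univ, Set.mem_univ, Set.iUnion_true,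
      Set.mem_iUnion, Finset.mem_coe, Finset.mem_filter, Finset.mem_univ, true_and]
    exact ⟨(i, j), hu, h2⟩
  have h4 := (Set.ncard_le_ncard h3 (Set.toFinite _)).trans
    ((Set.ncard_coe_finset _).le.trans Finset.card_biUnion_le)
  rw [Fintype.sum_prod_type] at h4
  simp only [Fin.sum_univ_two] at h4
  have h5 : ∀ i, downSum D Δ (fun d => if d = 2 then 1 else 0) (.inl (.branch i 0)) = 0 := by
    intro i
    have := D.vdeg_src (i, 0)
    rw [downSum_branch_zero, if_neg (by omega), if_neg (by omega)]
    rfl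
  have h6 : ∀ i, downSum D Δ (fun d => if d = 2 then 1 else 0) (.inl (.branch i 1)) = 0 := by
    intro i
    have := D.vdeg_src (i, 1)
    rw [downSum_branch_one, if_neg (by omega)]
  simp only [h2, h5, h6, sub_zero] at h1
  have h7 : (((thinBranch D c H).ncard : ℕ) : ℤ) ≤ _ := Int.ofNat_le.2 h4
  push_cast at h7
  rw [h1] at h7
  simp at h7
  omega

variable (hB : Branching H)
include hB

omit [Fintype (QVertex Δ a b)] in
/-- Leaves of `H` over vertices of `Q` from which a pendant path of length less than `θ` leads to a
vertex of degree at least `3` cannot outnumber those of `T`, except for one leaf for each vertex of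
degree `2` over the vertices `v_i^j`. -/
theorem card_le_of_pendant {f : T ↪g H} (hf : IsCopy f) (θ : ℕ) {ι : Type*} [Finite ι]
    {g : ι → VG ⊕ {z : VT // z ∉ D.F}} (hg : Function.Injective g)
    (hq : ∀ x, ∃ q, hatProj D c (g x) = .inl q)
    (hp : ∀ x, ∃ n u v, n + 1 < θ ∧ Pendant H n (g x) u v ∧
      (3 ≤ vdeg H v ∨ v ∈ thinBranch D c H)) :
    Nat.card ι ≤ (shortLeaves T θ ∩ D.F).ncard + (thinBranch D c H).ncard := by
  let g' : ↥(shortLeaves T θ \ D.F) ⊕ ι → VG ⊕ {z : VT // z ∉ D.F} :=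
    Sum.elim (fun z => .inr ⟨z.1, z.2.2⟩) g
  have hg' : Function.Injective g' := by
    refine Function.Injective.sumElim ?_ hg ?_
    · intro z z' he
      exact Subtype.ext (by simpa using he)
    · intro z x he
      obtain ⟨q, hx⟩ := hq x
      rw [← he] at hx
      cases hx
  have h1 := card_le_shortLeaves hB θ (thinBranch D c H) hg' (by
    rintro (z | x)
    · exact h.outside_end hB z.2.1 z.2.2
    · exact hp x)
  have h2 := hf.ncard_shortLeaves_le θ
  have h3 := Set.ncard_inter_add_ncard_sdiff_eq_ncard (shortLeaves T θ) D.F (Set.toFinite _)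
  rw [Nat.card_sum] at h1
  change (shortLeaves T θ \ D.F).ncard + _ ≤ _ at h1
  omega

omit h hB [Fintype VT] [Fintype VG] [Fintype (QVertex Δ a b)] in
theorem shortLeaves_inter (D : DesignatedForks T k a b) (hab : a ≤ b) :
    shortLeaves T a ∩ D.F = ∅ := by
  refine Set.eq_empty_of_forall_notMem fun z hz => ?_
  obtain ⟨p, r, hr, -⟩ := D.shortLeaves_cases hz.1 hz.2
  cases r
  · exact absurd hr (lt_irrefl a)
  · exact absurd hr (not_lt.2 hab)

/-- The length comparison: a split in the interior of the path from `v_i^2` to `v_i^1` would create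
too many leaves at distance less than `a` from a vertex of degree at least `3`. -/
theorem splitX_eq_empty {f : T ↪g H} (hf : IsCopy f) (hab : a ≤ b) :
    splitX D Δ E = ∅ ∧ thinBranch D c H = ∅ ∧
      (joined D c H).ncard = (splitX D Δ E ∪ splitY D Δ E).ncard := by
  have h1 := h.thinBranch_add_joined hf
  obtain ⟨g, hg, -⟩ := h.exists_splitY_injection hB
  have h2 : (splitY D Δ E).ncard ≤ (joined D c H).ncard := Nat.card_le_card_of_injective g hg
  have h3 := Set.ncard_union_le (splitX D Δ E) (splitY D Δ E)
  choose i t hs hq using fun q : splitX D Δ E => q.2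
  have hlow : ∀ q, hatProj D c (E (D.pt (i q, 1) .A (t q)) (D.pt (i q, 1) .A (t q - 1))) =
      .inl q.1 := by
    intro q
    rw [h.proj (isPair_inner D Δ _ (hs q).1 (hs q).2.1).adj, hq]
  have hup : ∀ q, hatProj D c (E (D.pt (i q, 1) .A (t q)) (D.pt (i q, 1) .A (t q + 1))) =
      .inl q.1 := by
    intro q
    rw [h.proj (isPair_inner D Δ _ (hs q).1 (hs q).2.1).adj', hq]
  -- a split yields two leaves of this kind, one on each side
  let G : splitX D Δ E ⊕ splitX D Δ E → VG ⊕ {z : VT // z ∉ D.F}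
    | .inl q => E (D.pt (i q, 1) .A (t q)) (D.pt (i q, 1) .A (t q - 1))
    | .inr q => E (D.pt (i q, 1) .A (t q)) (D.pt (i q, 1) .A (t q + 1))
  have hG : Function.Injective G := by
    rintro (q | q) (q' | q') he
    · have := (hlow q).symm.trans ((congrArg (hatProj D c) he).trans (hlow q'))
      rw [Subtype.ext (Sum.inl_injective this)]
    · have := (hlow q).symm.trans ((congrArg (hatProj D c) he).trans (hup q'))
      obtain rfl := Subtype.ext (Sum.inl_injective this)
      exact absurd he (hs q).2.2
    · have := (hup q).symm.trans ((congrArg (hatProj D c) he).trans (hlow q'))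
      obtain rfl := Subtype.ext (Sum.inl_injective this)
      exact absurd he.symm (hs q).2.2
    · have := (hup q).symm.trans ((congrArg (hatProj D c) he).trans (hup q'))
      rw [Subtype.ext (Sum.inl_injective this)]
  have hcharge := h.card_le_of_pendant hB hf a hG (by
    rintro (q | q)
    · exact ⟨_, hlow q⟩
    · exact ⟨_, hup q⟩) (by
    rintro (q | q)
    · have hsq := hs q
      have hlt : t q < a := hsq.2.1
      obtain ⟨u, v, hp, hv⟩ := h.source_end hB hsq.1 hsq.2.1.le (h.vdeg_split hsq).1
      exact ⟨_, u, v, by have := hsq.1; omega, hp, hv⟩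
    · have hsq := hs q
      have hlt : t q < a := hsq.2.1
      have hpos := hsq.1
      have hp := h.pendant_up hB (m := a - t q - 1)
        (by change t q + (a - t q - 1) + 1 ≤ a; omega) (h.vdeg_split hsq).2
      rw [show t q + (a - t q - 1) + 1 = a by omega,
        show t q + (a - t q - 1) = a - 1 by omega] at hp
      refine ⟨_, _, _, by omega, hp, ?_⟩
      have h2 := hp.vdeg_ne_one hB
      have h3 := ForkNumber.vdeg_pos hp.adj.symm
      by_cases h4 : 3 ≤ vdeg H (E (D.pt (i q, 1) .A a) (D.pt (i q, 1) .A (a - 1)))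
      · exact Or.inl h4
      · have hadj := D.pt_adj (i q, 1) (r := .A) (t := a - 1) (by change a - 1 < a; omega)
        rw [show a - 1 + 1 = a by omega] at hadj
        exact Or.inr ⟨⟨i q, 0, by rw [h.proj hadj.symm, gammaHat_x_end]⟩, by omega⟩)
  rw [Nat.card_sum, shortLeaves_inter D hab, Set.ncard_empty] at hcharge
  change (splitX D Δ E).ncard + (splitX D Δ E).ncard ≤ _ at hcharge
  -- `2 * |splitX| ≤ |thinBranch|`, but `|thinBranch| ≤ |splitX|` as `|splitY| ≤ |joined|`
  have h6 : (splitX D Δ E).ncard = 0 := by omega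
  have h7 : (thinBranch D c H).ncard = 0 := by omega
  refine ⟨(Set.ncard_eq_zero (Set.toFinite _)).1 h6, (Set.ncard_eq_zero (Set.toFinite _)).1 h7, ?_⟩
  omega

/-- The same comparison excludes a split at distance less than `a` from the source. -/
theorem le_of_split {f : T ↪g H} (hf : IsCopy f) (hab : a ≤ b) {p : Fin k × Fin 2} {r : Arm}
    {t : ℕ} (hs : IsSplit D E p r t) : a ≤ t := by
  by_contra hlt
  obtain ⟨-, hthin, -⟩ := h.splitX_eq_empty hB hf hab
  have hcharge := h.card_le_of_pendant hB hf a (ι := Unit)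
    (g := fun _ => E (D.pt p r t) (D.pt p r (t - 1))) (fun _ _ _ => rfl)
    (fun _ => ⟨_, by rw [h.proj (isPair_inner D Δ _ hs.1 hs.2.1).adj,
      gammaHat_inner D Δ p hs.1 hs.2.1]⟩) (by
    intro _
    obtain ⟨u, v, hp, hv⟩ := h.source_end hB hs.1 hs.2.1.le (h.vdeg_split hs).1
    exact ⟨_, u, v, by have := hs.1; omega, hp, hv⟩)
  rw [hthin, shortLeaves_inter D hab, Nat.card_unique] at hcharge
  simp at hcharge

end IsLift

end Count

/-! ### The structure of the copies of the tree -/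

section Structure

variable {k a b : ℕ} {VT : Type*} {T : SimpleGraph VT} [T.LocallyFinite]
  {D : DesignatedForks T k a b} {Δ : CubicGraph k} {VG : Type*} {c : VG → QVertex Δ a b}
  {H : SimpleGraph (VG ⊕ {z : VT // z ∉ D.F})} {E : VT → VT → VG ⊕ {z : VT // z ∉ D.F}}

theorem hatProj_eq_inl {u : VG ⊕ {z : VT // z ∉ D.F}} {q : QVertex Δ a b}
    (hu : hatProj D c u = .inl q) (z : {z : VT // z ∉ D.F}) : u ≠ .inr z := by
  rintro rfl
  cases hu

variable [Fintype VT] [Fintype VG]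

open Classical in
/-- The vertices of `H` over the vertex `q` of `Q`, without isolated vertices. -/
def fibre (D : DesignatedForks T k a b) (c : VG → QVertex Δ a b)
    (H : SimpleGraph (VG ⊕ {z : VT // z ∉ D.F})) (q : QVertex Δ a b) :
    Finset (VG ⊕ {z : VT // z ∉ D.F}) :=
  {u | hatProj D c u = .inl q ∧ 0 < vdeg H u}

theorem mem_fibre {q : QVertex Δ a b} {u : VG ⊕ {z : VT // z ∉ D.F}} :
    u ∈ fibre D c H q ↔ hatProj D c u = .inl q ∧ 0 < vdeg H u := by
  simp [fibre]

theorem upSum_eq_sum_fibre (φ : ℕ → ℤ) (hφ : φ 0 = 0) (q : QVertex Δ a b) :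
    upSum D c H φ (.inl q) = ∑ u ∈ fibre D c H q, φ (vdeg H u) := by
  classical
  rw [upSum]
  symm
  refine Finset.sum_subset ?_ ?_
  · intro u hu
    simp only [Finset.mem_filter, Finset.mem_univ, true_and]
    exact (mem_fibre.1 hu).1
  · intro u hu hn
    simp only [Finset.mem_filter, Finset.mem_univ, true_and] at hu
    rw [mem_fibre, not_and, Nat.pos_iff_ne_zero, not_not] at hn
    rw [hn hu, hφ]

namespace IsLift

variable (h : IsLift D c H E)
include h

theorem mem_fibre_E {y w : VT} {q : QVertex Δ a b} (hyw : T.Adj y w)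
    (hq : gammaHat D Δ y = .inl q) : E y w ∈ fibre D c H q :=
  mem_fibre.2 ⟨by rw [h.proj hyw, hq], h.vdeg_pos hyw⟩

omit [Fintype VT] [Fintype VG] in
/-- The roots at `s_i^1` and `s_i^2` are connected outside of `F`, so that, in the acyclic graph
`H`, they cannot both be attached to the copy of the path from `v_i^2` to `v_i^1`. -/
theorem root_separated [Finite VT] (hT : T.IsTree) {f : T ↪g H} (hf : IsCopy f)
    (hX : splitX D Δ E = ∅) (i : Fin k)
    (h1 : E (D.src (i, 1)) (D.root (i, 1)) = E (D.src (i, 1)) (D.pt (i, 1) .A 1)) :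
    E (D.src (i, 0)) (D.root (i, 0)) ≠ E (D.pt (i, 1) .A a) (D.pt (i, 1) .A (a - 1)) := by
  intro h0
  have hpos : 0 < a := D.len_pos (i, 1) .A
  have hr0 := (D.root_adj (i, 0)).symm
  have hr1 := (D.root_adj (i, 1)).symm
  have hE0 := h.eq_inr hr0 (D.root_notMem (i, 0))
  have hE1 := h.eq_inr hr1 (D.root_notMem (i, 1))
  have hp0 := h.proj hr0.symm
  have hp1 := h.proj hr1.symm
  rw [gammaHat_src] at hp0 hp1
  refine hf.not_reachable hT.2 (h.adj hr0) ?_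
  rw [hE0]
  set e0 := E (D.src (i, 0)) (D.root (i, 0)) with he0
  set e1 := E (D.src (i, 1)) (D.root (i, 1)) with he1
  set H' := H.deleteEdges {s(.inr ⟨D.root (i, 0), D.root_notMem (i, 0)⟩, e0)} with hH'
  have hadj : ∀ {u v}, H.Adj u v → ¬ (u = .inr ⟨D.root (i, 0), D.root_notMem (i, 0)⟩ ∧ v = e0) →
      ¬ (u = e0 ∧ v = .inr ⟨D.root (i, 0), D.root_notMem (i, 0)⟩) → H'.Adj u v := by
    intro u v huv n1 n2
    rw [hH', SimpleGraph.deleteEdges_adj]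
    refine ⟨huv, fun hm => ?_⟩
    rw [Set.mem_singleton_iff, Sym2.eq_iff] at hm
    exact hm.elim n1 n2
  -- from the first root to the second one outside of `F`
  have hout : H'.Reachable (.inr ⟨D.root (i, 0), D.root_notMem (i, 0)⟩)
      (.inr ⟨D.root (i, 1), D.root_notMem (i, 1)⟩) := by
    let F : T.induce D.Fᶜ →g H' :=
      { toFun := fun v => .inr v
        map_rel' := by
          rintro ⟨v, hv⟩ ⟨w, hw⟩ hvw
          have hvw' : T.Adj v w := hvw
          have h2 := h.adj hvw'
          rw [h.eq_inr hvw' hv, h.eq_inr hvw'.symm hw] at h2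
          exact hadj h2 (fun h3 => hatProj_eq_inl hp0 _ h3.2.symm)
            (fun h3 => hatProj_eq_inl hp0 _ h3.1.symm) }
    exact (D.root_reachable hT.1 (i, 0) (i, 1)).map F
  have hmid : H'.Reachable (.inr ⟨D.root (i, 1), D.root_notMem (i, 1)⟩) e1 := by
    have h2 := h.adj hr1
    rw [hE1] at h2
    refine (hadj h2 (fun h3 => ?_) (fun h3 => hatProj_eq_inl hp0 _ h3.1.symm)).reachable
    rw [← h3.2, hp1] at hp0
    have := (QVertex.branch.inj (Sum.inl_injective hp0)).2
    simp at this
  -- then along the path from `v_i^2` to `v_i^1`, which is not split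
  have hpath : ∀ s < a, H'.Reachable e1 (E (D.pt (i, 1) .A (s + 1)) (D.pt (i, 1) .A s)) := by
    have hstep : ∀ s < a, H'.Adj (E (D.pt (i, 1) .A s) (D.pt (i, 1) .A (s + 1)))
        (E (D.pt (i, 1) .A (s + 1)) (D.pt (i, 1) .A s)) := by
      intro s hs
      have h2 := D.pt_adj (i, 1) (r := .A) hs
      refine hadj (h.adj h2) (fun h3 => ?_) (fun h3 => ?_)
      · exact hatProj_eq_inl ((h.proj h2).trans (gammaHat_pt D Δ _ (show s ≤ a by omega))) _ h3.1
      · exact hatProj_eq_inl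
          ((h.proj h2.symm).trans (gammaHat_pt D Δ _ (show s + 1 ≤ a by omega))) _ h3.2
    intro s
    induction s with
    | zero =>
      intro hs
      have h2 := hstep 0 hs
      rw [D.pt_zero] at h2
      rw [h1, D.pt_zero]
      exact h2.reachable
    | succ s ih =>
      intro hs
      have h2 := hstep (s + 1) hs
      have h3 : E (D.pt (i, 1) .A (s + 1)) (D.pt (i, 1) .A s) =
          E (D.pt (i, 1) .A (s + 1)) (D.pt (i, 1) .A (s + 1 + 1)) := by
        by_contra hne
        have : QVertex.inner i 1 .A ⟨s + 1 - 1, by change _ < a - 1; omega⟩ ∈ splitX D Δ E :=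
          ⟨i, s + 1, ⟨by omega, hs, hne⟩, gammaHat_inner D Δ (i, 1) (by omega) hs⟩
        rw [hX] at this
        exact this
      rw [← h3] at h2
      exact (ih (by omega)).trans h2.reachable
  have h2 := hpath (a - 1) (by omega)
  rw [show a - 1 + 1 = a by omega, ← h0] at h2
  exact (hout.trans hmid).trans h2

variable [Fintype (QVertex Δ a b)] (hB : Branching H)
include hB

omit [Fintype VT] [Fintype VG] in
/-- The rays `F_a(i,1)` end in leaves of `H`: every joined port belongs to a split, but there is no
split on a ray of length `a`. -/
theorem vdeg_A_end [Finite VT] [Finite VG] {f : T ↪g H} (hf : IsCopy f) (hab : a ≤ b) (i : Fin k) :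
    vdeg H (E (D.pt (i, 0) .A a) (D.pt (i, 0) .A (a - 1))) = 1 := by
  have := Fintype.ofFinite VT
  have := Fintype.ofFinite VG
  have hpos : 0 < a := D.len_pos (i, 0) .A
  obtain ⟨hX, -, hcard⟩ := h.splitX_eq_empty hB hf hab
  obtain ⟨g, hg, hg'⟩ := h.exists_splitY_injection hB
  rw [hX, Set.empty_union] at hcard
  have hbij := hg.bijective_of_nat_card_le (show Nat.card (joined D c H) ≤ _ from hcard.le)
  set e := Δ.edgeAt i .s with he
  have hend : gammaHat D Δ (D.pt (i, 0) .A a) = .inl (.port e) := gammaHat_last D Δ (i, 0) .A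
  have hadj := D.pt_adj (i, 0) (r := .A) (t := a - 1) (by change a - 1 < a; omega)
  rw [show a - 1 + 1 = a by omega] at hadj
  by_contra hne
  have hJ : QVertex.port e ∈ joined D c H := by
    obtain ⟨i', i'', j, r, -, -, hg, hp⟩ := isPair_port D Δ e
    refine ⟨⟨e, rfl⟩, _, by rw [h.proj hp.adj, hg], h.vdeg_of_pair_eq hp ?_⟩
    by_contra hs
    rcases hp.cases hadj.symm (hend.trans hg.symm) with ⟨e1, e2⟩ | ⟨e1, e2⟩
    · rw [e1, e2] at hne
      exact hne (h.vdeg_of_pair_ne hp hs)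
    · rw [e1, e2] at hne
      exact hne (h.vdeg_of_pair_ne hp.symm (Ne.symm hs))
  obtain ⟨q, hq⟩ := hbij.2 ⟨_, hJ⟩
  obtain ⟨p, r, t, -, hs, hpe⟩ := hg' q
  rw [hq, gammaHat_last] at hpe
  obtain ⟨j, r', -, -, huniq⟩ := exists_portArm (a := a) (b := b) Δ (Δ.colour e)
  obtain ⟨-, h1⟩ := huniq _ _ _ _ (Sum.inl_injective hpe) rfl
  obtain ⟨-, h2⟩ := huniq i 0 .A e rfl rfl
  obtain rfl : r = .A := h1.trans h2.symm
  have h3 := h.le_of_split hB hf hab hs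
  exact absurd hs.2.1 (not_lt.2 h3)

open Classical in
/-- Over `v_i^1` there are two vertices of `H`, one of which is a leaf, and over `v_i^2` there is
one vertex: by the separation of the roots, there are at least three vertices over `v_i^1` and
`v_i^2`, so that there are exactly three for all `i`. As there are `2k` vertices of degree at least
`3` in total, one of the three is a leaf. A leaf over `v_i^2` instead of `v_i^1` would
increase the sum of the squares of the degrees since `deg s_i^2 ≤ deg s_i^1`. -/
theorem fibre_branch (hT : T.IsTree) {f : T ↪g H} (hf : IsCopy f) (hab : a ≤ b) (i : Fin k) :
    (∃ x y, x ≠ y ∧ fibre D c H (.branch i 0) = {x, y} ∧ vdeg H x = 1) ∧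
      ∃ z, fibre D c H (.branch i 1) = {z} := by
  obtain ⟨hX, hthin, hcard⟩ := h.splitX_eq_empty hB hf hab
  have hdeg : ∀ i j, ∀ u ∈ fibre D c H (.branch i j), vdeg H u = 1 ∨ 3 ≤ vdeg H u := by
    intro i j u hu
    obtain ⟨h1, h2⟩ := mem_fibre.1 hu
    by_contra h3
    have : u ∈ thinBranch D c H := ⟨⟨i, j, h1⟩, by omega⟩
    rw [hthin] at this
    exact this
  have hpos : ∀ i, 0 < a := fun i => D.len_pos (i, 0) .A
  have hxadj : ∀ i, T.Adj (D.pt (i, 1) .A a) (D.pt (i, 1) .A (a - 1)) := by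
    intro i
    have := hpos i
    have h1 := D.pt_adj (i, 1) (r := .A) (t := a - 1) (by change a - 1 < a; omega)
    rw [show a - 1 + 1 = a by omega] at h1
    exact h1.symm
  have hsadj : ∀ i, T.Adj (D.src (i, 1)) (D.pt (i, 1) .A 1) := by
    intro i
    have h1 := D.pt_adj (i, 1) (r := .A) (t := 0) (hpos i)
    rwa [D.pt_zero] at h1
  have hm0 : ∀ i, E (D.src (i, 0)) (D.root (i, 0)) ∈ fibre D c H (.branch i 0) := fun i =>
    h.mem_fibre_E (D.root_adj _) (gammaHat_src D Δ _)
  have hm0' : ∀ i, E (D.pt (i, 1) .A a) (D.pt (i, 1) .A (a - 1)) ∈ fibre D c H (.branch i 0) :=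
    fun i => h.mem_fibre_E (hxadj i) (gammaHat_x_end D Δ i)
  have hm1 : ∀ i, E (D.src (i, 1)) (D.root (i, 1)) ∈ fibre D c H (.branch i 1) := fun i =>
    h.mem_fibre_E (D.root_adj _) (gammaHat_src D Δ _)
  have hm1' : ∀ i, E (D.src (i, 1)) (D.pt (i, 1) .A 1) ∈ fibre D c H (.branch i 1) := fun i =>
    h.mem_fibre_E (hsadj i) (gammaHat_src D Δ _)
  have hn0 : ∀ i, 1 ≤ (fibre D c H (.branch i 0)).card := fun i => Finset.card_pos.2 ⟨_, hm0 i⟩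
  have hn1 : ∀ i, 1 ≤ (fibre D c H (.branch i 1)).card := fun i => Finset.card_pos.2 ⟨_, hm1 i⟩
  have hthree : ∀ i, 3 ≤ (fibre D c H (.branch i 0)).card + (fibre D c H (.branch i 1)).card := by
    intro i
    by_cases h1 : E (D.src (i, 1)) (D.root (i, 1)) = E (D.src (i, 1)) (D.pt (i, 1) .A 1)
    · have h2 := Finset.one_lt_card.2 ⟨_, hm0 i, _, hm0' i, h.root_separated hT hf hX i h1⟩
      have := hn1 i
      omega
    · have h2 := Finset.one_lt_card.2 ⟨_, hm1 i, _, hm1' i, h1⟩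
      have := hn0 i
      omega
  have hexc : ∀ φ : ℕ → ℤ, φ 0 = 0 →
      ∑ i : Fin k, ((∑ u ∈ fibre D c H (.branch i 0), φ (vdeg H u) +
        ∑ u ∈ fibre D c H (.branch i 1), φ (vdeg H u)) -
        (φ (vdeg T (D.src (i, 0))) + φ 1 + φ (vdeg T (D.src (i, 1))))) = 0 := by
    intro φ hφ
    have h1 := h.sum_branch_excess hf φ hφ
    rw [hcard, sub_self, mul_zero] at h1
    rw [← h1]
    refine Finset.sum_congr rfl fun i _ => ?_
    rw [upSum_eq_sum_fibre φ hφ, upSum_eq_sum_fibre φ hφ, downSum_branch_zero, downSum_branch_one]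
    ring
  have hd0 : ∀ i, 3 ≤ vdeg T (D.src (i, 0)) := fun i => D.vdeg_src _
  have hd1 : ∀ i, 3 ≤ vdeg T (D.src (i, 1)) := fun i => D.vdeg_src _
  have hp0 : ∀ i, 0 < vdeg T (D.src (i, 0)) := fun i => (hd0 i).trans_lt' (by decide)
  have hp1 : ∀ i, 0 < vdeg T (D.src (i, 1)) := fun i => (hd1 i).trans_lt' (by decide)
  have hsum0 : ∀ i, ∑ u ∈ fibre D c H (.branch i 0), vdeg H u = vdeg T (D.src (i, 0)) + 1 := by
    intro i
    have h1 := h.upSum_id (.inl (.branch i 0))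
    rw [upSum_eq_sum_fibre (fun d => (d : ℤ)) (by simp), downSum_branch_zero] at h1
    exact_mod_cast h1
  have hsum1 : ∀ i, ∑ u ∈ fibre D c H (.branch i 1), vdeg H u = vdeg T (D.src (i, 1)) := by
    intro i
    have h1 := h.upSum_id (.inl (.branch i 1))
    rw [upSum_eq_sum_fibre (fun d => (d : ℤ)) (by simp), downSum_branch_one] at h1
    exact_mod_cast h1
  have hcard3 : ∀ i,
      (fibre D c H (.branch i 0)).card + (fibre D c H (.branch i 1)).card = 3 := by
    -- the numbers of vertices, at least three for each `i`, add up to `3k`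
    have h1 := hexc (fun d => if 0 < d then 1 else 0) (by simp)
    have h2 : ∀ q, ∑ u ∈ fibre D c H q, (if 0 < vdeg H u then (1 : ℤ) else 0) =
        (fibre D c H q).card := by
      intro q
      rw [Finset.card_eq_sum_ones]
      push_cast
      exact Finset.sum_congr rfl fun u hu => if_pos (mem_fibre.1 hu).2
    simp only [h2] at h1
    rw [Finset.sum_eq_zero_iff_of_nonneg] at h1
    · intro i
      have h3 := h1 i (Finset.mem_univ i)
      rw [if_pos (hp0 i), if_pos (hp1 i), if_pos Nat.one_pos] at h3
      omega
    · intro i _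
      rw [if_pos (hp0 i), if_pos (hp1 i), if_pos Nat.one_pos]
      have := hthree i
      omega
  have hhigh : ∀ s : Finset (VG ⊕ {z : VT // z ∉ D.F}), s.card ≤ 2 →
      3 ≤ ∑ u ∈ s, vdeg H u → (∀ u ∈ s, vdeg H u = 1 ∨ 3 ≤ vdeg H u) →
      1 ≤ ({u ∈ s | 3 ≤ vdeg H u} : Finset _).card := by
    intro s hs hsum hsd
    by_contra h0
    have h1 : ({u ∈ s | 3 ≤ vdeg H u} : Finset _) = ∅ := Finset.card_eq_zero.1 (by omega)
    have h2 : ∑ u ∈ s, vdeg H u = ∑ u ∈ s, 1 := by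
      refine Finset.sum_congr rfl fun u hu => (hsd u hu).resolve_right fun h3 => ?_
      have : u ∈ ({u ∈ s | 3 ≤ vdeg H u} : Finset _) := Finset.mem_filter.2 ⟨hu, h3⟩
      rw [h1] at this
      simp at this
    rw [← Finset.card_eq_sum_ones] at h2
    omega
  have hhigh0 := fun i => hhigh _ (by have := hcard3 i; have := hn1 i; omega)
    (by rw [hsum0 i]; have := hd0 i; omega) (hdeg i 0)
  have hhigh1 := fun i => hhigh _ (by have := hcard3 i; have := hn0 i; omega)
    (by rw [hsum1 i]; exact hd1 i) (hdeg i 1)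
  have hone : ∀ i, ({u ∈ fibre D c H (.branch i 0) | 3 ≤ vdeg H u} : Finset _).card = 1 ∧
      ({u ∈ fibre D c H (.branch i 1) | 3 ≤ vdeg H u} : Finset _).card = 1 := by
    -- the numbers of vertices of degree at least `3`, at least two for each `i`, add up to `2k`
    have h1 := hexc (fun d => if 3 ≤ d then 1 else 0) (by simp)
    simp only [Finset.sum_boole] at h1
    rw [Finset.sum_eq_zero_iff_of_nonneg] at h1
    · intro i
      have h3 := h1 i (Finset.mem_univ i)
      rw [if_pos (hd0 i), if_pos (hd1 i), if_neg (by omega)] at h3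
      have := hhigh0 i
      have := hhigh1 i
      omega
    · intro i _
      rw [if_pos (hd0 i), if_pos (hd1 i), if_neg (by omega)]
      have := hhigh0 i
      have := hhigh1 i
      omega
  -- a set of two vertices, exactly one of which has degree at least `3`
  have htwo : ∀ s : Finset (VG ⊕ {z : VT // z ∉ D.F}), s.card = 2 →
      (∀ u ∈ s, vdeg H u = 1 ∨ 3 ≤ vdeg H u) →
      ({u ∈ s | 3 ≤ vdeg H u} : Finset _).card = 1 → ∃ x y, x ≠ y ∧ s = {x, y} ∧ vdeg H x = 1 := by
    intro s hs hsd hs1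
    obtain ⟨x, y, hxy, rfl⟩ := Finset.card_eq_two.1 hs
    obtain ⟨w, hw⟩ := Finset.card_eq_one.1 hs1
    rcases hsd x (by simp) with hx | hx
    · exact ⟨x, y, hxy, rfl, hx⟩
    · rcases hsd y (by simp) with hy | hy
      · exact ⟨y, x, hxy.symm, Finset.pair_comm _ _, hy⟩
      · have h1 : x ∈ ({w} : Finset _) := by rw [← hw]; simp [hx]
        have h2 : y ∈ ({w} : Finset _) := by rw [← hw]; simp [hy]
        rw [Finset.mem_singleton] at h1 h2
        exact absurd (h1.trans h2.symm) hxy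
  -- the sums of the squares of the degrees, in which no summand can be negative
  have hsq := hexc (fun d => (d : ℤ) ^ 2) (by simp)
  have hcases : ∀ i, ((∃ x y, x ≠ y ∧ fibre D c H (.branch i 0) = {x, y} ∧ vdeg H x = 1) ∧
      ∃ z, fibre D c H (.branch i 1) = {z}) ∧ ((∑ u ∈ fibre D c H (.branch i 0),
        ((vdeg H u : ℕ) : ℤ) ^ 2 + ∑ u ∈ fibre D c H (.branch i 1), ((vdeg H u : ℕ) : ℤ) ^ 2) -
        (((vdeg T (D.src (i, 0)) : ℕ) : ℤ) ^ 2 + ((1 : ℕ) : ℤ) ^ 2 +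
          ((vdeg T (D.src (i, 1)) : ℕ) : ℤ) ^ 2)) = 0 ∨
      0 < ((∑ u ∈ fibre D c H (.branch i 0),
        ((vdeg H u : ℕ) : ℤ) ^ 2 + ∑ u ∈ fibre D c H (.branch i 1), ((vdeg H u : ℕ) : ℤ) ^ 2) -
        (((vdeg T (D.src (i, 0)) : ℕ) : ℤ) ^ 2 + ((1 : ℕ) : ℤ) ^ 2 +
          ((vdeg T (D.src (i, 1)) : ℕ) : ℤ) ^ 2)) := by
    intro i
    have h3 := hcard3 i
    have h0 := hn0 i
    have h1 := hn1 i
    have hs0 := hsum0 i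
    have hs1 := hsum1 i
    obtain ⟨ho0, ho1⟩ := hone i
    rcases (show (fibre D c H (.branch i 0)).card = 2 ∧ (fibre D c H (.branch i 1)).card = 1 ∨
      (fibre D c H (.branch i 0)).card = 1 ∧ (fibre D c H (.branch i 1)).card = 2 by omega) with
      ⟨hc0, hc1⟩ | ⟨hc0, hc1⟩
    · left
      obtain ⟨x, y, hxy, hs, hx⟩ := htwo _ hc0 (hdeg i 0) ho0
      obtain ⟨z, hz⟩ := Finset.card_eq_one.1 hc1
      refine ⟨⟨⟨x, y, hxy, hs, hx⟩, z, hz⟩, ?_⟩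
      rw [hs, Finset.sum_pair hxy, hx] at hs0
      rw [hz, Finset.sum_singleton] at hs1
      rw [hs, hz, Finset.sum_pair hxy, Finset.sum_singleton, hx, hs1,
        show vdeg H y = vdeg T (D.src (i, 0)) by omega]
      ring
    · right
      obtain ⟨x, y, hxy, hs, hx⟩ := htwo _ hc1 (hdeg i 1) ho1
      obtain ⟨z, hz⟩ := Finset.card_eq_one.1 hc0
      rw [hs, Finset.sum_pair hxy, hx] at hs1
      rw [hz, Finset.sum_singleton] at hs0
      have hle := D.vdeg_src_le (p := (i, 0)) (q := (i, 1))
        (Prod.Lex.toLex_le_toLex.2 (Or.inr ⟨rfl, (by decide : (0 : Fin 2) ≤ 1)⟩))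
      rw [hs, hz, Finset.sum_pair hxy, Finset.sum_singleton, hx, hs0, ← hs1]
      rw [← hs1] at hle
      push_cast
      have : ((1 + vdeg H y : ℕ) : ℤ) ≤ (vdeg T (D.src (i, 0)) : ℕ) := Int.ofNat_le.2 hle
      push_cast at this
      nlinarith
  have hnonneg : ∀ i ∈ (Finset.univ : Finset (Fin k)), 0 ≤ ((∑ u ∈ fibre D c H (.branch i 0),
        ((vdeg H u : ℕ) : ℤ) ^ 2 + ∑ u ∈ fibre D c H (.branch i 1), ((vdeg H u : ℕ) : ℤ) ^ 2) -
        (((vdeg T (D.src (i, 0)) : ℕ) : ℤ) ^ 2 + ((1 : ℕ) : ℤ) ^ 2 +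
          ((vdeg T (D.src (i, 1)) : ℕ) : ℤ) ^ 2)) := by
    intro i _
    rcases hcases i with h1 | h1
    · exact h1.2.ge
    · exact h1.le
  rcases hcases i with h1 | h1
  · exact h1.1
  · exact absurd ((Finset.sum_eq_zero_iff_of_nonneg hnonneg).1 hsq i (Finset.mem_univ i)) h1.ne'

/-- If the root at `s_i^1` is attached to a leaf, then everything else over `v_i^1` is
attached to one other vertex. -/
theorem eq_or_eq_of_root_leaf (hT : T.IsTree) {f : T ↪g H} (hf : IsCopy f) (hab : a ≤ b)
    {i : Fin k} (hi : vdeg H (E (D.src (i, 0)) (D.root (i, 0))) = 1)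
    {u : VG ⊕ {z : VT // z ∉ D.F}} (hu : u ∈ fibre D c H (.branch i 0)) :
    u = E (D.src (i, 0)) (D.root (i, 0)) ∨ u = E (D.src (i, 0)) (D.pt (i, 0) .A 1) := by
  classical
  obtain ⟨⟨x, y, hxy, hs, -⟩, -⟩ := h.fibre_branch hB hT hf hab i
  have hadj := D.pt_adj (i, 0) (r := .A) (t := 0) (D.len_pos (i, 0) .A)
  rw [D.pt_zero] at hadj
  have hm0 := h.mem_fibre_E (D.root_adj (i, 0)) (gammaHat_src D Δ (i, 0))
  have hm1 := h.mem_fibre_E hadj (gammaHat_src D Δ (i, 0))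
  have hne : E (D.src (i, 0)) (D.pt (i, 0) .A 1) ≠ E (D.src (i, 0)) (D.root (i, 0)) := by
    intro he
    have h1 := (h.dart_unique hi hadj (D.root_adj (i, 0)) he rfl).2
    exact D.root_notMem (i, 0) (h1 ▸ D.pt_mem _ _ _)
  simp only at hm0 hm1
  rw [hs, Finset.mem_insert, Finset.mem_singleton] at hm0 hm1 hu
  grind

/-- If no root at a vertex `s_i^1` is attached to a leaf, then nothing is split, except for ends
of designated rays that are identified in `Q`. -/
theorem eq_of_root_not_leaf (hT : T.IsTree) {f : T ↪g H} (hf : IsCopy f) (hab : a ≤ b)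
    (hgood : ∀ i, vdeg H (E (D.src (i, 0)) (D.root (i, 0))) ≠ 1) {y w w' : VT}
    (hw : T.Adj y w) (hw' : T.Adj y w') : E y w = E y w' := by
  obtain ⟨hX, hthin, -⟩ := h.splitX_eq_empty hB hf hab
  have hxadj : ∀ i, T.Adj (D.pt (i, 1) .A a) (D.pt (i, 1) .A (a - 1)) := by
    intro i
    have : 0 < a := D.len_pos (i, 0) .A
    have h1 := D.pt_adj (i, 1) (r := .A) (t := a - 1) (by change a - 1 < a; omega)
    rw [show a - 1 + 1 = a by omega] at h1
    exact h1.symm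
  have hA0 : ∀ i, vdeg H (E (D.pt (i, 1) .A a) (D.pt (i, 1) .A (a - 1))) = 1 ∧
      ∀ w, T.Adj (D.src (i, 0)) w →
        E (D.src (i, 0)) w = E (D.src (i, 0)) (D.root (i, 0)) := by
    intro i
    obtain ⟨⟨x, y, hxy, hs, hx⟩, z, hz⟩ := h.fibre_branch hB hT hf hab i
    have hpos : 0 < a := D.len_pos (i, 0) .A
    have hadj := D.pt_adj (i, 1) (r := .A) (t := 0) hpos
    rw [D.pt_zero] at hadj
    have h1 := h.mem_fibre_E (D.root_adj (i, 1)) (gammaHat_src D Δ (i, 1))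
    have h2 := h.mem_fibre_E hadj (gammaHat_src D Δ (i, 1))
    simp only at h1 h2
    rw [hz, Finset.mem_singleton] at h1 h2
    have h3 := h.root_separated hT hf hX i (h1.trans h2.symm)
    have hmem : ∀ {y' w'}, T.Adj y' w' → gammaHat D Δ y' = .inl (.branch i 0) →
        E y' w' = x ∨ E y' w' = y := by
      intro y' w' h4 h5
      have := h.mem_fibre_E h4 h5
      rw [hs] at this
      simpa using this
    have hroot : E (D.src (i, 0)) (D.root (i, 0)) = y := by
      refine (hmem (D.root_adj _) (gammaHat_src D Δ _)).resolve_left fun h4 => ?_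
      exact hgood i (by rw [h4, hx])
    have hxe : E (D.pt (i, 1) .A a) (D.pt (i, 1) .A (a - 1)) = x := by
      refine (hmem (hxadj i) (gammaHat_x_end D Δ i)).resolve_right fun h4 => ?_
      exact h3 (hroot.trans h4.symm)
    refine ⟨by rw [hxe, hx], fun w hw => ?_⟩
    rw [hroot]
    refine (hmem hw (gammaHat_src D Δ _)).resolve_left fun h4 => ?_
    have h5 := (h.dart_unique hx hw (hxadj i) h4 hxe).1
    have h6 := D.vdeg_src (i, 0)
    have h7 := D.vdeg_pt_last (i, 1) .A
    rw [h5] at h6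
    simp only [Arm.len] at h7
    omega
  have hsplit : ∀ p r t, ¬ IsSplit D E p r t := by
    intro p r t hs
    have hat := h.le_of_split hB hf hab hs
    have htl := hs.2.1
    have hr : r = .B := by
      cases r
      · exact absurd htl (not_lt.2 hat)
      · rfl
    subst hr
    have htb : t < b := htl
    have hpos : 0 < a := D.len_pos p .A
    have hdA : ∀ p, vdeg H (E (D.pt p .A a) (D.pt p .A (a - 1))) = 1 := by
      rintro ⟨i, j⟩
      fin_cases j
      · exact h.vdeg_A_end hB hf hab i
      · exact (hA0 i).1
    have hadj : ∀ p, T.Adj (D.pt p .A a) (D.pt p .A (a - 1)) := by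
      intro p
      have h1 := D.pt_adj p (r := .A) (t := a - 1) (by change a - 1 < a; omega)
      rw [show a - 1 + 1 = a by omega] at h1
      exact h1.symm
    have hpair := isPair_inner D Δ p hs.1 hs.2.1
    -- besides the `2k` ends of the rays of length `a`, the split yields a leaf at distance `t < b`
    -- from a vertex of degree at least `3`
    let G : Option (Fin k × Fin 2) → VG ⊕ {z : VT // z ∉ D.F}
      | none => E (D.pt p .B t) (D.pt p .B (t - 1))
      | some p' => E (D.pt p' .A a) (D.pt p' .A (a - 1))
    have hne : ∀ p', E (D.pt p .B t) (D.pt p .B (t - 1)) ≠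
        E (D.pt p' .A a) (D.pt p' .A (a - 1)) := by
      intro p' he
      have h1 := (h.dart_unique (hdA p') hpair.adj (hadj p') he rfl).1
      have h2 := (D.pt_inj (r := .B) (r' := .A) hs.2.1.le (le_refl a) h1).2.2 (by omega)
      cases h2
    have hG : Function.Injective G := by
      rintro (_ | p1) (_ | p2) he
      · rfl
      · exact absurd he (hne p2)
      · exact absurd he.symm (hne p1)
      · have h1 := (h.dart_unique (hdA p2) (hadj p1) (hadj p2) he rfl).1
        rw [(D.pt_inj (r := .A) (r' := .A) (le_refl a) (le_refl a) h1).1]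
    have hcharge := h.card_le_of_pendant hB hf b hG (by
      rintro (_ | p')
      · exact ⟨_, by rw [h.proj hpair.adj, gammaHat_pt D Δ p hs.2.1.le]⟩
      · exact ⟨_, by rw [h.proj (hadj p'), gammaHat_pt D Δ p' (r := .A) (le_refl a)]⟩) (by
      rintro (_ | p')
      · obtain ⟨u, v, hp, hv⟩ := h.source_end hB hs.1 hs.2.1.le (h.vdeg_split hs).1
        exact ⟨_, u, v, by have := hs.1; omega, hp, hv⟩
      · obtain ⟨u, v, hp, hv⟩ := h.source_end hB (r := .A) hpos (le_refl a) (hdA p')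
        exact ⟨_, u, v, by omega, hp, hv⟩)
    have hsub : shortLeaves T b ∩ D.F ⊆ Set.range fun p => D.pt p .A a := by
      rintro z ⟨hz, hzF⟩
      obtain ⟨p', r, hr, rfl⟩ := D.shortLeaves_cases hz hzF
      cases r
      · exact ⟨p', rfl⟩
      · exact absurd hr (lt_irrefl b)
    have hle := Set.ncard_le_ncard hsub (Set.toFinite _)
    have hle' : (Set.range fun p => D.pt p .A a).ncard ≤ Nat.card (Fin k × Fin 2) := by
      rw [← Set.image_univ, ← Set.ncard_univ]
      exact Set.ncard_image_le (Set.toFinite _)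
    rw [hthin, Set.ncard_empty, Finite.card_option] at hcharge
    omega
  by_cases hyF : y ∈ D.F
  · rcases D.mem_F_cases hyF with ⟨⟨i, j⟩, rfl⟩ | ⟨p, r, t, h0, ht, rfl⟩
    · fin_cases j
      · exact ((hA0 i).2 w hw).trans ((hA0 i).2 w' hw').symm
      · obtain ⟨-, z, hz⟩ := h.fibre_branch hB hT hf hab i
        have h1 := h.mem_fibre_E hw (gammaHat_src D Δ (i, 1))
        have h2 := h.mem_fibre_E hw' (gammaHat_src D Δ (i, 1))
        simp only at h1 h2
        rw [hz, Finset.mem_singleton] at h1 h2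
        exact h1.trans h2.symm
    · have hno := hsplit p r t
      have key : t < r.len a b →
          E (D.pt p r t) (D.pt p r (t - 1)) = E (D.pt p r t) (D.pt p r (t + 1)) := by
        intro hlt
        by_contra hne
        exact hno ⟨h0, hlt, hne⟩
      rcases D.pt_neighbour h0 ht hw with rfl | ⟨hlt, rfl⟩ <;>
      rcases D.pt_neighbour h0 ht hw' with rfl | ⟨hlt', rfl⟩
      · rfl
      · exact key hlt'
      · exact (key hlt).symm
      · rfl
  · rw [h.eq_inr hw hyF, h.eq_inr hw' hyF]

end IsLift

end Structure

/-! ### Edge-colourful copies as lifts -/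

section Copies

variable {k a b : ℕ} {VT : Type*} {T : SimpleGraph VT} [T.LocallyFinite]
  {D : DesignatedForks T k a b} {Δ : CubicGraph k} {VG : Type*} {G : SimpleGraph VG}
  {c : G →g qGraph Δ a b}

/-- The colour of an edge of `Ĝ` lies over the same edge as the edge itself. -/
theorem HatColour.map_eq {e : Sym2 (VG ⊕ {z : VT // z ∉ D.F})} {f : Sym2 VT}
    (h : HatColour D Δ c e f) : e.map (hatProj D c) = f.map (gammaHat D Δ) := by
  cases h with
  | inside e he f hf h =>
    have h1 : hatProj D c ∘ Sum.inl = Sum.inl ∘ c := rfl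
    have h2 : gammaHat D Δ ∘ Subtype.val = Sum.inl ∘ gamma D Δ :=
      funext fun y => gammaHat_mem D Δ y
    rw [Sym2.map_map, Sym2.map_map, h1, h2, ← Sym2.map_map, ← Sym2.map_map, h]
  | outside z z' h => rw [Sym2.map_mk, Sym2.map_mk, gammaHat_notMem, gammaHat_notMem]; rfl
  | between z g y h hg =>
    rw [Sym2.map_mk, Sym2.map_mk, gammaHat_notMem, gammaHat_mem, ← hg]; rfl

theorem map_gammaHat_inj {f f' : Sym2 VT} (hf : f ∈ T.edgeSet) (hf' : f' ∈ T.edgeSet)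
    (h : f.map (gammaHat D Δ) = f'.map (gammaHat D Δ)) : f = f' := by
  induction f using Sym2.ind with
  | _ y w =>
  induction f' using Sym2.ind with
  | _ y' w' =>
  rw [SimpleGraph.mem_edgeSet] at hf hf'
  rw [Sym2.map_mk, Sym2.map_mk, Sym2.eq_iff] at h
  rcases h with ⟨h1, h2⟩ | ⟨h1, h2⟩
  · obtain ⟨rfl, rfl⟩ := gammaHat_dart_inj D Δ hf hf' h1 h2
    rfl
  · obtain ⟨rfl, rfl⟩ := gammaHat_dart_inj D Δ hf hf'.symm h1 h2
    exact Sym2.eq_swap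

/-- The colour of an edge of `Ĝ` is determined by its image. -/
theorem hatGamma_eq_iff (e : (hatGraph D Δ c).edgeSet) (f : T.edgeSet) :
    hatGamma D Δ c e = f ↔ (e : Sym2 _).map (hatProj D c) = (f : Sym2 VT).map (gammaHat D Δ) := by
  have h1 := HatColour.map_eq (hatColour_existsUnique D Δ c e).choose_spec.1
  constructor
  · rintro rfl
    exact h1
  · intro h2
    exact Subtype.ext (map_gammaHat_inj (hatGamma D Δ c e).2 f.2 (h1.symm.trans h2))

theorem hatGraph_adj_of_notMem {y w : VT} {u v : VG ⊕ {z : VT // z ∉ D.F}} (hyw : T.Adj y w)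
    (hy : y ∉ D.F) (hu : hatProj D c u = gammaHat D Δ y) (hv : hatProj D c v = gammaHat D Δ w) :
    (hatGraph D Δ c).Adj u v := by
  rw [gammaHat_notMem D Δ ⟨y, hy⟩] at hu
  rcases u with g | z
  · cases hu
  obtain rfl : z = ⟨y, hy⟩ := Sum.inr_injective hu
  by_cases hw : w ∈ D.F
  · rw [gammaHat_mem D Δ ⟨w, hw⟩] at hv
    rcases v with g | z
    · exact ⟨⟨w, hw⟩, hyw, Sum.inl_injective hv⟩
    · cases hv
  · rw [gammaHat_notMem D Δ ⟨w, hw⟩] at hv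
    rcases v with g | z
    · cases hv
    · obtain rfl : z = ⟨w, hw⟩ := Sum.inr_injective hv
      exact hyw

theorem exists_dart_of_hatGraph_adj {u v : VG ⊕ {z : VT // z ∉ D.F}}
    (huv : (hatGraph D Δ c).Adj u v) : ∃ y w, T.Adj y w ∧ hatProj D c u = gammaHat D Δ y ∧
      hatProj D c v = gammaHat D Δ w := by
  have h1 := (hatGamma_eq_iff (D := D) (c := c) ⟨s(u, v), huv⟩ _).1 rfl
  generalize hatGamma D Δ c ⟨s(u, v), huv⟩ = f at h1
  obtain ⟨f, hf⟩ := f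
  induction f using Sym2.ind with
  | _ y w =>
  rw [Sym2.map_mk, Sym2.map_mk, Sym2.eq_iff] at h1
  rcases h1 with ⟨h1, h2⟩ | ⟨h1, h2⟩
  · exact ⟨y, w, hf, h1, h2⟩
  · exact ⟨w, y, SimpleGraph.Adj.symm hf, h1, h2⟩

/-- The copies of `T` in `Ĝ` with exactly one edge of each colour, as graphs on `V(Ĝ)`. -/
def copies (D : DesignatedForks T k a b) (c : G →g qGraph Δ a b) :
    Set (SimpleGraph (VG ⊕ {z : VT // z ∉ D.F})) :=
  {H | H ≤ hatGraph D Δ c ∧ (∃ f : T ↪g H, IsCopy f) ∧ ∃ E, IsLift D c H E}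

/-- The end over `y` of the edge of `H` over the edge `{y, w}` of `T`. -/
def liftEnd [Nonempty VG] (D : DesignatedForks T k a b) (c : VG → QVertex Δ a b)
    (H : SimpleGraph (VG ⊕ {z : VT // z ∉ D.F})) (y w : VT) : VG ⊕ {z : VT // z ∉ D.F} :=
  Classical.epsilon fun u =>
    ∃ v, H.Adj u v ∧ hatProj D c u = gammaHat D Δ y ∧ hatProj D c v = gammaHat D Δ w

section

variable {H : SimpleGraph (VG ⊕ {z : VT // z ∉ D.F})}
  {E : VT → VT → VG ⊕ {z : VT // z ∉ D.F}}

theorem IsLift.eq_of_adj (h : IsLift D c H E) {y w : VT} (hyw : T.Adj y w)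
    {u v : VG ⊕ {z : VT // z ∉ D.F}} (huv : H.Adj u v) (hu : hatProj D c u = gammaHat D Δ y)
    (hv : hatProj D c v = gammaHat D Δ w) : u = E y w ∧ v = E w y := by
  obtain ⟨y', w', hyw', rfl, rfl⟩ := h.exists_of_adj huv
  rw [h.proj hyw'] at hu
  rw [h.proj hyw'.symm] at hv
  obtain ⟨rfl, rfl⟩ := gammaHat_dart_inj D Δ hyw' hyw hu hv
  exact ⟨rfl, rfl⟩

theorem IsLift.liftEnd_eq [Nonempty VG] (h : IsLift D c H E) {y w : VT} (hyw : T.Adj y w) :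
    liftEnd D c H y w = E y w := by
  obtain ⟨v, h1, h2, h3⟩ := Classical.epsilon_spec (p := fun u =>
    ∃ v, H.Adj u v ∧ hatProj D c u = gammaHat D Δ y ∧ hatProj D c v = gammaHat D Δ w)
    ⟨E y w, E w y, h.adj hyw, h.proj hyw, h.proj hyw.symm⟩
  exact (h.eq_of_adj hyw h1 h2 h3).1

theorem IsLift.liftEnd [Nonempty VG] (h : IsLift D c H E) : IsLift D c H (liftEnd D c H) := by
  refine ⟨fun hyw => ?_, fun hyw => ?_, fun huv => ?_⟩
  · rw [h.liftEnd_eq hyw, h.proj hyw]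
  · rw [h.liftEnd_eq hyw, h.liftEnd_eq hyw.symm]
    exact h.adj hyw
  · obtain ⟨y, w, hyw, rfl, rfl⟩ := h.exists_of_adj huv
    exact ⟨y, w, hyw, h.liftEnd_eq hyw, h.liftEnd_eq hyw.symm⟩

end

/-- The condition on the colours says that the edges are a lift of the edges of `T`. -/
theorem colourful_iff_exists_isLift [Nonempty VG] (S : (hatGraph D Δ c).Subgraph) :
    (∀ x : T.edgeSet, ∃! e : (hatGraph D Δ c).edgeSet,
      (e : Sym2 _) ∈ S.edgeSet ∧ hatGamma D Δ c e = x) ↔ ∃ E, IsLift D c S.spanningCoe E := by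
  constructor
  · intro hS
    have huniq : ∀ {u v u' v'}, S.Adj u v → S.Adj u' v' → hatProj D c u = hatProj D c u' →
        hatProj D c v = hatProj D c v' → u = u' := by
      intro u v u' v' huv huv' hu hv
      have h1 := (hS (hatGamma D Δ c ⟨s(u, v), huv.adj_sub⟩)).unique
        (y₁ := ⟨s(u, v), huv.adj_sub⟩) (y₂ := ⟨s(u', v'), huv'.adj_sub⟩) ⟨huv, rfl⟩ ⟨huv', by
          rw [hatGamma_eq_iff, ← (hatGamma_eq_iff _ _).1 rfl, Sym2.map_mk, Sym2.map_mk, hu, hv]⟩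
      rcases Sym2.eq_iff.1 (congrArg Subtype.val h1) with ⟨h2, -⟩ | ⟨h2, -⟩
      · exact h2
      · -- the two ends of an edge of `Ĝ` never lie over the same vertex
        obtain ⟨y, w, hyw, h3, h4⟩ := exists_dart_of_hatGraph_adj huv'.adj_sub
        exact absurd (by rw [← h3, ← hu, h2, h4]) (gammaHat_ne D Δ hyw)
    have hex : ∀ {y w}, T.Adj y w → ∃ u v, S.Adj u v ∧ hatProj D c u = gammaHat D Δ y ∧
        hatProj D c v = gammaHat D Δ w := by
      intro y w hyw
      obtain ⟨⟨e, he⟩, ⟨heS, hec⟩, -⟩ := hS ⟨s(y, w), hyw⟩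
      rw [hatGamma_eq_iff] at hec
      induction e using Sym2.ind with
      | _ u v =>
      simp only [Sym2.map_mk, Sym2.eq_iff] at hec
      rcases hec with ⟨h1, h2⟩ | ⟨h1, h2⟩
      · exact ⟨u, v, heS, h1, h2⟩
      · exact ⟨v, u, S.symm.symm _ _ heS, h2, h1⟩
    have hspec : ∀ {y w}, T.Adj y w → ∀ {u v}, S.Adj u v → hatProj D c u = gammaHat D Δ y →
        hatProj D c v = gammaHat D Δ w → ForkNumber.liftEnd D c S.spanningCoe y w = u := by
      intro y w hyw u v huv hu hv
      obtain ⟨v', h1, h2, h3⟩ := Classical.epsilon_spec (p := fun u => ∃ v,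
        S.spanningCoe.Adj u v ∧ hatProj D c u = gammaHat D Δ y ∧ hatProj D c v = gammaHat D Δ w)
        ⟨u, v, huv, hu, hv⟩
      exact huniq h1 huv (h2.trans hu.symm) (h3.trans hv.symm)
    refine ⟨ForkNumber.liftEnd D c S.spanningCoe, fun hyw => ?_, fun hyw => ?_, fun huv => ?_⟩
    · obtain ⟨u, v, h1, h2, h3⟩ := hex hyw
      rw [hspec hyw h1 h2 h3, h2]
    · obtain ⟨u, v, h1, h2, h3⟩ := hex hyw
      rw [hspec hyw h1 h2 h3, hspec hyw.symm h1.symm h3 h2]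
      exact h1
    · obtain ⟨y, w, hyw, h1, h2⟩ := exists_dart_of_hatGraph_adj (S.spanningCoe_le huv)
      exact ⟨y, w, hyw, hspec hyw huv h1 h2, hspec hyw.symm huv.symm h2 h1⟩
  · rintro ⟨E, h⟩ ⟨f, hf⟩
    induction f using Sym2.ind with
    | _ y w =>
    have hyw : T.Adj y w := hf
    refine ⟨⟨s(E y w, E w y), S.spanningCoe_le (h.adj hyw)⟩, ⟨h.adj hyw, ?_⟩, ?_⟩
    · rw [hatGamma_eq_iff, Sym2.map_mk, Sym2.map_mk, h.proj hyw, h.proj hyw.symm]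
    · rintro ⟨e, he⟩ ⟨heS, hec⟩
      rw [hatGamma_eq_iff] at hec
      refine Subtype.ext ?_
      induction e using Sym2.ind with
      | _ u v =>
      simp only [Sym2.map_mk, Sym2.eq_iff] at hec ⊢
      rcases hec with ⟨h1, h2⟩ | ⟨h1, h2⟩
      · exact Or.inl (h.eq_of_adj hyw heS h1 h2)
      · exact Or.inr (h.eq_of_adj hyw.symm heS h1 h2)

/-- As no vertex of `T` is isolated, a copy of `T` is determined by its edges. -/
theorem card_colSub_eq_card_copies [Nonempty VG] (hT : ∀ y, ∃ w, T.Adj y w) :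
    Nat.card (colSub T (hatGraph D Δ c) (hatGamma D Δ c)) = Nat.card (copies D c) := by
  have hmem : ∀ S ∈ colSub T (hatGraph D Δ c) (hatGamma D Δ c), S.spanningCoe ∈ copies D c := by
    rintro S ⟨⟨φ⟩, hS⟩
    refine ⟨S.spanningCoe_le, ⟨⟨⟨fun y => (φ.symm y).1,
      Subtype.val_injective.comp φ.symm.injective⟩, ?_⟩, ?_⟩,
      (colourful_iff_exists_isLift S).1 hS⟩
    · intro y w
      exact φ.symm.map_adj_iff
    · intro u v huv
      exact ⟨φ ⟨u, S.edge_vert huv⟩, by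
        change (φ.symm (φ _)).1 = u
        rw [RelIso.symm_apply_apply]⟩
  have hverts : ∀ S ∈ colSub T (hatGraph D Δ c) (hatGamma D Δ c),
      S.verts = {u | ∃ v, S.spanningCoe.Adj u v} := by
    rintro S ⟨⟨φ⟩, -⟩
    ext u
    refine ⟨fun hu => ?_, fun ⟨v, hv⟩ => S.edge_vert hv⟩
    obtain ⟨w, hw⟩ := hT (φ ⟨u, hu⟩)
    refine ⟨φ.symm w, ?_⟩
    have h1 := φ.symm.map_adj_iff.2 hw
    rwa [RelIso.symm_apply_apply] at h1
  refine Nat.card_congr (Equiv.ofBijective (fun S => ⟨S.1.spanningCoe, hmem S.1 S.2⟩) ⟨?_, ?_⟩)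
  · rintro ⟨S, hS⟩ ⟨S', hS'⟩ h
    have h1 : S.spanningCoe = S'.spanningCoe := congrArg Subtype.val h
    refine Subtype.ext (SimpleGraph.Subgraph.verts_spanningCoe_injective (Prod.ext ?_ h1))
    simp only
    rw [hverts S hS, hverts S' hS', h1]
  · rintro ⟨H, hle, ⟨f, hf⟩, hE⟩
    let S : (hatGraph D Δ c).Subgraph :=
      { verts := Set.range f
        Adj := H.Adj
        adj_sub := fun h => hle h
        edge_vert := fun {u v} h => hf u v h
        symm := H.symm }
    have hSH : S.spanningCoe = H := rfl
    refine ⟨⟨S, ⟨?_⟩, (colourful_iff_exists_isLift S).2 (by rwa [hSH])⟩, Subtype.ext hSH⟩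
    let φ : T ≃g S.coe :=
      { toEquiv := Equiv.ofInjective f f.injective
        map_rel_iff' := f.map_adj_iff }
    exact φ.symm

end Copies

/-! ### A pairing of the copies in which a root is attached to a leaf -/

section Pairing

/-- A set of even size has an involution without fixed points. -/
theorem exists_involution {α : Type*} {s : Set α} [Finite s] (hs : Even (Nat.card s)) :
    ∃ ι : α → α, ∀ u ∈ s, ι u ∈ s ∧ ι u ≠ u ∧ ι (ι u) = u := by
  classical
  obtain ⟨n, hn⟩ := hs
  obtain ⟨e⟩ : Nonempty (s ≃ Fin n × Bool) := Finite.card_eq.1 (by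
    rw [hn, Nat.card_prod]
    simp
    omega)
  refine ⟨fun u => if hu : u ∈ s then e.symm ((e ⟨u, hu⟩).1, !(e ⟨u, hu⟩).2) else u, ?_⟩
  intro u hu
  simp only [hu, dif_pos, Subtype.coe_prop, Subtype.coe_eta, Equiv.apply_symm_apply, Bool.not_not,
    Prod.mk.eta, Equiv.symm_apply_apply, and_true, true_and, ne_eq]
  intro h
  have h1 := (Equiv.symm_apply_eq e).1 (Subtype.ext (a2 := ⟨u, hu⟩) h)
  have h2 := congrArg Prod.snd h1
  simp at h2

variable {k a b : ℕ} {VT : Type*} {T : SimpleGraph VT} [T.LocallyFinite]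
  {D : DesignatedForks T k a b} {Δ : CubicGraph k} {VG : Type*} {G : SimpleGraph VG}
  {c : G →g qGraph Δ a b} [Nonempty VG] [Finite VT]

/-- The indices `i` such that the root at `s_i^1` is attached to a leaf of `H`. -/
def leafRoots (D : DesignatedForks T k a b) (c : VG → QVertex Δ a b)
    (H : SimpleGraph (VG ⊕ {z : VT // z ∉ D.F})) : Set (Fin k) :=
  {i | vdeg H (liftEnd D c H (D.src (i, 0)) (D.root (i, 0))) = 1}

section

variable {H : SimpleGraph (VG ⊕ {z : VT // z ∉ D.F})}
  {E : VT → VT → VG ⊕ {z : VT // z ∉ D.F}} {θ : Equiv.Perm (VG ⊕ {z : VT // z ∉ D.F})}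

omit [Nonempty VG] [Finite VT] in
theorem IsLift.comap (h : IsLift D c H E) (hθ : ∀ u, hatProj D c (θ u) = hatProj D c u) :
    IsLift D c (H.comap θ) fun y w => θ.symm (E y w) := by
  refine ⟨fun hyw => ?_, fun hyw => ?_, fun huv => ?_⟩
  · rw [← hθ, Equiv.apply_symm_apply, h.proj hyw]
  · rw [SimpleGraph.comap_adj, Equiv.apply_symm_apply, Equiv.apply_symm_apply]
    exact h.adj hyw
  · obtain ⟨y, w, hyw, h1, h2⟩ := h.exists_of_adj huv
    exact ⟨y, w, hyw, by simp [h1], by simp [h2]⟩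

omit [T.LocallyFinite] [Finite VT] in
theorem IsCopy.comap {V : Type*} {H : SimpleGraph V} {f : T ↪g H} (hf : IsCopy f)
    (θ : Equiv.Perm V) : ∃ f' : T ↪g H.comap θ, IsCopy f' := by
  refine ⟨f.trans (SimpleGraph.Iso.comap θ H).symm.toEmbedding, ?_⟩
  intro u v huv
  obtain ⟨y, hy⟩ := hf _ _ huv
  exact ⟨y, by
    change θ.symm (f y) = u
    rw [hy, Equiv.symm_apply_apply]⟩

theorem vdeg_comap {V : Type*} (H : SimpleGraph V) (θ : Equiv.Perm V) (u : V) :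
    vdeg (H.comap θ) (θ.symm u) = vdeg H u := by
  have h1 : (H.comap θ).neighborSet (θ.symm u) = θ.symm '' H.neighborSet u := by
    ext v
    rw [Equiv.image_symm_eq_preimage]
    simp
  rw [vdeg, h1, Set.ncard_image_of_injective _ θ.symm.injective, vdeg]

theorem IsLift.leafRoots_comap (h : IsLift D c H E)
    (hθ : ∀ u, hatProj D c (θ u) = hatProj D c u) :
    leafRoots D c (H.comap θ) = leafRoots D c H := by
  ext i
  have h1 := D.root_adj (i, 0)
  change vdeg _ _ = 1 ↔ vdeg _ _ = 1
  rw [(h.comap hθ).liftEnd_eq h1, h.liftEnd_eq h1, vdeg_comap]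

omit [Finite VT] in
theorem src_adj_pt (i : Fin k) : T.Adj (D.src (i, 0)) (D.pt (i, 0) .A 1) := by
  have h1 := D.pt_adj (i, 0) (r := .A) (t := 0) (D.len_pos (i, 0) .A)
  rwa [D.pt_zero] at h1

omit [Nonempty VG] in
theorem IsLift.pt_end_ne_root_end (h : IsLift D c H E) {i : Fin k}
    (hi : vdeg H (E (D.src (i, 0)) (D.root (i, 0))) = 1) :
    E (D.src (i, 0)) (D.pt (i, 0) .A 1) ≠ E (D.src (i, 0)) (D.root (i, 0)) := by
  intro he
  have h1 := (h.dart_unique hi (src_adj_pt i) (D.root_adj (i, 0)) he rfl).2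
  exact D.root_notMem (i, 0) (h1 ▸ D.pt_mem _ _ _)

end

variable [Finite VG]

open Classical in
/-- If the root at some `s_i^1` is attached to a leaf of `H`, then this leaf is exchanged with
another vertex `ι i h g` of the same colour, where `g` is the leaf and `h` the other vertex of `H`
of this colour. -/
def switch (D : DesignatedForks T k a b) (c : VG → QVertex Δ a b)
    (ι : Fin k → VG ⊕ {z : VT // z ∉ D.F} → VG ⊕ {z : VT // z ∉ D.F} → VG ⊕ {z : VT // z ∉ D.F})
    (H : SimpleGraph (VG ⊕ {z : VT // z ∉ D.F})) : SimpleGraph (VG ⊕ {z : VT // z ∉ D.F}) :=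
  if h : (leafRoots D c H).Nonempty then
    H.comap (Equiv.swap (liftEnd D c H (D.src (h.some, 0)) (D.root (h.some, 0)))
      (ι h.some (liftEnd D c H (D.src (h.some, 0)) (D.pt (h.some, 0) .A 1))
        (liftEnd D c H (D.src (h.some, 0)) (D.root (h.some, 0)))))
  else H

/-- The main property of `switch`: it is an involution on the copies of `T`, with the copies
without leaves at the roots as its fixed points. -/
theorem switch_spec (hT : T.IsTree) (hab : a ≤ b) (hk : 0 < k) [Fintype (QVertex Δ a b)]
    {ι : Fin k → VG ⊕ {z : VT // z ∉ D.F} → VG ⊕ {z : VT // z ∉ D.F} → VG ⊕ {z : VT // z ∉ D.F}}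
    (hι : ∀ i v, hatProj D c v = .inl (.branch i 0) → ∀ u, hatProj D c u = .inl (.branch i 0) →
      u ≠ v → hatProj D c (ι i v u) = .inl (.branch i 0) ∧ ι i v u ≠ v ∧ ι i v u ≠ u ∧
        ι i v (ι i v u) = u)
    {H : SimpleGraph (VG ⊕ {z : VT // z ∉ D.F})} (hH : H ∈ copies D c) :
    switch D c ι H ∈ copies D c ∧ switch D c ι (switch D c ι H) = H ∧
      (switch D c ι H = H ↔ leafRoots D c H = ∅) := by
  classical
  by_cases hne : (leafRoots D c H).Nonempty
  swap
  · have h1 : switch D c ι H = H := dif_neg hne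
    rw [h1, h1]
    exact ⟨hH, rfl, iff_of_true rfl (Set.not_nonempty_iff_eq_empty.1 hne)⟩
  obtain ⟨hle, ⟨f, hf⟩, ⟨E, hE⟩⟩ := hH
  have := Fintype.ofFinite VT
  have := Fintype.ofFinite VG
  have hB : Branching H := hf.branching hT.1 (D.vdeg_src (⟨0, hk⟩, 0))
  set i := hne.some with hi
  have hr := D.root_adj (i, 0)
  have hp : T.Adj (D.src (i, 0)) (D.pt (i, 0) .A 1) := src_adj_pt i
  have hleaf : vdeg H (E (D.src (i, 0)) (D.root (i, 0))) = 1 := by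
    have h1 : vdeg H (liftEnd D c H (D.src (i, 0)) (D.root (i, 0))) = 1 := by
      have h2 := hne.some_mem
      rwa [← hi] at h2
    rwa [hE.liftEnd_eq hr] at h1
  set g := E (D.src (i, 0)) (D.root (i, 0)) with hg
  set v := E (D.src (i, 0)) (D.pt (i, 0) .A 1) with hv
  have hgv : v ≠ g := hE.pt_end_ne_root_end hleaf
  have hgc : hatProj D c g = .inl (.branch i 0) := by rw [hg, hE.proj hr, gammaHat_src]
  have hvc : hatProj D c v = .inl (.branch i 0) := by rw [hv, hE.proj hp, gammaHat_src]
  obtain ⟨hc1, hv1, hg1, hinv⟩ := hι i v hvc g hgc hgv.symm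
  set g' := ι i v g with hg'
  set θ := Equiv.swap g g' with hθdef
  have hθ : ∀ u, hatProj D c (θ u) = hatProj D c u := by
    intro u
    rw [hθdef, Equiv.swap_apply_def]
    split_ifs with h1 h2
    · rw [h1, hc1, hgc]
    · rw [h2, hc1, hgc]
    · rfl
  have hsymm : θ.symm = θ := Equiv.symm_swap _ _
  have hθg : θ g = g' := Equiv.swap_apply_left _ _
  have hθv : θ v = v := Equiv.swap_apply_of_ne_of_ne hgv hv1.symm
  have hsw : switch D c ι H = H.comap θ := by
    rw [switch, dif_pos hne, hE.liftEnd_eq hp, hE.liftEnd_eq hr]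
  have hlift := hE.comap hθ
  have hroots := hE.leafRoots_comap hθ
  have hne' : (leafRoots D c (H.comap θ)).Nonempty := hroots ▸ hne
  have hi' : hne'.some = i := by
    rw [hi]
    congr 1
  have hsw' : switch D c ι (H.comap θ) = H := by
    rw [switch, dif_pos hne', hi', hlift.liftEnd_eq hp, hlift.liftEnd_eq hr, ← hg, ← hv, hsymm,
      hθg, hθv, hinv, Equiv.swap_comm, ← hθdef, SimpleGraph.comap_comap]
    have : (θ : _ → _) ∘ θ = id := by
      funext u
      exact Equiv.swap_apply_self g g' u
    rw [this, SimpleGraph.comap_id]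
  refine ⟨?_, by rw [hsw, hsw'], iff_of_false ?_ hne.ne_empty⟩
  · rw [hsw]
    refine ⟨?_, hf.comap θ, _, hlift⟩
    intro u u' huu'
    obtain ⟨y, w, hyw, h1, h2⟩ := hlift.exists_of_adj huu'
    have hu := hlift.proj hyw
    have hu' := hlift.proj hyw.symm
    rw [h1] at hu
    rw [h2] at hu'
    by_cases hy : y ∈ D.F
    · by_cases hw : w ∈ D.F
      · -- only the edge to the root is moved
        have hfix : ∀ {y w}, T.Adj y w → w ∈ D.F → θ (E y w) = E y w := by
          intro y w hyw hw
          have h3 : E y w ≠ g := by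
            intro h4
            have h5 := (hE.dart_unique hleaf hyw hr h4 rfl).2
            exact D.root_notMem (i, 0) (h5 ▸ hw)
          refine Equiv.swap_apply_of_ne_of_ne h3 ?_
          intro h4
          have h5 : E y w ∈ fibre D c H (.branch i 0) :=
            mem_fibre.2 ⟨by rw [h4, hc1], hE.vdeg_pos hyw⟩
          rcases hE.eq_or_eq_of_root_leaf hB hT hf hab hleaf h5 with h6 | h6
          · exact h3 h6
          · exact hv1 (h4.symm.trans h6)
        rw [hsymm, hfix hyw hw] at h1
        rw [hsymm, hfix hyw.symm hy] at h2
        rw [← h1, ← h2]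
        exact hle (hE.adj hyw)
      · exact (hatGraph_adj_of_notMem hyw.symm hw hu' hu).symm
    · exact hatGraph_adj_of_notMem hyw hy hu hu'
  · intro h1
    rw [hsw] at h1
    have h2 := hlift.liftEnd_eq hr
    rw [h1, hE.liftEnd_eq hr, hsymm, ← hg, hθg] at h2
    exact hg1 h2.symm

/-- The copies in which a root is attached to a leaf cancel modulo `2`. -/
theorem card_copies_modEq (hT : T.IsTree) (hab : a ≤ b) (hk : 0 < k)
    (hodd : ∀ q : QVertex Δ a b, Odd (Nat.card (c ⁻¹' {q}))) [Fintype (QVertex Δ a b)] :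
    Nat.card (copies D c) ≡ Nat.card {H // H ∈ copies D c ∧ leafRoots D c H = ∅} [MOD 2] := by
  classical
  have hι : ∀ i v, ∃ ι : VG ⊕ {z : VT // z ∉ D.F} → VG ⊕ {z : VT // z ∉ D.F},
      hatProj D c v = .inl (.branch i 0) → ∀ u, hatProj D c u = .inl (.branch i 0) →
      u ≠ v → hatProj D c (ι u) = .inl (.branch i 0) ∧ ι u ≠ v ∧ ι u ≠ u ∧ ι (ι u) = u := by
    intro i v
    by_cases hv : hatProj D c v = .inl (.branch i 0)
    · have h1 : {u | hatProj D c u = .inl (.branch i 0)} = Sum.inl '' (c ⁻¹' {.branch i 0}) := by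
        ext (g | z)
        · simp [hatProj]
        · simp [hatProj]
      have h2 : Odd {u | hatProj D c u = .inl (.branch i 0)}.ncard := by
        rw [h1, Set.ncard_image_of_injective _ Sum.inl_injective]
        exact hodd _
      have h3 : Even (Nat.card ↥({u | hatProj D c u = .inl (.branch i 0)} \ {v})) := by
        have h4 := Set.ncard_sdiff_singleton_add_one (a := v)
          (s := {u | hatProj D c u = .inl (.branch i 0)}) hv
        change Even (Set.ncard _)
        rw [← h4] at h2
        simpa [Nat.odd_add_one] using h2
      obtain ⟨ι, hι⟩ := exists_involution h3
      refine ⟨ι, fun _ u hu huv => ?_⟩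
      obtain ⟨h5, h6, h7⟩ := hι u ⟨hu, huv⟩
      exact ⟨h5.1, h5.2, h6, h7⟩
    · exact ⟨id, fun h => absurd h hv⟩
  choose ι hι using hι
  have hspec := fun {H} (hH : H ∈ copies D c) => switch_spec hT hab hk hι hH
  have := Fintype.ofFinite (copies D c)
  let σ : Function.End (copies D c) := fun H => ⟨switch D c ι H.1, (hspec H.2).1⟩
  have hσ : σ ^ 2 ^ 1 = 1 := by
    funext H
    exact Subtype.ext (hspec H.2).2.1
  have h1 := Equiv.Perm.card_fixedPoints_modEq (p := 2) hσ
  rw [← Nat.card_eq_fintype_card, ← Nat.card_eq_fintype_card] at h1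
  refine h1.trans (congrArg (· % 2) (Nat.card_congr ?_))
  refine (Equiv.subtypeEquivRight fun H => ?_).trans (Equiv.subtypeSubtypeEquivSubtypeInter
    (fun H => H ∈ copies D c) fun H => leafRoots D c H = ∅)
  rw [← (hspec H.2).2.2]
  exact Subtype.ext_iff

end Pairing

/-! ### The remaining copies as embeddings of `T[F]` -/

section Good

variable {k a b : ℕ} {VT : Type*} {T : SimpleGraph VT} [T.LocallyFinite]
  (D : DesignatedForks T k a b) (Δ : CubicGraph k) {VG : Type*} {G : SimpleGraph VG}
  (c : G →g qGraph Δ a b)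

/-- The map `γ` as a colouring of `T[F]`. -/
def gammaHom : T.induce D.F →g qGraph Δ a b where
  toFun := gamma D Δ
  map_rel' := by
    intro y w hyw
    obtain ⟨⟨i, j⟩, r, t, h1⟩ := D.induce_edge s(y, w) hyw
    have h2 := congrArg (Sym2.map (gamma D Δ)) h1
    rw [gammaE_ray, Sym2.map_mk] at h2
    rw [← SimpleGraph.mem_edgeSet, h2, qGraph, SimpleGraph.edgeSet_fromEdgeSet]
    refine ⟨⟨i, j, r, t, t.2, rfl⟩, ?_⟩
    rw [Sym2.mem_diagSet, Sym2.mk_isDiag_iff]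
    exact qGraph_gadgetPath_ne Δ t.2

open Classical in
/-- The extension of a map from `F` to `V(G)` by the identity on the vertices outside of `F`. -/
def extend (ψ : D.F → VG) : VT → VG ⊕ {z : VT // z ∉ D.F} :=
  fun y => if h : y ∈ D.F then .inl (ψ ⟨y, h⟩) else .inr ⟨y, h⟩

variable {D Δ c}

theorem extend_mem (ψ : D.F → VG) (y : D.F) : extend D ψ y = .inl (ψ y) := dif_pos y.2

theorem extend_notMem (ψ : D.F → VG) (z : {z : VT // z ∉ D.F}) : extend D ψ z = .inr z :=
  dif_neg z.2

theorem extend_injective {ψ : D.F → VG} (hψ : Function.Injective ψ) :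
    Function.Injective (extend D ψ) := by
  intro y y' h
  by_cases hy : y ∈ D.F <;> by_cases hy' : y' ∈ D.F <;>
    simp only [extend, hy, hy', dif_pos, dif_neg, not_false_eq_true] at h
  · exact congrArg Subtype.val (hψ (Sum.inl_injective h))
  · cases h
  · cases h
  · exact congrArg Subtype.val (Sum.inr_injective h)

theorem hatProj_extend {ψ : D.F → VG} (hψ : ∀ y, c (ψ y) = gamma D Δ y) (y : VT) :
    hatProj D c (extend D ψ y) = gammaHat D Δ y := by
  by_cases hy : y ∈ D.F
  · rw [extend_mem ψ ⟨y, hy⟩, gammaHat_mem D Δ ⟨y, hy⟩, ← hψ]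
    rfl
  · rw [extend_notMem ψ ⟨y, hy⟩, gammaHat_notMem D Δ ⟨y, hy⟩]
    rfl

theorem map_extend_adj {ψ : D.F → VG} (hψ : Function.Injective ψ)
    {u v : VG ⊕ {z : VT // z ∉ D.F}} : (T.map (extend D ψ)).Adj u v ↔
      ∃ y w, T.Adj y w ∧ extend D ψ y = u ∧ extend D ψ w = v :=
  SimpleGraph.map_adj ⟨extend D ψ, extend_injective hψ⟩ T u v

/-- The image of `T` is a copy of `T`. -/
theorem exists_isCopy_map_extend {ψ : D.F → VG} (hψ : Function.Injective ψ) :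
    ∃ f : T ↪g T.map (extend D ψ), IsCopy f ∧ ⇑f = extend D ψ := by
  refine ⟨SimpleGraph.Embedding.map ⟨_, extend_injective hψ⟩ T, ?_, rfl⟩
  intro u v huv
  obtain ⟨y, w, -, h1, -⟩ := (map_extend_adj hψ).1 huv
  exact ⟨y, h1⟩

/-- The image of `T` under the extension of `ψ` is a lift without splits. -/
theorem extend_isLift {ψ : D.F → VG} (hψ : Function.Injective ψ)
    (hc : ∀ y, c (ψ y) = gamma D Δ y) :
    IsLift D c (T.map (extend D ψ)) fun y _ => extend D ψ y := by
  refine ⟨fun _ => hatProj_extend hc _, fun hyw => ?_, fun huv => ?_⟩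
  · exact (map_extend_adj hψ).2 ⟨_, _, hyw, rfl, rfl⟩
  · obtain ⟨y, w, hyw, h1, h2⟩ := (map_extend_adj hψ).1 huv
    exact ⟨y, w, hyw, h1, h2⟩

theorem extend_mem_copies {ψ : T.induce D.F →g G} (hψ : Function.Injective ψ)
    (hc : ∀ y, c (ψ y) = gamma D Δ y) : T.map (extend D ψ) ∈ copies D c := by
  have hlift := extend_isLift (c := c) hψ hc
  refine ⟨?_, (exists_isCopy_map_extend hψ).imp fun _ hf => hf.1, _, hlift⟩
  intro u v huv
  obtain ⟨y, w, hyw, rfl, rfl⟩ := hlift.exists_of_adj huv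
  have h1 := hatProj_extend (c := c) hc
  by_cases hy : y ∈ D.F
  · by_cases hw : w ∈ D.F
    · rw [extend_mem ψ ⟨y, hy⟩, extend_mem ψ ⟨w, hw⟩]
      exact ψ.map_adj (v := ⟨y, hy⟩) (w := ⟨w, hw⟩) hyw
    · exact (hatGraph_adj_of_notMem hyw.symm hw (h1 w) (h1 y)).symm
  · exact hatGraph_adj_of_notMem hyw hy (h1 y) (h1 w)

/-- The copies in which no root is attached to a leaf arise from the embeddings of `T[F]`: nothing
is split in such a copy, so that it is the image of `T` under an extension of a map from `F` to
`V(G)`. -/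
theorem card_good_copies [Nonempty VG] [Finite VT] [Finite VG] [Fintype (QVertex Δ a b)]
    (hT : T.IsTree) (hnb : ∀ y, ∃ w, T.Adj y w) (hab : a ≤ b) (hk : 0 < k) :
    Nat.card {H // H ∈ copies D c ∧ leafRoots D c H = ∅} =
      Nat.card (colEmb (gammaHom D Δ) c) := by
  have hgood : ∀ ψ ∈ colEmb (gammaHom D Δ) c,
      leafRoots D c (T.map (extend D ψ)) = ∅ := by
    rintro ψ ⟨hψ, hc⟩
    obtain ⟨f, hf⟩ := exists_isCopy_map_extend (T := T) hψ
    refine Set.eq_empty_of_forall_notMem fun i hi => ?_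
    have h1 : vdeg _ _ = 1 := hi
    rw [(extend_isLift (c := c) hψ hc).liftEnd_eq (D.root_adj (i, 0)), ← congrFun hf.2,
      hf.1.vdeg_apply] at h1
    have := D.vdeg_src (i, 0)
    omega
  symm
  refine Nat.card_congr (Equiv.ofBijective (fun ψ =>
    ⟨T.map (extend D ψ.1), extend_mem_copies ψ.2.1 ψ.2.2, hgood ψ.1 ψ.2⟩) ⟨?_, ?_⟩)
  · rintro ⟨ψ, hψ, hc⟩ ⟨ψ', hψ', hc'⟩ h
    have h1 : T.map (extend D ψ) = T.map (extend D ψ') :=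
      congrArg Subtype.val h
    refine Subtype.ext (RelHom.ext fun y => ?_)
    obtain ⟨w, hw⟩ := hnb y
    have h2 := (extend_isLift (c := c) hψ hc).liftEnd_eq hw
    rw [h1, (extend_isLift (c := c) hψ' hc').liftEnd_eq hw, extend_mem, extend_mem] at h2
    exact (Sum.inl_injective h2).symm
  · rintro ⟨H, ⟨hle, ⟨f, hf⟩, ⟨E, hE⟩⟩, hH⟩
    have := Fintype.ofFinite VT
    have := Fintype.ofFinite VG
    have hB : Branching H := hf.branching hT.1 (D.vdeg_src (⟨0, hk⟩, 0))
    have hEq := fun {y w w'} => hE.eq_of_root_not_leaf hB hT hf hab (y := y) (w := w) (w' := w') (by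
      intro i hi
      have h1 : i ∈ leafRoots D c H := by
        change vdeg _ _ = 1
        rw [hE.liftEnd_eq (D.root_adj (i, 0)), hi]
      rw [hH] at h1
      exact h1)
    choose nb hadj using hnb
    let F : VT → VG ⊕ {z : VT // z ∉ D.F} := fun y => E y (nb y)
    have hF : ∀ {y w}, T.Adj y w → E y w = F y := fun hyw => hEq hyw (hadj _)
    have hFadj : ∀ {y w}, T.Adj y w → H.Adj (F y) (F w) := by
      intro y w hyw
      rw [← hF hyw, ← hF hyw.symm]
      exact hE.adj hyw
    have hFproj : ∀ y, hatProj D c (F y) = gammaHat D Δ y := fun y => hE.proj (hadj y)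
    -- every vertex of the copy is of the form `F y`, so that `F` is injective by counting
    have hsurj : ∀ z, ∃ y, F y = f z := by
      intro z
      obtain ⟨y, w, hyw, h1, -⟩ := hE.exists_of_adj (f.map_adj_iff.2 (hadj z))
      exact ⟨y, by rw [← hF hyw, h1]⟩
    choose σ hσ using hsurj
    have hσinj : Function.Injective σ := by
      intro z z' h
      apply f.injective
      rw [← hσ, ← hσ, h]
    have hFinj : Function.Injective F := by
      intro y y' h
      obtain ⟨z, rfl⟩ := Finite.surjective_of_injective hσinj y
      obtain ⟨z', rfl⟩ := Finite.surjective_of_injective hσinj y'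
      rw [hσ, hσ] at h
      rw [f.injective h]
    have hin : ∀ y : D.F, ∃ g, F y = .inl g := by
      intro y
      have h1 := hFproj y
      rw [gammaHat_mem] at h1
      generalize F y = u at h1
      rcases u with g | z
      · exact ⟨g, rfl⟩
      · cases h1
    choose ψ hψ using hin
    have hext : extend D ψ = F := by
      funext y
      by_cases hy : y ∈ D.F
      · rw [extend_mem ψ ⟨y, hy⟩]
        exact (hψ ⟨y, hy⟩).symm
      · rw [extend_notMem ψ ⟨y, hy⟩]
        exact (hE.eq_inr (hadj y) hy).symm
    let ψ' : T.induce D.F →g G :=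
      { toFun := ψ
        map_rel' := by
          intro y w hyw
          have h1 := hle (hFadj (y := y) (w := w) hyw)
          rw [hψ, hψ] at h1
          exact h1 }
    have hinj : Function.Injective ψ' := by
      intro y y' h
      refine Subtype.ext (hFinj ?_)
      rw [hψ, hψ]
      exact congrArg _ h
    have hc : ∀ y, c (ψ' y) = gamma D Δ y := by
      intro y
      have h1 := hFproj y
      rw [hψ, gammaHat_mem] at h1
      exact Sum.inl_injective h1
    refine ⟨⟨ψ', hinj, hc⟩, Subtype.ext ?_⟩
    ext u v
    rw [map_extend_adj hinj]
    constructor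
    · rintro ⟨y, w, hyw, rfl, rfl⟩
      change H.Adj (extend D ψ y) (extend D ψ w)
      rw [hext]
      exact hFadj hyw
    · intro huv
      obtain ⟨y, w, hyw, rfl, rfl⟩ := hE.exists_of_adj huv
      refine ⟨y, w, hyw, ?_, ?_⟩
      · change extend D ψ y = _
        rw [hext, hF hyw]
      · change extend D ψ w = _
        rw [hext, hF hyw.symm]

end Good

/-! ### The fractured graph is a copy of `T[F]` -/

section Fractured

variable {k a b : ℕ} {VT : Type*} {T : SimpleGraph VT} [T.LocallyFinite]
  (D : DesignatedForks T k a b) (Δ : CubicGraph k)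

/-- Two edges of `Q` at a vertex `q` are in the same block of `τ` if and only if the corresponding
edges of `T[F]` meet over `q`. -/
theorem tau_rel_iff {q : QVertex Δ a b} {y w y' w' : D.F} (hyw : T.Adj y w) (hyw' : T.Adj y' w')
    (hy : gamma D Δ y = q) (hy' : gamma D Δ y' = q)
    (m : s(q, gamma D Δ w) ∈ (qGraph Δ a b).incidenceSet q)
    (m' : s(q, gamma D Δ w') ∈ (qGraph Δ a b).incidenceSet q) :
    tau Δ a b q ⟨_, m⟩ ⟨_, m'⟩ ↔ y = y' := by
  have hg : gammaHat D Δ y = .inl q := by rw [gammaHat_mem, hy]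
  have hg' : gammaHat D Δ y' = .inl q := by rw [gammaHat_mem, hy']
  cases q with
  | port e =>
    have hlast : ∀ {y}, gammaHat D Δ y = .inl (.port e) →
        ∃ p r, y = D.pt p r (r.len a b) := by
      intro y h
      rcases gammaHat_cases D Δ h with ⟨p, rfl, h1⟩ | ⟨p, r', t', h0', ht', rfl, h1⟩ |
        ⟨p, r', rfl, h1⟩
      · cases h1
      · cases h1
      · exact ⟨p, r', rfl⟩
    change (⟨_, m⟩ : (qGraph Δ a b).incidenceSet _) = ⟨_, m'⟩ ↔ _
    rw [Subtype.mk.injEq, Sym2.congr_right]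
    constructor
    · intro h
      refine Subtype.ext (gammaHat_dart_inj D Δ hyw hyw' (hg.trans hg'.symm) ?_).1
      rw [gammaHat_mem, gammaHat_mem, h]
    · rintro rfl
      obtain ⟨p, r, h1⟩ := hlast hg
      have h2 := D.vdeg_pt_last p r
      rw [← h1] at h2
      rw [Subtype.ext (eq_of_vdeg_one h2 hyw hyw')]
  | inner i j r t =>
    refine iff_of_true trivial (Subtype.ext ?_)
    have h1 : (⟨t.val + 1 - 1, by omega⟩ : Fin (r.len a b - 1)) = t := rfl
    rw [← h1] at hg hg'
    have h0 : t.val + 1 < r.len a b := by omega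
    rw [gammaHat_eq_inner D Δ t.val.succ_pos h0 hg, gammaHat_eq_inner D Δ t.val.succ_pos h0 hg']
  | branch i j =>
    have hj : j = 0 ∨ j = 1 := by omega
    rcases hj with rfl | rfl
    · have hpos : 0 < a := D.len_pos (i, 0) .A
      have hxadj : T.Adj (D.pt (i, 1) .A a) (D.pt (i, 1) .A (a - 1)) := by
        have h1 := D.pt_adj (i, 1) (r := .A) (t := a - 1) (by change a - 1 < a; omega)
        rw [show a - 1 + 1 = a by omega] at h1
        exact h1.symm
      have hxg := gammaHat_pt D Δ (i, 1) (r := .A) (t := a - 1) (by change a - 1 ≤ a; omega)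
      have hne : D.src (i, 0) ≠ D.pt (i, 1) .A a := by
        intro h1
        have h2 := D.vdeg_src (i, 0)
        have h3 := D.vdeg_pt_last (i, 1) .A
        rw [h1] at h2
        simp only [Arm.len] at h3
        omega
      have key : ∀ {y w : D.F}, T.Adj y w → gammaHat D Δ y = .inl (.branch i 0) →
          ((s(.branch i 0, gamma D Δ w) : Sym2 (QVertex Δ a b)) =
            s(.branch i 0, gadgetPath Δ a b i 1 .A (a - 1)) ↔ y.1 = D.pt (i, 1) .A a) := by
        intro y w hyw hg
        rw [Sym2.congr_right]
        constructor
        · intro h1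
          refine (gammaHat_dart_inj D Δ hyw hxadj (hg.trans (gammaHat_x_end D Δ i).symm) ?_).1
          rw [gammaHat_mem, h1, hxg]
        · intro h1
          rw [h1] at hyw
          rcases D.pt_neighbour (r := .A) hpos (le_refl a) hyw with h2 | ⟨h2, -⟩
          · rw [← h2, gammaHat_mem] at hxg
            exact Sum.inl_injective hxg
          · exact absurd h2 (lt_irrefl a)
      change ((s(.branch i 0, gamma D Δ w) : Sym2 (QVertex Δ a b)) =
            s(.branch i 0, gadgetPath Δ a b i 1 .A (a - 1))) =
          ((s(.branch i 0, gamma D Δ w') : Sym2 (QVertex Δ a b)) =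
            s(.branch i 0, gadgetPath Δ a b i 1 .A (a - 1))) ↔ y = y'
      rw [eq_iff_iff, key hyw hg, key hyw' hg', Subtype.ext_iff]
      rcases gammaHat_eq_branch_zero D Δ hg with h1 | h1 <;>
      rcases gammaHat_eq_branch_zero D Δ hg' with h2 | h2 <;>
      rw [h1, h2] <;> simp [hne, hne.symm]
    · exact iff_of_true trivial (Subtype.ext
        ((gammaHat_eq_branch_one D Δ hg).trans (gammaHat_eq_branch_one D Δ hg').symm))

theorem mem_incidenceSet_gamma {y w : D.F} (hyw : T.Adj y w) :
    s(gamma D Δ y, gamma D Δ w) ∈ (qGraph Δ a b).incidenceSet (gamma D Δ y) :=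
  ⟨(gammaHom D Δ).map_adj (v := y) (w := w) hyw, Sym2.mem_mk_left _ _⟩

/-- The vertex of the fractured graph that belongs to the vertex `y` of `T[F]`. -/
def fracturedVertex (nb : D.F → D.F) (hnb : ∀ y : D.F, T.Adj y (nb y)) (y : D.F) :
    (tau Δ a b).Vertex :=
  ⟨gamma D Δ y, Quotient.mk _ ⟨_, mem_incidenceSet_gamma D Δ (hnb y)⟩⟩

theorem exists_adj_mem_F (y : D.F) : ∃ w : D.F, T.Adj y w := by
  obtain ⟨y, hy⟩ := y
  rcases D.mem_F_cases hy with ⟨p, rfl⟩ | ⟨p, r, t, h0, ht, rfl⟩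
  · have h1 := D.pt_adj p (r := .A) (t := 0) (D.len_pos p .A)
    rw [D.pt_zero] at h1
    exact ⟨⟨_, D.pt_mem _ _ _⟩, h1⟩
  · have h1 := D.pt_adj p (r := r) (t := t - 1) (by omega)
    rw [show t - 1 + 1 = t by omega] at h1
    exact ⟨⟨_, D.pt_mem _ _ _⟩, h1.symm⟩

/-- The fractured graph `Q_τ` with its canonical colouring is isomorphic to `T[F]` with the
colouring `γ`. -/
theorem exists_iso_fractured : ∃ φ : T.induce D.F ≃g (tau Δ a b).graph,
    ∀ y, (tau Δ a b).canonicalColouring (φ y) = gammaHom D Δ y := by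
  choose nb hnb using exists_adj_mem_F D
  have hmk : ∀ {y w : D.F} (hyw : T.Adj y w), (fracturedVertex D Δ nb hnb y).2 =
      Quotient.mk _ ⟨_, mem_incidenceSet_gamma D Δ hyw⟩ := by
    intro y w hyw
    exact Quotient.sound ((tau_rel_iff D Δ (hnb y) hyw rfl rfl _ _).2 rfl)
  have hinj : Function.Injective (fracturedVertex D Δ nb hnb) := by
    intro y y' h
    have hq : gamma D Δ y = gamma D Δ y' := congrArg Sigma.fst h
    have hex : ∀ q, gamma D Δ y = q → ∃ m, fracturedVertex D Δ nb hnb y =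
        ⟨q, Quotient.mk _ ⟨s(q, gamma D Δ (nb y)), m⟩⟩ := by
      rintro q rfl
      exact ⟨_, rfl⟩
    obtain ⟨m, h1⟩ := hex _ hq
    exact (tau_rel_iff D Δ (hnb y) (hnb y') hq rfl m (mem_incidenceSet_gamma D Δ (hnb y'))).1
      (Quotient.exact (eq_of_heq (Sigma.mk.inj (h1.symm.trans h)).2))
  have hsurj : Function.Surjective (fracturedVertex D Δ nb hnb) := by
    rintro ⟨q, B⟩
    induction B using Quotient.ind with
    | _ B =>
    obtain ⟨e, he, hq⟩ := B
    obtain ⟨f, hf, rfl⟩ := gammaE_surjective D Δ e he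
    have key : ∀ y w : D.F, T.Adj y w → ∀ m : s(q, gamma D Δ w) ∈ (qGraph Δ a b).incidenceSet q,
        q = gamma D Δ y → ∃ y', fracturedVertex D Δ nb hnb y' =
          ⟨q, Quotient.mk _ ⟨s(q, gamma D Δ w), m⟩⟩ := by
      rintro y w hyw m rfl
      exact ⟨y, Sigma.ext rfl (heq_of_eq (hmk hyw))⟩
    induction f using Sym2.ind with
    | _ y w =>
    have hyw : T.Adj y w := hf
    rcases Sym2.mem_iff.1 hq with rfl | rfl
    · exact key y w hyw ⟨he, hq⟩ rfl
    · obtain ⟨y', h⟩ := key w y hyw.symm ⟨by rw [Sym2.eq_swap]; exact he, by simp⟩ rfl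
      refine ⟨y', h.trans (Sigma.ext rfl (heq_of_eq ?_))⟩
      exact congrArg _ (Subtype.ext Sym2.eq_swap)
  refine ⟨⟨Equiv.ofBijective _ ⟨hinj, hsurj⟩, ?_⟩, fun y => rfl⟩
  intro y w
  change (tau Δ a b).graph.Adj (fracturedVertex D Δ nb hnb y) (fracturedVertex D Δ nb hnb w) ↔
    T.Adj y w
  constructor
  · rintro ⟨e, hey, hew, he, h1, h2⟩
    obtain ⟨f, hf, hfe⟩ := gammaE_surjective D Δ e hey.1
    have key : ∀ y1 w1 : D.F, T.Adj y1 w1 → gamma D Δ y1 = gamma D Δ y →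
        gamma D Δ w1 = gamma D Δ w → T.Adj y w := by
      intro y1 w1 h3 hy1 hw1
      have hy2 : y = y1 := by
        refine (tau_rel_iff D Δ (hnb y) h3 rfl hy1 (mem_incidenceSet_gamma D Δ (hnb y))
          (hy1 ▸ mem_incidenceSet_gamma D Δ h3)).1 (Quotient.exact (h1.trans ?_))
        congr 2
        rw [he, hw1]
        rfl
      have hw2 : w = w1 := by
        refine (tau_rel_iff D Δ (hnb w) h3.symm rfl hw1 (mem_incidenceSet_gamma D Δ (hnb w))
          (hw1 ▸ mem_incidenceSet_gamma D Δ h3.symm)).1 (Quotient.exact (h2.trans ?_))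
        congr 2
        rw [he, hy1, Sym2.eq_swap]
        rfl
      rw [hy2, hw2]
      exact h3
    induction f using Sym2.ind with
    | _ y1 w1 =>
    have h3 : T.Adj y1 w1 := hf
    rw [he, Sym2.map_mk, Sym2.eq_iff] at hfe
    rcases hfe with ⟨h4, h5⟩ | ⟨h4, h5⟩
    · exact key y1 w1 h3 h4 h5
    · exact key w1 y1 h3.symm h5 h4
  · intro hyw
    have m := mem_incidenceSet_gamma D Δ hyw.symm
    rw [Sym2.eq_swap] at m
    refine ⟨s(gamma D Δ y, gamma D Δ w), mem_incidenceSet_gamma D Δ hyw, m, rfl, hmk hyw, ?_⟩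
    rw [hmk hyw.symm]
    congr 2
    exact Sym2.eq_swap

theorem card_colEmb_gammaHom {VG : Type*} {G : SimpleGraph VG} (c : G →g qGraph Δ a b) :
    Nat.card (colEmb (gammaHom D Δ) c) =
      Nat.card (colEmb (tau Δ a b).canonicalColouring c) := by
  obtain ⟨φ, hφ⟩ := exists_iso_fractured D Δ
  refine Nat.card_congr
    { toFun := fun ψ => ⟨ψ.1.comp φ.symm.toHom, ψ.2.1.comp φ.symm.injective, fun x => ?_⟩
      invFun := fun ψ => ⟨ψ.1.comp φ.toHom, ψ.2.1.comp φ.injective, fun y => ?_⟩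
      left_inv := fun ψ => Subtype.ext (RelHom.ext fun y => ?_)
      right_inv := fun ψ => Subtype.ext (RelHom.ext fun y => ?_) }
  · refine (ψ.2.2 (φ.symm x)).trans ?_
    rw [← hφ, RelIso.apply_symm_apply]
  · exact (ψ.2.2 (φ y)).trans (hφ y)
  · exact congrArg ψ.1 (φ.symm_apply_apply y)
  · exact congrArg ψ.1 (φ.apply_symm_apply y)

end Fractured

end

end ForkNumber

theorem lemma4p20 {k a b : ℕ} (hk : 2 ≤ k) (ha : 0 < a) (hab : a ≤ b)
    {VT : Type*} [Finite VT] (T : SimpleGraph VT) [T.LocallyFinite] (hT : T.IsTree)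
    (D : ForkNumber.DesignatedForks T k a b) (Δ : ForkNumber.CubicGraph k)
    {VG : Type*} [Finite VG] (G : SimpleGraph VG) (c : G →g ForkNumber.qGraph Δ a b)
    (hodd : ∀ v : ForkNumber.QVertex Δ a b, Odd (Nat.card (c ⁻¹' {v}))) :
    Nat.card (ForkNumber.colSub T (ForkNumber.hatGraph D Δ c) (ForkNumber.hatGamma D Δ c)) ≡
      Nat.card (ForkNumber.colEmb (ForkNumber.tau Δ a b).canonicalColouring c) [MOD 2] := by
  have hk0 : 0 < k := by omega
  -- the classes of the colouring are not empty, so that `Q` is finite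
  have hsurj : Function.Surjective c := by
    intro v
    by_contra hv
    have : IsEmpty (c ⁻¹' {v}) := ⟨fun g => hv ⟨g.1, g.2⟩⟩
    have h1 := hodd v
    rw [Nat.card_of_isEmpty] at h1
    exact absurd h1 (by decide)
  have : Nonempty VG := ⟨(hsurj (.branch ⟨0, hk0⟩ 0)).choose⟩
  have : Finite (ForkNumber.QVertex Δ a b) := Finite.of_surjective c hsurj
  have := Fintype.ofFinite (ForkNumber.QVertex Δ a b)
  have : Nontrivial VT := ⟨_, _, (D.root_adj (⟨0, hk0⟩, 0)).ne⟩
  have hnb : ∀ y, ∃ w, T.Adj y w := fun y => hT.1.preconnected.exists_adj_of_nontrivial y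
  rw [ForkNumber.card_colSub_eq_card_copies hnb, ← ForkNumber.card_colEmb_gammaHom D Δ c,
    ← ForkNumber.card_good_copies hT hnb hab hk0]
  exact ForkNumber.card_copies_modEq hT hab hk0 hodd
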